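/- Let $N\ge 2$ and $0\le\tau<1$. Let $G_1,G_2$ be independent $N\times N$ real Ginibre matrices (all entries i.i.d. real standard normal) and let $$G_\tau=\sqrt{\tfrac{1+\tau}{2}}\,G_1+i\sqrt{\tfrac{1-\tau}{2}}\,G_2$$ be the interpolating Ginibre ensemble. Its mean eigenvalue density $p_N^{(\tau)}(x,y)$ is the density, with respect to Lebesgue measure $dx\,dy$ on $\mathbb C$ ($z=x+iy$), of the expectation of the empirical eigenvalue measure $\sum_{a=1}^N\delta_{z_a}$, where $z_1,\dots,z_N$ are the eigenvalues of $G_\tau$ with algebraic multiplicity; that is, for every Borel set $A\subseteq\mathbb C$ the expected number of eigenvalues in $A$ equals $\int_A p_N^{(\tau)}(x,y)\,dx\,dy$ (so the total mass is $N$). Write $\Gamma(s,a)=\int_a^\infty t^{s-1}e^{-t}\,dt$. Then this density exists, is nonnegative, has a continuous version, and this version is given at every point by $$p_N^{(\tau)}(x,y)=\frac{1}{\pi\,\Gamma(N-1)\sqrt{1-\tau^2}}\int_0^1\frac{w^{N-2}}{\sqrt{1-\tau^2w^2}}\;e^{\tau(1-w^2)\left(\frac{x^2}{1+\tau}-\frac{y^2}{1-\tau}\right)}$$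 $$\times\Big\{\Gamma(N,x^2+y^2)(1-\tau^2w^2)+\Gamma(N-1,x^2+y^2)\,\tau w^2\big[\tau(x^2+y^2)(1+w^2)-2(x^2-y^2)\big]\Big\}\,dw ,$$ where the integral converges. In particular, for $\tau=0$ it reduces to the density of the complex Ginibre ensemble, $$p_N^{(0)}(x,y)=\frac1\pi e^{-(x^2+y^2)}\sum_{n=0}^{N-1}\frac{(x^2+y^2)^n}{n!}.$$ -/

import Mathlib

open MeasureTheory ProbabilityTheory

noncomputable section

/-- The law of a pair `(G₁, G₂)` of independent real Ginibre matrices of size `N`: all entries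
are independent real standard normal variables. -/
def realGinibrePair (N : ℕ) :
    Measure ((Fin N → Fin N → ℝ) × (Fin N → Fin N → ℝ)) :=
  (Measure.pi fun _ => Measure.pi fun _ => gaussianReal 0 1).prod
    (Measure.pi fun _ => Measure.pi fun _ => gaussianReal 0 1)

/-- The matrix `G_τ = √((1+τ)/2) G₁ + i √((1-τ)/2) G₂` of the interpolating Ginibre ensemble,
as a function of the pair `(G₁, G₂)`. -/
def interpolatingGinibre (N : ℕ) (τ : ℝ)
    (G : (Fin N → Fin N → ℝ) × (Fin N → Fin N → ℝ)) : Matrix (Fin N) (Fin N) ℂ :=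
  Matrix.of fun j k =>
    (Real.sqrt ((1 + τ) / 2) : ℂ) * (G.1 j k : ℂ) +
      Complex.I * (Real.sqrt ((1 - τ) / 2) : ℂ) * (G.2 j k : ℂ)

open Classical in
/-- The number of eigenvalues of `X` lying in `A`, counted with algebraic multiplicity: the mass
that the empirical measure `∑ₐ δ_{zₐ}` of the eigenvalues gives to `A`. -/
def eigenvalueCount {N : ℕ} (X : Matrix (Fin N) (Fin N) ℂ) (A : Set ℂ) : ℕ :=
  X.charpoly.roots.countP (· ∈ A)

/-- `p` is a density, with respect to Lebesgue measure on `ℂ`, of the expectation of the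
empirical measure `∑ₐ δ_{zₐ}` of the eigenvalues of the random matrix `X` on `(Ω, P)`. It has
total mass `N`. -/
structure IsMeanEigenvalueDensity {Ω : Type*} [MeasurableSpace Ω] (P : Measure Ω) {N : ℕ}
    (X : Ω → Matrix (Fin N) (Fin N) ℂ) (p : ℂ → ℝ) : Prop where
  measurable : Measurable p
  nonneg : ∀ z, 0 ≤ p z
  lintegral_count : ∀ A : Set ℂ, MeasurableSet A →
    ∫⁻ ω, (eigenvalueCount (X ω) A : ENNReal) ∂P = ∫⁻ z in A, ENNReal.ofReal (p z)

/-- The (upper) incomplete Gamma function `Γ(s, a) = ∫_a^∞ t^(s-1) e^(-t) dt`. -/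
def incompleteGamma (s a : ℝ) : ℝ :=
  ∫ t in Set.Ioi a, t ^ (s - 1) * Real.exp (-t)

/-- The integrand, as a function of `w ∈ [0,1]`, in the formula for the mean eigenvalue density
of the interpolating Ginibre ensemble. -/
def interpolatingIntegrand (N : ℕ) (τ x y w : ℝ) : ℝ :=
  w ^ (N - 2) / Real.sqrt (1 - τ ^ 2 * w ^ 2) *
    Real.exp (τ * (1 - w ^ 2) * (x ^ 2 / (1 + τ) - y ^ 2 / (1 - τ))) *
    (incompleteGamma N (x ^ 2 + y ^ 2) * (1 - τ ^ 2 * w ^ 2) +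
      incompleteGamma ((N : ℝ) - 1) (x ^ 2 + y ^ 2) * τ * w ^ 2 *
        (τ * (x ^ 2 + y ^ 2) * (1 + w ^ 2) - 2 * (x ^ 2 - y ^ 2)))

/-- The explicit formula for the mean eigenvalue density at `x + iy`. -/
def interpolatingDensity (N : ℕ) (τ x y : ℝ) : ℝ :=
  1 / (Real.pi * Real.Gamma ((N : ℝ) - 1) * Real.sqrt (1 - τ ^ 2)) *
    ∫ w in (0 : ℝ)..1, interpolatingIntegrand N τ x y w

end

/-! This is a Kac-Rice computation. Prescribe an eigenvalue `z`, an eigenvector `v = (1, u)` and all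
columns `g` of a matrix but the first; the eigenvalue equation then determines the first column. For
almost every matrix the eigenvalues correspond to the preimages under this map
(`eigenvalueCount_eq_encard`), so the area formula turns the expected count into an integral of the
Gaussian density times the squared modulus of a complex Jacobian determinant
(`lintegral_eigenvalueCount`). The mean density at `z` is the integral over `u` and `g`.

For fixed `z` and `u` the rows stay independent, row `i` being a Gaussian vector `ξ` conditioned on
`ξ ⬝ v = z v i`. The Jacobian determinant is that of `z - G + v v^* / |v|²`
(`det_chartJacobian_eq`), whose rows have a common covariance `C` and means forming a matrix `A`.
The second absolute moment of such a determinant is `det (T C + Aᵀ conj A)` with every `T ^ k`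
replaced by `k!` (`sum_sign_mul_sign_prod`). Both `C` and `A` are scalar up to a term built from `v`
and `conj v`, so this determinant is `(T + |z|²) ^ (N - 2)` times a polynomial of degree at most one
in `T` (`det_smul_conditionalCov_add`). Replacing powers by factorials is integration against `exp
(-T)` over the half-line; it produces truncated exponential series, that is, the incomplete Gamma
functions (`incompleteGamma_natCast_succ`).

What remains depends on `u` only through the weight `|v| ^ (-2N)`, the invariant measure of
projective space in an affine chart, and the ratio `r = |v ⬝ v|² / |v|⁴`. Under this weight `√(1 -
r)` has density proportional to `w ^ (N - 2)` on `(0, 1)` (`lintegral_squareRatio`): rotations and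
scaling reduce the claim to a half-plane, where it becomes Archimedes' theorem that a coordinate on
the sphere is uniform. A last substitution (`lintegral_sqrt_substitution`) simplifies `1 - τ² r` and
yields the stated integral over `w` (`mul_fiberDensity_eq`). -/

/-! ### Second moment of a determinant with independent rows. -/

/-- The linear functional on polynomials with `X ^ k ↦ k!`. -/
noncomputable def factorialFunctional (R : Type*) [CommRing R] : Polynomial R →ₗ[R] R :=
  Polynomial.lsum fun k => (k.factorial : R) • LinearMap.id

theorem factorialFunctional_monomial {R : Type*} [CommRing R] (k : ℕ) (a : R) :
    factorialFunctional R (Polynomial.monomial k a) = k.factorial * a := by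
  simp [factorialFunctional, Polynomial.lsum_apply]

theorem factorialFunctional_C_mul_X_pow {R : Type*} [CommRing R] (k : ℕ) (a : R) :
    factorialFunctional R (Polynomial.C a * Polynomial.X ^ k) = k.factorial * a := by
  rw [Polynomial.C_mul_X_pow_eq_monomial, factorialFunctional_monomial]

section Permutations

variable {n : Type*} [Fintype n] [DecidableEq n]

/-- A map that is injective off `T` has `|T|!` extensions, from the complement of `T`, to
permutations. -/
theorem card_perm_eqOn_compl (T : Finset n) (r : n → n) (hr : Set.InjOn r (T : Set n)ᶜ) :
    (Finset.univ.filter fun τ : Equiv.Perm n => ∀ j, j ∉ T → τ j = r j).card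
      = T.card.factorial := by
  obtain ⟨e, he⟩ := Finset.exists_equiv_extend_of_card_eq (α := n) (β := n) (t := Finset.univ)
    (by simp) (s := Tᶜ) (f := r) (by simp) (by simpa using hr)
  let τ₀ : Equiv.Perm n := e.trans (Equiv.subtypeUnivEquiv (by simp))
  have h0 : ∀ j, j ∉ T → τ₀ j = r j := fun j hj => he j (by simpa using hj)
  rw [← Fintype.card_coe T, ← Fintype.card_perm, ← Fintype.card_coe]
  apply Fintype.card_congr
  refine Equiv.trans ?_ (Equiv.Perm.subtypeEquivSubtypePerm (fun j => j ∈ T)).symm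
  refine (Equiv.mulLeft τ₀⁻¹).subtypeEquiv fun τ => ?_
  simp only [Finset.mem_filter, Finset.mem_univ, true_and, Equiv.coe_mulLeft, Equiv.Perm.mul_apply]
  refine forall₂_congr fun j hj => ?_
  rw [Equiv.Perm.inv_eq_iff_eq, h0 j hj]

/-- Group the permutations by their restriction to the complement of `T`, encoded as a total map by
the default value `j` at each `j ∈ T`. An injective restriction has `|T|!` extensions; the others
are not reached by permutations, and `hΦ` lets them be added to the right-hand sum for free. -/
theorem sum_perm_eq_factorial_mul_sum {R : Type*} [CommRing R] (T : Finset n) (Φ : (n → n) → R)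
    (hΦ : ∀ r, ¬ Set.InjOn r (T : Set n)ᶜ → Φ r = 0) :
    ∑ τ : Equiv.Perm n, Φ (T.piecewise id τ) =
      T.card.factorial *
        ∑ r ∈ Fintype.piFinset (fun j => if j ∈ T then {j} else Finset.univ), Φ r := by
  rw [← Finset.sum_fiberwise_of_maps_to
    (t := Fintype.piFinset (fun j => if j ∈ T then {j} else Finset.univ))
    (g := fun τ : Equiv.Perm n => T.piecewise id τ), Finset.mul_sum]
  · refine Finset.sum_congr rfl fun r hr => ?_
    rw [Finset.sum_congr rfl (g := fun _ => Φ r) fun τ hτ => by rw [(Finset.mem_filter.1 hτ).2],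
      Finset.sum_const, nsmul_eq_mul]
    by_cases hinj : Set.InjOn r (T : Set n)ᶜ
    · rw [← card_perm_eqOn_compl T r hinj]
      congr 3
      ext τ
      simp only [Finset.mem_filter, Finset.mem_univ, true_and]
      constructor
      · rintro rfl j hj
        simp [hj]
      · intro h
        ext j
        by_cases hj : j ∈ T
        · have := Fintype.mem_piFinset.1 hr j
          simp_all
        · simp [hj, h j hj]
    · simp [hΦ r hinj]
  · intro τ _
    rw [Fintype.mem_piFinset]
    intro j
    by_cases hj : j ∈ T <;> simp [hj]

variable {R : Type*} [CommRing R]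

/-- Multilinearity in the rows: `T` is the set of rows where `x • C j` is chosen, and `r` chooses
the summand `A i j • B i` in each other row. The exponent `|T|` is what the factorial functional
later turns into the number of extensions of a restricted permutation. -/
theorem det_smul_add_transpose_mul (x : R) (C A B : Matrix n n R) :
    (x • C + A.transpose * B).det = ∑ T : Finset n, x ^ T.card *
      ∑ r ∈ Fintype.piFinset (fun j => if j ∈ T then {j} else Finset.univ),
        (∏ j, if j ∈ T then 1 else A (r j) j) *
          (Matrix.of fun j => if j ∈ T then C j else B (r j)).det := by
  have h1 : (x • C + A.transpose * B) =
      (fun j => x • C j) + (fun j => ∑ i, A i j • B i) := by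
    ext j k
    simp [Matrix.mul_apply]
  have h2 := (Matrix.detRowAlternating (n := n) (R := R)).toMultilinearMap.map_add_univ
    (fun j => x • C j) (fun j => ∑ i, A i j • B i)
  rw [h1]
  refine h2.trans (Finset.sum_congr rfl fun T _ => ?_)
  have h3 : T.piecewise (fun j => x • C j) (fun j => ∑ i, A i j • B i) =
      fun j => ∑ i ∈ (if j ∈ T then {j} else Finset.univ),
        (if j ∈ T then x else A i j) • (if j ∈ T then C j else B i) := by
    ext j k
    by_cases hj : j ∈ T <;> simp [hj]
  rw [h3, MultilinearMap.map_sum_finset, Finset.mul_sum]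
  refine Finset.sum_congr rfl fun r _ => ?_
  rw [MultilinearMap.map_smul_univ]
  have h4 : (∏ j, if j ∈ T then x else A (r j) j) =
      x ^ T.card * ∏ j, if j ∈ T then 1 else A (r j) j := by
    rw [← Finset.prod_const, ← Finset.prod_ite_mem_eq T, ← Finset.prod_mul_distrib]
    refine Finset.prod_congr rfl fun j _ => ?_
    by_cases hj : j ∈ T <;> simp [hj]
  rw [h4, smul_eq_mul, mul_assoc]
  rfl

/-- The second moment of the determinant of a matrix with independent rows, whose `i`-th row has
mean `A i` and covariance `C`. -/
theorem sum_sign_mul_sign_prod (C A B : Matrix n n R) :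
    ∑ σ : Equiv.Perm n, ∑ π : Equiv.Perm n,
      ((Equiv.Perm.sign σ : ℤ) : R) * ((Equiv.Perm.sign π : ℤ) : R) *
        ∏ i, (C (σ i) (π i) + A i (σ i) * B i (π i)) =
    factorialFunctional R ((Polynomial.X : Polynomial R) • C.map Polynomial.C
      + (A.map Polynomial.C).transpose * B.map Polynomial.C).det := by
  -- With `σ = τ⁻¹` and `i = τ j`, the sum over `π` is the determinant with rows `C j + A (τ j) j •
  -- B (τ j)`. Its multilinear expansion sees `τ` only off `T`.
  have hL : ∀ τ : Equiv.Perm n, ∑ π : Equiv.Perm n,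
      ((Equiv.Perm.sign τ⁻¹ : ℤ) : R) * ((Equiv.Perm.sign π : ℤ) : R) *
        ∏ i, (C (τ⁻¹ i) (π i) + A i (τ⁻¹ i) * B i (π i)) =
      ∑ T : Finset n, (∏ j, if j ∈ T then 1 else A ((T.piecewise id τ) j) j) *
        (Matrix.of fun j => if j ∈ T then C j else B ((T.piecewise id τ) j)).det := by
    intro τ
    have h1 : ∑ π : Equiv.Perm n,
      ((Equiv.Perm.sign τ⁻¹ : ℤ) : R) * ((Equiv.Perm.sign π : ℤ) : R) *
        ∏ i, (C (τ⁻¹ i) (π i) + A i (τ⁻¹ i) * B i (π i)) =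
        (C + Matrix.of fun j => A (τ j) j • B (τ j)).det := by
      rw [← Matrix.det_transpose, Matrix.det_apply']
      rw [← Equiv.sum_comp (Equiv.mulRight τ⁻¹)]
      refine Finset.sum_congr rfl fun π _ => ?_
      rw [← Equiv.prod_comp τ]
      have : ((Equiv.Perm.sign τ⁻¹ : ℤ) : R) * ((Equiv.Perm.sign (π * τ⁻¹) : ℤ) : R)
          = ((Equiv.Perm.sign π : ℤ) : R) := by
        rw [Equiv.Perm.sign_mul, mul_comm (Equiv.Perm.sign π), ← Int.cast_mul, ← Units.val_mul,
          ← mul_assoc, ← sq, Int.units_sq, one_mul]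
      simp only [Equiv.coe_mulRight]
      rw [this]
      simp
    rw [h1]
    refine ((Matrix.detRowAlternating (n := n) (R := R)).toMultilinearMap.map_add_univ
      C (fun j => A (τ j) j • B (τ j))).trans (Finset.sum_congr rfl fun T _ => ?_)
    have h3 : T.piecewise C (fun j => A (τ j) j • B (τ j)) =
        fun j => (if j ∈ T then 1 else A ((T.piecewise id τ) j) j) •
          (if j ∈ T then C j else B ((T.piecewise id τ) j)) := by
      ext j k
      by_cases hj : j ∈ T <;> simp [Finset.piecewise, hj]
    rw [h3, MultilinearMap.map_smul_univ]
    rfl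
  rw [← Equiv.sum_comp (Equiv.inv (Equiv.Perm n))]
  simp only [Equiv.inv_apply]
  rw [Finset.sum_congr rfl fun τ _ => hL τ, Finset.sum_comm, det_smul_add_transpose_mul, map_sum]
  refine Finset.sum_congr rfl fun T _ => ?_
  rw [sum_perm_eq_factorial_mul_sum T (fun r => (∏ j, if j ∈ T then 1 else A (r j) j) *
        (Matrix.of fun j => if j ∈ T then C j else B (r j)).det)]
  · rw [mul_comm (Polynomial.X ^ T.card), ← factorialFunctional_C_mul_X_pow, map_sum]
    congr 2
    refine Finset.sum_congr rfl fun r _ => ?_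
    rw [map_mul, map_prod, RingHom.map_det]
    congr 1
    · refine Finset.prod_congr rfl fun j _ => ?_
      by_cases hj : j ∈ T <;> simp [hj]
    · congr 1
      ext1 j k
      by_cases hj : j ∈ T <;> simp [hj]
  -- If `r` repeats a value off `T`, two rows `B (r i)` and `B (r j)` coincide.
  · intro r hr
    simp only [Set.InjOn, not_forall] at hr
    obtain ⟨i, hi, j, hj, hij, hne⟩ := hr
    rw [Matrix.det_zero_of_row_eq hne, mul_zero]
    have hi' : i ∉ T := by simpa using hi
    have hj' : j ∉ T := by simpa using hj
    ext k
    simp [hi', hj', hij]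

end Permutations

/-! ### Determinants of rank-two perturbations of scalar matrices. -/

/-- Sylvester's identity, read off at `c` from the characteristic polynomials of `(-U) * V` and `V *
(-U)`. -/
theorem Matrix.det_smul_one_add_mul_comm {R m n : Type*} [CommRing R] [Fintype m] [Fintype n]
    [DecidableEq m] [DecidableEq n] (c : R) (U : Matrix m n R) (V : Matrix n m R)
    (h : Fintype.card n ≤ Fintype.card m) :
    (c • (1 : Matrix m m R) + U * V).det =
      c ^ (Fintype.card m - Fintype.card n) * (c • (1 : Matrix n n R) + V * U).det := by
  have key := congrArg (Polynomial.eval c) (Matrix.charpoly_mul_comm_of_le (-U) V h)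
  rw [Polynomial.eval_mul, Matrix.eval_charpoly, Matrix.eval_charpoly] at key
  simpa [sub_neg_eq_add, Matrix.smul_one_eq_diagonal, Matrix.scalar_apply] using key

section RankTwo

variable {n : Type*} [Fintype n] [DecidableEq n]

/-- The mean of `z - G + v v^* / s`, for the matrix `G` conditioned on `G v = z v`. Here `v'` and
`z'` stand for the conjugates of `v` and `z`, and `s = v ⬝ v'`, `q = v ⬝ v`, `q' = v' ⬝ v'`. -/
noncomputable def deflatedMean (τ s q q' z z' : ℂ) (v v' : n → ℂ) : Matrix n n ℂ :=
  Matrix.of fun i j => (if i = j then z else 0) + v i * v' j / s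
    - (s * z * v i - τ * q * z' * v' i) / (s ^ 2 - τ ^ 2 * (q * q')) * v' j
    - τ * ((s * z' * v' i - τ * q' * z * v i) / (s ^ 2 - τ ^ 2 * (q * q'))) * v j

/-- The covariance of a row of `G` conditioned on `G v = z v`. -/
noncomputable def conditionalCov (τ s q q' : ℂ) (v v' : n → ℂ) : Matrix n n ℂ :=
  Matrix.of fun j k => (if j = k then 1 else 0) -
    (s * (v' j * v k) + τ ^ 2 * s * (v j * v' k) - τ ^ 2 * q' * (v j * v k)
      - τ ^ 2 * q * (v' j * v' k)) / (s ^ 2 - τ ^ 2 * (q * q'))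

/-- Let `E` have columns `v` and `v'`. Mean and covariance are scalar matrices plus `E * K * Eᵀ`
with 2×2 matrices `K`, so the whole matrix is `T + z z'` plus such a term, and Sylvester's identity
leaves a 2×2 determinant in the Gram matrix of `v, v'`. Its `T²` coefficient vanishes because the
covariance is degenerate along `v`. Conjugates enter as free variables, so the final identity is one
of rational functions. -/
theorem det_smul_conditionalCov_add (hn : 2 ≤ Fintype.card n) (τ s q q' z z' T : ℂ)
    (v v' : n → ℂ) (hs : s ≠ 0) (hD : s ^ 2 - τ ^ 2 * (q * q') ≠ 0)
    (hvv : ∑ i, v i * v i = q) (hvv' : ∑ i, v i * v' i = s) (hv'v' : ∑ i, v' i * v' i = q') :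
    (T • conditionalCov τ s q q' v v' + (deflatedMean τ s q q' z z' v v').transpose *
        deflatedMean τ s q' q z' z v' v).det =
      (T + z * z') ^ (Fintype.card n - 2) *
        ((1 - τ ^ 2) * s ^ 2 / (s ^ 2 - τ ^ 2 * (q * q')) * T +
          ((1 - τ) ^ 2 * (s ^ 2 + τ * (q * q')) ^ 2 * ((z + z') / 2) ^ 2
            - (1 + τ) ^ 2 * (s ^ 2 - τ * (q * q')) ^ 2 * ((z - z') / 2) ^ 2) /
              (s ^ 2 - τ ^ 2 * (q * q')) ^ 2) := by
  set D := s ^ 2 - τ ^ 2 * (q * q') with hDdef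
  have hD' : s ^ 2 - τ ^ 2 * (q' * q) = D := by rw [hDdef]; ring
  set E : Matrix n (Fin 2) ℂ := Matrix.of fun i => ![v i, v' i] with hE
  set K : Matrix (Fin 2) (Fin 2) ℂ :=
    !![τ ^ 2 * q' * z / D, 1 / s - s * z / D; -τ * s * z' / D, τ * q * z' / D] with hK
  set K' : Matrix (Fin 2) (Fin 2) ℂ :=
    !![τ * q' * z / D, -τ * s * z / D; 1 / s - s * z' / D, τ ^ 2 * q * z' / D] with hK'
  set Kc : Matrix (Fin 2) (Fin 2) ℂ :=
    !![τ ^ 2 * q' / D, -τ ^ 2 * s / D; - s / D, τ ^ 2 * q / D] with hKc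
  have hG : E.transpose * E = !![q, s; s, q'] := by
    ext a b
    fin_cases a <;> fin_cases b <;> simp [Matrix.mul_apply, hE, hvv, hvv', hv'v']
    rw [← hvv']
    exact Finset.sum_congr rfl fun i _ => mul_comm _ _
  have hA : deflatedMean τ s q q' z z' v v' = z • (1 : Matrix n n ℂ) + E * K * E.transpose := by
    ext i j
    simp only [deflatedMean, Matrix.of_apply, Matrix.add_apply, Matrix.smul_apply, Matrix.one_apply,
      Matrix.mul_apply, Fin.sum_univ_two, hE, hK, Matrix.transpose_apply, ← hDdef]
    simp
    split_ifs <;> ring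
  have hB : deflatedMean τ s q' q z' z v' v = z' • (1 : Matrix n n ℂ) + E * K' * E.transpose := by
    ext i j
    simp only [deflatedMean, Matrix.of_apply, Matrix.add_apply, Matrix.smul_apply, Matrix.one_apply,
      Matrix.mul_apply, Fin.sum_univ_two, hE, hK', Matrix.transpose_apply, hD']
    simp
    split_ifs <;> ring
  have hC : conditionalCov τ s q q' v v' = 1 + E * Kc * E.transpose := by
    ext i j
    simp only [conditionalCov, Matrix.of_apply, Matrix.add_apply, Matrix.one_apply,
      Matrix.mul_apply, Fin.sum_univ_two, hE, hKc, Matrix.transpose_apply, ← hDdef]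
    simp
    split_ifs <;> ring
  have hM : T • conditionalCov τ s q q' v v' + (deflatedMean τ s q q' z z' v v').transpose *
        deflatedMean τ s q' q z' z v' v = (T + z * z') • (1 : Matrix n n ℂ) +
      E * ((T • Kc + z' • K.transpose + z • K' + K.transpose * !![q, s; s, q'] * K') *
        E.transpose) := by
    rw [hA, hB, hC, ← hG]
    simp only [Matrix.transpose_add, Matrix.transpose_mul, Matrix.transpose_smul,
      Matrix.transpose_one, Matrix.transpose_transpose, Matrix.mul_add, Matrix.add_mul,
      Matrix.smul_mul, Matrix.mul_smul, Matrix.mul_one, Matrix.one_mul, Matrix.mul_assoc, smul_add,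
      smul_smul, add_smul, mul_comm z' z]
    abel
  rw [hM, Matrix.det_smul_one_add_mul_comm _ _ _ (by simpa using hn), Matrix.mul_assoc, hG,
    Fintype.card_fin]
  congr 1
  have hq : τ ^ 2 * (q * q') = s ^ 2 - D := by rw [hDdef]; ring
  simp only [hK, hK', hKc, Matrix.det_fin_two, Matrix.add_apply, Matrix.smul_apply,
    Matrix.mul_apply, Fin.sum_univ_two, Matrix.transpose_apply, Matrix.one_apply]
  simp
  field_simp
  rw [hDdef]
  ring

end RankTwo

/-! ### The area formula with multiplicity. -/

section AreaFormula

variable {E : Type*} [NormedAddCommGroup E] [NormedSpace ℝ E] [FiniteDimensional ℝ E]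

theorem exists_isOpen_injOn_of_det_ne_zero {f : E → E} {f' : E →L[ℝ] E} {x : E}
    (hf : HasStrictFDerivAt f f' x) (hx : f'.det ≠ 0) :
    ∃ U : Set E, IsOpen U ∧ x ∈ U ∧ Set.InjOn f U := by
  have h : HasStrictFDerivAt f (f'.toContinuousLinearEquivOfDetNeZero hx : E →L[ℝ] E) x := by
    simpa using hf
  refine ⟨(h.toOpenPartialHomeomorph f).source, (h.toOpenPartialHomeomorph f).open_source,
    h.mem_toOpenPartialHomeomorph_source, ?_⟩
  simpa using (h.toOpenPartialHomeomorph f).injOn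

variable [MeasurableSpace E] [BorelSpace E]

/-- The regular points of a `C¹` map split into countably many measurable pieces on which the map
is injective. -/
theorem exists_measurable_partition_injOn {f : E → E} {f' : E → E →L[ℝ] E}
    (hf : ∀ x, HasStrictFDerivAt f (f' x) x) (hf' : Continuous f') :
    ∃ t : ℕ → Set E, (∀ k, MeasurableSet (t k)) ∧ Pairwise (Function.onFun Disjoint t) ∧
      (∀ k, Set.InjOn f (t k)) ∧ ⋃ k, t k = {x | (f' x).det ≠ 0} := by
  have hdet : MeasurableSet {x | (f' x).det ≠ 0} :=
    (isOpen_ne.preimage (ContinuousLinearMap.continuous_det.comp hf')).measurableSet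
  rcases Set.eq_empty_or_nonempty {x | (f' x).det ≠ 0} with he | hne
  · exact ⟨fun _ => ∅, by simp, fun _ _ _ => by simp [Function.onFun], by simp, by simp [he]⟩
  have hex : ∀ x, ∃ U : Set E, IsOpen U ∧ ((f' x).det ≠ 0 → x ∈ U) ∧ Set.InjOn f U := by
    intro x
    by_cases hx : (f' x).det = 0
    -- Critical points receive the empty set, so that `U` can be chosen at every point.
    · exact ⟨∅, isOpen_empty, fun h => absurd hx h, by simp⟩
    · obtain ⟨U, h1, h2, h3⟩ := exists_isOpen_injOn_of_det_ne_zero (hf x) hx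
      exact ⟨U, h1, fun _ => h2, h3⟩
  choose U hUo hUm hUi using hex
  obtain ⟨c, hcs, hcc, hcov⟩ := TopologicalSpace.countable_cover_nhdsWithin
    (s := {x | (f' x).det ≠ 0}) (f := U)
    fun x hx => mem_nhdsWithin_of_mem_nhds ((hUo x).mem_nhds (hUm x hx))
  have hcne : c.Nonempty := by
    obtain ⟨x, hx⟩ := hne
    obtain ⟨y, hy, -⟩ := Set.mem_iUnion₂.1 (hcov hx)
    exact ⟨y, hy⟩
  obtain ⟨e, rfl⟩ := hcc.exists_eq_range hcne
  refine ⟨fun k => disjointed (fun k => U (e k)) k ∩ {x | (f' x).det ≠ 0}, fun k => ?_, ?_, ?_, ?_⟩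
  · exact (MeasurableSet.disjointed (fun k => (hUo (e k)).measurableSet) k).inter hdet
  · intro i j hij
    exact (disjoint_disjointed _ hij).mono Set.inter_subset_left Set.inter_subset_left
  · intro k
    exact (hUi (e k)).mono (Set.inter_subset_left.trans (disjointed_subset _ k))
  · rw [← Set.iUnion_inter, iUnion_disjointed]
    refine Set.inter_eq_right.2 ?_
    simpa using hcov

/-- The area formula: integration of the number of regular preimages in a set. -/
theorem measurable_encard_and_lintegral (μ : Measure E) [μ.IsAddHaarMeasure] {f : E → E}
    {f' : E → E →L[ℝ] E} (hf : ∀ x, HasStrictFDerivAt f (f' x) x) (hf' : Continuous f')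
    {S : Set E} (hS : MeasurableSet S) :
    Measurable (fun y => ((S ∩ {x | (f' x).det ≠ 0} ∩ f ⁻¹' {y}).encard : ENNReal)) ∧
    ∀ g : E → ENNReal, Measurable g →
      ∫⁻ y, ((S ∩ {x | (f' x).det ≠ 0} ∩ f ⁻¹' {y}).encard : ENNReal) * g y ∂μ =
        ∫⁻ x in S, ENNReal.ofReal |(f' x).det| * g (f x) ∂μ := by
  obtain ⟨t, htm, htd, hti, htu⟩ := exists_measurable_partition_injOn hf hf'
  have hcont : Continuous f := continuous_iff_continuousAt.2 fun x => (hf x).continuousAt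
  have him : ∀ k, MeasurableSet (f '' (S ∩ t k)) := fun k =>
    measurable_image_of_fderivWithin (hS.inter (htm k))
      (fun x _ => (hf x).hasFDerivAt.hasFDerivWithinAt) ((hti k).mono Set.inter_subset_right)
  -- Each piece meets a fibre in at most one point, so counting a fibre means counting the images
  -- that contain `y`.
  have hcount : (fun y => ((S ∩ {x | (f' x).det ≠ 0} ∩ f ⁻¹' {y}).encard : ENNReal)) =
      fun y => ∑' k, (f '' (S ∩ t k)).indicator 1 y := by
    ext y
    have hms : ∀ k, MeasurableSet (S ∩ t k ∩ f ⁻¹' {y}) := fun k =>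
      (hS.inter (htm k)).inter (hcont.measurable (measurableSet_singleton y))
    rw [← htu, Set.inter_iUnion, Set.iUnion_inter, ← Measure.count_apply (MeasurableSet.iUnion hms),
      measure_iUnion _ hms]
    · refine tsum_congr fun k => ?_
      rw [Measure.count_apply (hms k)]
      by_cases hy : y ∈ f '' (S ∩ t k)
      · obtain ⟨x, hx, rfl⟩ := hy
        have : S ∩ t k ∩ f ⁻¹' {f x} = {x} := by
          ext x'
          constructor
          · rintro ⟨hx', h⟩
            exact hti k hx'.2 hx.2 h
          · rintro rfl
            exact ⟨hx, rfl⟩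
        rw [this, Set.indicator_of_mem (Set.mem_image_of_mem f hx)]
        simp
      · have : S ∩ t k ∩ f ⁻¹' {y} = ∅ :=
          Set.eq_empty_of_forall_notMem fun x' ⟨hx', h⟩ => hy ⟨x', hx', h⟩
        rw [this, Set.indicator_of_notMem hy]
        simp
    · intro i j hij
      exact (htd hij).mono (fun x hx => hx.1.2) (fun x hx => hx.1.2)
  refine ⟨?_, fun g hg => ?_⟩
  · rw [hcount]
    exact Measurable.tsum fun k => measurable_one.indicator (him k)
  · have h1 : ∀ y, ((S ∩ {x | (f' x).det ≠ 0} ∩ f ⁻¹' {y}).encard : ENNReal) * g y =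
        ∑' k, (f '' (S ∩ t k)).indicator g y := by
      intro y
      rw [congrFun hcount y, ← ENNReal.tsum_mul_right]
      refine tsum_congr fun k => ?_
      by_cases hy : y ∈ f '' (S ∩ t k) <;> simp [hy]
    simp_rw [h1]
    rw [lintegral_tsum fun k => (hg.indicator (him k)).aemeasurable]
    have h2 : ∀ k, ∫⁻ y, (f '' (S ∩ t k)).indicator g y ∂μ =
        ∫⁻ x in S ∩ t k, ENNReal.ofReal |(f' x).det| * g (f x) ∂μ := by
      intro k
      rw [lintegral_indicator (him k)]
      exact lintegral_image_eq_lintegral_abs_det_fderiv_mul μ (hS.inter (htm k))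
        (fun x _ => (hf x).hasFDerivAt.hasFDerivWithinAt) ((hti k).mono Set.inter_subset_right) g
    simp_rw [h2]
    -- The pieces reassemble to the regular points only; the critical points may be put back since
    -- the Jacobian factor vanishes there.
    rw [← lintegral_iUnion (fun k => hS.inter (htm k)), ← Set.inter_iUnion, htu,
      ← lintegral_indicator hS, ← lintegral_indicator]
    · refine lintegral_congr fun x => ?_
      by_cases hx : x ∈ S <;> by_cases hd : (f' x).det = 0 <;> simp [hx, hd]
    · exact hS.inter
        (isOpen_ne.preimage (ContinuousLinearMap.continuous_det.comp hf')).measurableSet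
    · intro i j hij
      exact (htd hij).mono Set.inter_subset_right Set.inter_subset_right

end AreaFormula

/-! ### The map from eigenpairs to matrices and its Jacobian. -/

section Chart

variable {n : ℕ}

/-- A square matrix given by its first column and its remaining columns. -/
def consColumn (y : (Fin (n + 1) → ℂ) × (Fin (n + 1) → Fin n → ℂ)) :
    Matrix (Fin (n + 1)) (Fin (n + 1)) ℂ :=
  Matrix.of fun i => Fin.cons (y.1 i) (y.2 i)

/-- From an eigenvalue `c 0`, an eigenvector with coordinates `1, c 1, …, c n`, and all columns of a
matrix but the first, recover the first column. -/
def eigenChart (p : (Fin (n + 1) → ℂ) × (Fin (n + 1) → Fin n → ℂ)) :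
    (Fin (n + 1) → ℂ) × (Fin (n + 1) → Fin n → ℂ) :=
  (fun i => p.1 0 * Function.update p.1 0 1 i - ∑ j, p.2 i j * p.1 j.succ, p.2)

/-- The partial Jacobian matrix of `eigenChart`. -/
def chartJacobian (p : (Fin (n + 1) → ℂ) × (Fin (n + 1) → Fin n → ℂ)) :
    Matrix (Fin (n + 1)) (Fin (n + 1)) ℂ :=
  Matrix.of fun i => Fin.cons (Function.update p.1 0 1 i)
    (fun j => (if i = j.succ then p.1 0 else 0) - p.2 i j)

theorem chartJacobian_mulVec (p : (Fin (n + 1) → ℂ) × (Fin (n + 1) → Fin n → ℂ))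
    (a : Fin (n + 1) → ℂ) (i : Fin (n + 1)) :
    (chartJacobian p).mulVec a i = Function.update p.1 0 1 i * a 0 +
      ∑ j : Fin n, ((if i = j.succ then p.1 0 else 0) - p.2 i j) * a j.succ := by
  simp [Matrix.mulVec, dotProduct, Fin.sum_univ_succ, chartJacobian]

theorem contDiff_eigenChart : ContDiff ℝ 1 (eigenChart (n := n)) := by
  refine ContDiff.prodMk (contDiff_pi.2 fun i => ?_) contDiff_snd
  have h1 : ∀ i, ContDiff ℝ 1
      fun p : (Fin (n + 1) → ℂ) × (Fin (n + 1) → Fin n → ℂ) => p.1 i := fun i => by fun_prop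
  have h2 : ∀ i j, ContDiff ℝ 1
      fun p : (Fin (n + 1) → ℂ) × (Fin (n + 1) → Fin n → ℂ) => p.2 i j := fun i j => by fun_prop
  refine ((h1 0).mul ?_).sub (ContDiff.sum fun j _ => (h2 i j).mul (h1 j.succ))
  by_cases hi : i = 0
  · subst hi; simpa using contDiff_const
  · simpa [Function.update_of_ne hi] using h1 i

/-- The linear map `(a, b) ↦ (a + L b, b)` has determinant one. -/
theorem LinearMap.det_shear {K V W : Type*} [Field K] [CharZero K] [AddCommGroup V]
    [AddCommGroup W] [Module K V] [Module K W] (L : W →ₗ[K] V) :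
    LinearMap.det ((LinearMap.fst K V W + L ∘ₗ LinearMap.snd K V W).prod (LinearMap.snd K V W))
      = 1 := by
  -- No basis is needed. The shear `S L` is the square of `S (L/2)`, is inverse to `S (-L)`, and is
  -- conjugate to `S (-L)` by `(-1, 1)`. Hence `det (S L) = det (S (L/2)) * det (S (-L/2)) = 1`.
  have h2 : ∀ L : W →ₗ[K] V, LinearMap.det
      ((LinearMap.fst K V W + L ∘ₗ LinearMap.snd K V W).prod (LinearMap.snd K V W)) =
      LinearMap.det (((LinearMap.fst K V W + ((2 : K)⁻¹ • L) ∘ₗ LinearMap.snd K V W).prod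
        (LinearMap.snd K V W))) ^ 2 := by
    intro L
    rw [sq, ← LinearMap.det_comp]
    congr 1
    ext x <;> simp
    rw [← add_smul]
    norm_num
  have h3 : ∀ L : W →ₗ[K] V, LinearMap.det
      ((LinearMap.fst K V W + L ∘ₗ LinearMap.snd K V W).prod (LinearMap.snd K V W)) *
      LinearMap.det ((LinearMap.fst K V W + (-L) ∘ₗ LinearMap.snd K V W).prod
        (LinearMap.snd K V W)) = 1 := by
    intro L
    rw [← LinearMap.det_comp, ← LinearMap.det_id (A := K) (M := V × W)]
    congr 1
    ext x <;> simp
  have h4 : ∀ L : W →ₗ[K] V, LinearMap.det ((LinearMap.fst K V W + (-L) ∘ₗ LinearMap.snd K V W).prod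
        (LinearMap.snd K V W)) = LinearMap.det
      ((LinearMap.fst K V W + L ∘ₗ LinearMap.snd K V W).prod (LinearMap.snd K V W)) := by
    intro L
    have hP : LinearMap.det (LinearMap.prodMap (-LinearMap.id : V →ₗ[K] V)
        (LinearMap.id : W →ₗ[K] W)) * LinearMap.det (LinearMap.prodMap
        (-LinearMap.id : V →ₗ[K] V) (LinearMap.id : W →ₗ[K] W)) = 1 := by
      rw [← LinearMap.det_comp, ← LinearMap.det_id (A := K) (M := V × W)]
      congr 1
      ext x <;> simp
    calc _ = LinearMap.det ((LinearMap.prodMap (-LinearMap.id : V →ₗ[K] V)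
        (LinearMap.id : W →ₗ[K] W)) ∘ₗ
          ((LinearMap.fst K V W + L ∘ₗ LinearMap.snd K V W).prod (LinearMap.snd K V W)) ∘ₗ
          (LinearMap.prodMap (-LinearMap.id : V →ₗ[K] V) (LinearMap.id : W →ₗ[K] W))) := by
            congr 1
            ext x <;> simp
      _ = _ := by
        rw [LinearMap.det_comp, LinearMap.det_comp, mul_comm, mul_assoc, hP, mul_one]
  rw [h2, sq]
  nth_rewrite 2 [← h4]
  exact h3 _

/-- The derivative is complex linear and factors as a shear, coming from the variation of the
columns, after the block map `(chartJacobian p, id)`. Its complex determinant is therefore that of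
`chartJacobian p`, and passing to real scalars takes the squared modulus. -/
theorem det_fderiv_eigenChart (p : (Fin (n + 1) → ℂ) × (Fin (n + 1) → Fin n → ℂ)) :
    (fderiv ℝ eigenChart p).det = ‖(chartJacobian p).det‖ ^ 2 := by
  let e1 : Fin (n + 1) → ((Fin (n + 1) → ℂ) × (Fin (n + 1) → Fin n → ℂ)) →L[ℂ] ℂ := fun i =>
    (ContinuousLinearMap.proj i).comp (ContinuousLinearMap.fst ℂ _ _)
  let e2 : Fin (n + 1) → Fin n → ((Fin (n + 1) → ℂ) × (Fin (n + 1) → Fin n → ℂ)) →L[ℂ] ℂ :=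
    fun i j => (ContinuousLinearMap.proj (R := ℂ) (φ := fun _ : Fin n => ℂ) j).comp
      ((ContinuousLinearMap.proj (R := ℂ) (φ := fun _ : Fin (n + 1) => Fin n → ℂ) i).comp
        (ContinuousLinearMap.snd ℂ _ _))
  have h1 : ∀ i, HasFDerivAt (fun p : (Fin (n + 1) → ℂ) × (Fin (n + 1) → Fin n → ℂ) => p.1 i)
      (e1 i) p := fun i => (e1 i).hasFDerivAt
  have h2 : ∀ i j, HasFDerivAt
      (fun p : (Fin (n + 1) → ℂ) × (Fin (n + 1) → Fin n → ℂ) => p.2 i j) (e2 i j) p :=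
    fun i j => (e2 i j).hasFDerivAt
  let d : Fin (n + 1) → ((Fin (n + 1) → ℂ) × (Fin (n + 1) → Fin n → ℂ)) →L[ℂ] ℂ := fun i =>
    (p.1 0 • (if i = 0 then 0 else e1 i) + Function.update p.1 0 1 i • e1 0) -
      ∑ j, (p.2 i j • e1 j.succ + p.1 j.succ • e2 i j)
  have hd : HasFDerivAt eigenChart ((ContinuousLinearMap.pi d).prod
      (ContinuousLinearMap.snd ℂ (Fin (n + 1) → ℂ) (Fin (n + 1) → Fin n → ℂ))) p := by
    refine HasFDerivAt.prodMk (hasFDerivAt_pi.2 fun i => ?_) hasFDerivAt_snd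
    refine ((h1 0).mul ?_).sub (HasFDerivAt.fun_sum fun j _ => (h2 i j).mul (h1 j.succ))
    by_cases hi : i = 0
    · subst hi; simpa using hasFDerivAt_const _ _
    · simpa [Function.update_of_ne hi, hi] using h1 i
  rw [(hd.restrictScalars ℝ).fderiv]
  let L : (Fin (n + 1) → Fin n → ℂ) →ₗ[ℂ] (Fin (n + 1) → ℂ) :=
    LinearMap.pi fun i => -∑ j, p.1 j.succ • (LinearMap.proj j ∘ₗ LinearMap.proj i)
  have hcomp : (((ContinuousLinearMap.pi d).prod
      (ContinuousLinearMap.snd ℂ (Fin (n + 1) → ℂ) (Fin (n + 1) → Fin n → ℂ)) :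
        _ →L[ℂ] _) : _ →ₗ[ℂ] _) =
      ((LinearMap.fst ℂ _ _ + L ∘ₗ LinearMap.snd ℂ _ _).prod (LinearMap.snd ℂ _ _)) ∘ₗ
        LinearMap.prodMap (Matrix.toLin' (chartJacobian p)) LinearMap.id := by
    apply LinearMap.ext
    rintro ⟨a, b⟩
    refine Prod.ext ?_ rfl
    funext i
    simp [chartJacobian_mulVec, d, L, e1, e2, sub_mul, Finset.sum_add_distrib,
      Finset.sum_sub_distrib]
    by_cases hi : i = 0
    · subst hi
      simp [(Fin.succ_ne_zero _).symm]
      ring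
    · obtain ⟨k, rfl⟩ := Fin.exists_succ_eq.2 hi
      simp
      ring
  have hdet : ∀ f : ((Fin (n + 1) → ℂ) × (Fin (n + 1) → Fin n → ℂ)) →L[ℂ]
      ((Fin (n + 1) → ℂ) × (Fin (n + 1) → Fin n → ℂ)),
      (f.restrictScalars ℝ).det = ‖LinearMap.det (f : ((Fin (n + 1) → ℂ) ×
        (Fin (n + 1) → Fin n → ℂ)) →ₗ[ℂ] ((Fin (n + 1) → ℂ) × (Fin (n + 1) → Fin n → ℂ)))‖ ^ 2 := by
    intro f
    rw [← Complex.normSq_eq_norm_sq, ← Algebra.norm_complex_apply]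
    exact LinearMap.det_restrictScalars
  rw [hdet, hcomp, LinearMap.det_comp, LinearMap.det_shear, LinearMap.det_prodMap]
  simp

end Chart

/-! ### Eigenvalues as preimages, outside a null set of matrices. -/

section Counting

variable {n : ℕ}

instance isAddHaarMeasure_volume_column (m n : ℕ) :
    (volume : Measure (Fin m → Fin n → ℂ)).IsAddHaarMeasure :=
  @Measure.pi.isAddHaarMeasure (Fin m) (fun _ => Fin n → ℂ) _ _ (fun _ => volume) _ _ _ _ _

instance isAddHaarMeasure_volume_column_prod (m n : ℕ) :
    (volume : Measure ((Fin m → ℂ) × (Fin m → Fin n → ℂ))).IsAddHaarMeasure :=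
  @Measure.prod.instIsAddHaarMeasure (Fin m → ℂ) _ _ _ (Fin m → Fin n → ℂ) _ _ _
    volume volume _ _ _ _ _ _

/-- Row by row, the formula for the first column is the eigenvector equation. Slot `0` of `p.1`
holds the eigenvalue, since the eigenvector's own coordinate there is normalised to `1`. -/
theorem eigenChart_eq_iff (p y : (Fin (n + 1) → ℂ) × (Fin (n + 1) → Fin n → ℂ)) :
    eigenChart p = y ↔ p.2 = y.2 ∧
      (consColumn y).mulVec (Function.update p.1 0 1) = p.1 0 • Function.update p.1 0 1 := by
  have h : ∀ i, (consColumn y).mulVec (Function.update p.1 0 1) i =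
      y.1 i + ∑ j, y.2 i j * p.1 j.succ := by
    intro i
    simp [Matrix.mulVec, dotProduct, Fin.sum_univ_succ, consColumn]
  rw [Prod.ext_iff, and_comm]
  refine and_congr_right fun h2 => ?_
  change p.2 = y.2 at h2
  simp only [funext_iff, h, eigenChart, Pi.smul_apply, smul_eq_mul, h2]
  refine forall_congr' fun i => ?_
  constructor <;> intro h' <;> linear_combination -h'

/-- Let `z = p.1 0`. Since `v 0 = 1`, replacing the first column of `X - M` by `(X - M) v = (X - z)
v` preserves the determinant. So the characteristic polynomial is `X - z` times a determinant which
at `X = z` is that of the chart; this cofactor is the derivative at `z`. -/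
theorem det_chartJacobian (p y : (Fin (n + 1) → ℂ) × (Fin (n + 1) → Fin n → ℂ))
    (h : eigenChart p = y) :
    (chartJacobian p).det = (consColumn y).charpoly.derivative.eval (p.1 0) := by
  obtain ⟨h2, hv⟩ := (eigenChart_eq_iff p y).1 h
  set v := Function.update p.1 0 1 with hvdef
  set M := consColumn y with hM
  have h1 : M.charpoly = (Polynomial.X - Polynomial.C (p.1 0)) *
      (M.charmatrix.updateCol 0 fun k => Polynomial.C (v k)).det := by
    have := Matrix.det_updateCol_sum M.charmatrix 0 fun i => Polynomial.C (v i)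
    rw [Matrix.charpoly]
    have hv0 : v 0 = 1 := by simp [hvdef]
    rw [hv0, map_one, one_smul] at this
    refine this.symm.trans (Eq.trans ?_ (Matrix.det_updateCol_smul M.charmatrix 0
      (Polynomial.X - Polynomial.C (p.1 0)) fun k => Polynomial.C (v k)))
    congr 2
    ext1 k
    have hk : ∑ i, M k i * v i = p.1 0 * v k := congrFun hv k
    rw [Pi.smul_apply, smul_eq_mul, sub_mul, ← map_mul, ← hk, map_sum]
    simp only [smul_eq_mul, Matrix.charmatrix_apply, mul_sub, Finset.sum_sub_distrib, map_mul]
    congr 1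
    · simp only [Matrix.diagonal_apply, mul_ite, mul_zero, Finset.sum_ite_eq, Finset.mem_univ,
        if_true]
      exact mul_comm _ _
    · exact Finset.sum_congr rfl fun i _ => mul_comm _ _
  rw [h1, Polynomial.derivative_mul]
  simp only [Polynomial.derivative_sub, Polynomial.derivative_X, Polynomial.derivative_C, sub_zero,
    one_mul, Polynomial.eval_add, Polynomial.eval_mul, Polynomial.eval_sub, Polynomial.eval_X,
    Polynomial.eval_C, sub_self, zero_mul, add_zero]
  rw [← Polynomial.coe_evalRingHom, RingHom.map_det]
  congr 1
  ext i j
  refine Fin.cases ?_ (fun j => ?_) j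
  · simp [chartJacobian, hvdef]
  · simp [chartJacobian, h2, hM, consColumn, Matrix.charmatrix_apply, Matrix.diagonal_apply]
    split_ifs <;> simp

/-- If all eigenvectors have a nonzero first coordinate and all eigenvalues are simple, then the
eigenvalues correspond to the preimages under `eigenChart`. -/
theorem eigenvalueCount_eq_encard (y : (Fin (n + 1) → ℂ) × (Fin (n + 1) → Fin n → ℂ))
    (h1 : ∀ p, eigenChart p = y → (chartJacobian p).det ≠ 0)
    (h2 : ∀ (z : ℂ) (v : Fin (n + 1) → ℂ), v 0 = 0 → (consColumn y).mulVec v = z • v → v = 0)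
    (A : Set ℂ) :
    ((eigenvalueCount (consColumn y) A : ℕ) : ℕ∞) =
      ({p | p.1 0 ∈ A} ∩ eigenChart ⁻¹' {y}).encard := by
  classical
  set M := consColumn y with hM
  have hex : ∀ z ∈ M.charpoly.roots, ∃ p, eigenChart p = y ∧ p.1 0 = z := by
    intro z hz
    have hz' : M.charpoly.IsRoot z := Polynomial.isRoot_of_mem_roots hz
    have hev : Module.End.HasEigenvalue (Matrix.toLin' M) z := by
      rw [Module.End.hasEigenvalue_iff_isRoot_charpoly, Matrix.charpoly_toLin']
      exact hz'
    obtain ⟨w, hw⟩ := hev.exists_hasEigenvector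
    have hw1 : M.mulVec w = z • w := by simpa using hw.apply_eq_smul
    have hw0 : w 0 ≠ 0 := fun h => hw.2 (h2 z w h hw1)
    refine ⟨(Function.update ((w 0)⁻¹ • w) 0 z, y.2), ?_, by simp⟩
    rw [eigenChart_eq_iff]
    refine ⟨rfl, ?_⟩
    have : Function.update (Function.update ((w 0)⁻¹ • w) 0 z) 0 1 = (w 0)⁻¹ • w := by
      rw [Function.update_idem]
      refine Function.update_eq_self_iff.2 ?_
      simp [hw0]
    simp only [this, Function.update_self]
    rw [Matrix.mulVec_smul, ← hM, hw1, smul_comm]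
  have hroot : ∀ p, eigenChart p = y → p.1 0 ∈ M.charpoly.roots := by
    intro p hp
    rw [Polynomial.mem_roots (Matrix.charpoly_monic M).ne_zero, ← Matrix.charpoly_toLin',
      ← Module.End.hasEigenvalue_iff_isRoot_charpoly]
    refine Module.End.hasEigenvalue_of_hasEigenvector
      (x := Function.update p.1 0 1) ⟨?_, fun h => ?_⟩
    · rw [Module.End.mem_eigenspace_iff]
      simpa using ((eigenChart_eq_iff p y).1 hp).2
    · simpa using congrFun h 0
  -- A nonzero Jacobian is a nonzero derivative of the characteristic polynomial, so every root is
  -- simple.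
  have hnodup : M.charpoly.roots.Nodup := by
    refine Multiset.nodup_iff_count_le_one.2 fun z => ?_
    by_cases hz : z ∈ M.charpoly.roots
    · obtain ⟨p, hp, rfl⟩ := hex z hz
      rw [Polynomial.count_roots]
      by_contra! hlt
      have := (Polynomial.one_lt_rootMultiplicity_iff_isRoot (Matrix.charpoly_monic M).ne_zero).1 hlt
      refine h1 p hp ?_
      rw [det_chartJacobian p y hp]
      exact this.2
    · rw [Multiset.count_eq_zero_of_notMem hz]
      exact zero_le_one
  -- Two normalised eigenvectors for the same eigenvalue differ by a solution of the eigenvector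
  -- equation with vanishing first coordinate, which `h2` forces to be zero.
  have hinj : Set.InjOn (fun p : (Fin (n + 1) → ℂ) × (Fin (n + 1) → Fin n → ℂ) => p.1 0)
      (eigenChart ⁻¹' {y}) := by
    intro p hp p' hp' hpp
    have e := (eigenChart_eq_iff p y).1 hp
    have e' := (eigenChart_eq_iff p' y).1 hp'
    simp only at hpp
    have hd := h2 (p.1 0) (Function.update p.1 0 1 - Function.update p'.1 0 1) (by simp) (by
      rw [Matrix.mulVec_sub, hM, e.2, e'.2, hpp, smul_sub])
    refine Prod.ext ?_ (e.1.trans e'.1.symm)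
    ext i
    by_cases hi : i = 0
    · rw [hi, hpp]
    · have := congrFun (sub_eq_zero.1 hd) i
      simpa [hi] using this
  rw [eigenvalueCount, Multiset.countP_eq_card_filter,
    ← Set.InjOn.encard_image (hinj.mono Set.inter_subset_right)]
  have hset : (fun p : (Fin (n + 1) → ℂ) × (Fin (n + 1) → Fin n → ℂ) => p.1 0) ''
      ({p | p.1 0 ∈ A} ∩ eigenChart ⁻¹' {y}) =
      ((⟨M.charpoly.roots.filter (· ∈ A), hnodup.filter _⟩ : Finset ℂ) : Set ℂ) := by
    ext z
    simp only [Set.mem_image, Finset.mem_coe, Finset.mem_mk, Multiset.mem_filter]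
    constructor
    · rintro ⟨p, ⟨hA, hp⟩, rfl⟩
      exact ⟨hroot p hp, hA⟩
    · rintro ⟨hz, hA⟩
      obtain ⟨p, hp, rfl⟩ := hex z hz
      exact ⟨p, ⟨hA, hp⟩, rfl⟩
  rw [hset, Set.encard_coe_eq_coe_finsetCard]
  rfl

/-- Matrices with an eigenvector orthogonal to the first coordinate vector form a null set. -/
theorem volume_exists_eigenvector_zero :
    volume {y : (Fin (n + 1) → ℂ) × (Fin (n + 1) → Fin n → ℂ) |
      ∃ (z : ℂ) (v : Fin (n + 1) → ℂ), v 0 = 0 ∧ v ≠ 0 ∧ (consColumn y).mulVec v = z • v} = 0 := by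
  -- Column `k` of the parameter stores an eigenvector normalised to `1` in coordinate `k.succ`:
  -- that free slot holds the eigenvalue, and the slot of row `0` holds `v 0 = 0`. The map `Ψ k`
  -- replaces column `k` by the one solving the eigenvector equation. Hence the bad matrices are
  -- images of null subspaces under differentiable self-maps.
  let w : Fin n → ((Fin (n + 1) → ℂ) × (Fin (n + 1) → Fin n → ℂ)) → Fin (n + 1) → ℂ :=
    fun k y => Function.update (Function.update (fun i => y.2 i k) 0 0) k.succ 1
  let Ψ : Fin n → ((Fin (n + 1) → ℂ) × (Fin (n + 1) → Fin n → ℂ)) →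
      ((Fin (n + 1) → ℂ) × (Fin (n + 1) → Fin n → ℂ)) := fun k y =>
    (y.1, fun i j => if j = k then y.2 k.succ k * w k y i -
      ∑ l, (if l = k then 0 else w k y l.succ * y.2 i l) else y.2 i j)
  have hΨ : ∀ k, Differentiable ℝ (Ψ k) := by
    intro k
    have h2 : ∀ i j, Differentiable ℝ
      fun p : (Fin (n + 1) → ℂ) × (Fin (n + 1) → Fin n → ℂ) => p.2 i j := fun i j => by fun_prop
    have hw : ∀ i, Differentiable ℝ fun y => w k y i := by
      intro i
      by_cases h : i = k.succ
      · subst h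
        simp [w]
      · by_cases h' : i = 0
        · subst h'
          simp [w, h]
        · simpa [w, h, h'] using h2 i k
    refine differentiable_fst.prodMk (differentiable_pi.2 fun i => differentiable_pi.2 fun j => ?_)
    by_cases hj : j = k
    · simp only [hj, if_true]
      refine ((h2 _ _).mul (hw i)).sub (Differentiable.fun_sum fun l _ => ?_)
      by_cases hl : l = k
      · simp [hl]
      · simp only [hl, if_false]
        exact (hw l.succ).mul (h2 i l)
    · simpa [hj] using h2 i j
  have hnull : ∀ k : Fin n,
      volume {y : (Fin (n + 1) → ℂ) × (Fin (n + 1) → Fin n → ℂ) | y.2 0 k = 0} = 0 := by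
    intro k
    let e : ((Fin (n + 1) → ℂ) × (Fin (n + 1) → Fin n → ℂ)) →ₗ[ℝ] ℂ :=
      { toFun := fun y => y.2 0 k, map_add' := fun _ _ => rfl, map_smul' := fun _ _ => rfl }
    refine Measure.addHaar_submodule volume e.ker fun h => ?_
    have h1 : ((0 : Fin (n + 1) → ℂ), fun (_ : Fin (n + 1)) (_ : Fin n) => (1 : ℂ)) ∈ e.ker := by
      rw [h]; trivial
    exact one_ne_zero (show (1 : ℂ) = 0 from h1)
  refine measure_mono_null (t := ⋃ k, Ψ k '' {y | y.2 0 k = 0}) ?_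
    (measure_iUnion_null fun k => addHaar_image_eq_zero_of_differentiableOn_of_addHaar_eq_zero
      volume (hΨ k).differentiableOn (hnull k))
  rintro y ⟨z, v, hv0, hv, hyv⟩
  obtain ⟨k, hk⟩ : ∃ k : Fin n, v k.succ ≠ 0 := by
    by_contra! h
    refine hv (funext fun i => ?_)
    refine Fin.cases hv0 h i
  refine Set.mem_iUnion.2 ⟨k, (y.1, fun i j => if j = k then
    Function.update ((v k.succ)⁻¹ • v) k.succ z i else y.2 i j), ?_, ?_⟩
  · simp [hv0, Function.update_of_ne (Fin.succ_ne_zero k).symm]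
  · refine Prod.ext rfl (funext fun i => funext fun j => ?_)
    have hwv : w k (y.1, fun i j => if j = k then
        Function.update ((v k.succ)⁻¹ • v) k.succ z i else y.2 i j) = (v k.succ)⁻¹ • v := by
      ext i
      by_cases h : i = k.succ
      · subst h
        simp [w, hk]
      · by_cases h' : i = 0
        · subst h'
          simp [w, h, hv0]
        · simp [w, h, h']
    simp only [Ψ, hwv]
    by_cases hj : j = k
    · subst hj
      simp only [if_true, Function.update_self, Pi.smul_apply, smul_eq_mul]
      have hi : ∑ l, y.2 i l * v l.succ = z * v i := by
        have := congrFun hyv i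
        simpa [Matrix.mulVec, dotProduct, Fin.sum_univ_succ, consColumn, hv0] using this
      rw [← Finset.add_sum_erase _ _ (Finset.mem_univ j)] at hi
      have hs : ∑ l, (if l = j then 0 else (v j.succ)⁻¹ * v l.succ *
          if l = j then Function.update ((v j.succ)⁻¹ • v) j.succ z i else y.2 i l) =
          (v j.succ)⁻¹ * ∑ l ∈ Finset.univ.erase j, y.2 i l * v l.succ := by
        rw [← Finset.add_sum_erase _ _ (Finset.mem_univ j), Finset.mul_sum]
        simp only [if_true, zero_add]
        refine Finset.sum_congr rfl fun l hl => ?_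
        rw [if_neg (Finset.ne_of_mem_erase hl), if_neg (Finset.ne_of_mem_erase hl)]
        ring
      rw [hs, eq_sub_of_add_eq' hi]
      field_simp
      ring
    · simp [hj]

/-- The area formula counts regular preimages. By Sard's theorem almost every matrix has no critical
preimage, and almost every matrix has no eigenvector with vanishing first coordinate, so this count
is that of the eigenvalues in `A`. -/
theorem lintegral_eigenvalueCount_mul {A : Set ℂ} (hA : MeasurableSet A)
    {g : (Fin (n + 1) → ℂ) × (Fin (n + 1) → Fin n → ℂ) → ENNReal} (hg : Measurable g) :
    ∫⁻ y, (eigenvalueCount (consColumn y) A : ENNReal) * g y =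
      ∫⁻ p in {p : (Fin (n + 1) → ℂ) × (Fin (n + 1) → Fin n → ℂ) | p.1 0 ∈ A},
        ENNReal.ofReal (‖(chartJacobian p).det‖ ^ 2) * g (eigenChart p) := by
  have hS : MeasurableSet {p : (Fin (n + 1) → ℂ) × (Fin (n + 1) → Fin n → ℂ) | p.1 0 ∈ A} :=
    ((measurable_pi_apply 0).comp measurable_fst) hA
  have hstrict : ∀ p, HasStrictFDerivAt eigenChart (fderiv ℝ (eigenChart (n := n)) p) p := fun p =>
    contDiff_eigenChart.contDiffAt.hasStrictFDerivAt one_ne_zero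
  have hmain := (measurable_encard_and_lintegral volume hstrict
    (contDiff_eigenChart.continuous_fderiv one_ne_zero) hS).2 g hg
  have hcrit : volume (eigenChart '' {p | (fderiv ℝ (eigenChart (n := n)) p).det = 0}) = 0 :=
    addHaar_image_eq_zero_of_det_fderivWithin_eq_zero volume
      (fun p _ => (hstrict p).hasFDerivAt.hasFDerivWithinAt) fun p hp => hp
  have hdet : ∀ p, (fderiv ℝ (eigenChart (n := n)) p).det = 0 ↔ (chartJacobian p).det = 0 := by
    intro p
    rw [det_fderiv_eigenChart]
    simp
  simp_rw [det_fderiv_eigenChart, abs_pow, abs_norm] at hmain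
  rw [← hmain]
  refine lintegral_congr_ae ?_
  filter_upwards [measure_eq_zero_iff_ae_notMem.1 hcrit,
    measure_eq_zero_iff_ae_notMem.1 (volume_exists_eigenvector_zero (n := n))] with y h1 h2
  have h1' : ∀ p, eigenChart p = y → (chartJacobian p).det ≠ 0 := fun p hp h0 =>
    h1 ⟨p, (hdet p).2 h0, hp⟩
  have := eigenvalueCount_eq_encard y h1' (fun z v hv0 hv => by
    by_contra hne
    exact h2 ⟨z, v, hv0, hne, hv⟩) A
  have hset : {p : (Fin (n + 1) → ℂ) × (Fin (n + 1) → Fin n → ℂ) | p.1 0 ∈ A} ∩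
      {x | ‖(chartJacobian x).det‖ ^ 2 ≠ 0} ∩ eigenChart ⁻¹' {y} =
      {p | p.1 0 ∈ A} ∩ eigenChart ⁻¹' {y} := by
    ext p
    simp only [Set.mem_inter_iff, Set.mem_ofPred_eq, Set.mem_preimage, Set.mem_singleton_iff]
    constructor
    · rintro ⟨⟨a, -⟩, c⟩
      exact ⟨a, c⟩
    · rintro ⟨a, c⟩
      exact ⟨⟨a, by simpa using h1' p c⟩, c⟩
  simp only [hset, ← this]
  simp

end Counting

/-! ### The density of the matrix entries. -/

section Law

theorem lintegral_fin_prod_eq_prod {n : ℕ} {α : Type*} [MeasurableSpace α]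
    (μ : Fin n → Measure α) [∀ i, SigmaFinite (μ i)] (f : Fin n → α → ENNReal)
    (hf : ∀ i, Measurable (f i)) :
    ∫⁻ x, ∏ i, f i (x i) ∂(Measure.pi μ) = ∏ i, ∫⁻ a, f i a ∂(μ i) := by
  induction n with
  | zero => simp
  | succ n ih =>
    have hmp : MeasurePreserving (MeasurableEquiv.piFinSuccAbove (fun _ => α) 0).symm
        ((μ 0).prod (Measure.pi fun j => μ j.succ)) (Measure.pi μ) :=
      (measurePreserving_piFinSuccAbove μ 0).symm
    rw [← hmp.lintegral_comp_emb (MeasurableEquiv.measurableEmbedding _), Fin.prod_univ_succ,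
      ← ih (fun j => μ j.succ) (fun j => f j.succ) fun j => hf _,
      ← lintegral_prod_mul (hf 0).aemeasurable (Measurable.aemeasurable (by fun_prop))]
    refine lintegral_congr fun p => ?_
    rw [Fin.prod_univ_succ]
    simp [MeasurableEquiv.piFinSuccAbove, Fin.insertNthEquiv]

theorem pi_withDensity {n : ℕ} {α : Type*} [MeasurableSpace α]
    (μ : Fin n → Measure α) [∀ i, SigmaFinite (μ i)] (f : Fin n → α → ENNReal)
    (hf : ∀ i, Measurable (f i)) [∀ i, SigmaFinite ((μ i).withDensity (f i))] :
    Measure.pi (fun i => (μ i).withDensity (f i)) =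
      (Measure.pi μ).withDensity fun x => ∏ i, f i (x i) := by
  refine Measure.pi_eq fun s hs => ?_
  rw [withDensity_apply _ (MeasurableSet.univ_pi hs), Measure.restrict_pi_pi,
    lintegral_fin_prod_eq_prod _ _ hf]
  exact Finset.prod_congr rfl fun i _ => (withDensity_apply _ (hs i)).symm

theorem pi_pi_withDensity {m n : ℕ} {α : Type*} [MeasurableSpace α] (μ : Measure α)
    [SigmaFinite μ] (f : α → ENNReal) (hf : Measurable f) [SigmaFinite (μ.withDensity f)] :
    (Measure.pi fun _ : Fin m => Measure.pi fun _ : Fin n => μ.withDensity f) =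
      (Measure.pi fun _ : Fin m => Measure.pi fun _ : Fin n => μ).withDensity
        fun x => ∏ i, ∏ j, f (x i j) := by
  have h2 : (Measure.pi fun _ : Fin n => μ.withDensity f) =
      (Measure.pi fun _ : Fin n => μ).withDensity fun x => ∏ j, f (x j) :=
    pi_withDensity (fun _ => μ) (fun _ => f) fun _ => hf
  have : SigmaFinite ((Measure.pi fun _ : Fin n => μ).withDensity fun x => ∏ j, f (x j)) := by
    rw [← h2]; infer_instance
  rw [h2]
  exact pi_withDensity (fun _ => Measure.pi fun _ : Fin n => μ) (fun _ x => ∏ j, f (x j))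
    fun _ => Finset.measurable_prod _ fun j _ => hf.comp (measurable_pi_apply j)

/-- The density of the entries of `G_τ`. -/
noncomputable def entryDensity (τ : ℝ) (g : ℂ) : ℝ :=
  1 / (Real.pi * Real.sqrt (1 - τ ^ 2)) *
    Real.exp (-(g.re ^ 2 / (1 + τ) + g.im ^ 2 / (1 - τ)))

theorem continuous_entryDensity (τ : ℝ) : Continuous (entryDensity τ) := by
  unfold entryDensity
  fun_prop

theorem entryDensity_nonneg (τ : ℝ) (g : ℂ) : 0 ≤ entryDensity τ g := by
  unfold entryDensity
  positivity

theorem measurable_ofReal_entryDensity (τ : ℝ) :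
    Measurable fun g => ENNReal.ofReal (entryDensity τ g) :=
  (continuous_entryDensity τ).measurable.ennreal_ofReal

/-- The law of the entries of `G_τ`. -/
noncomputable def entryLaw (τ : ℝ) : Measure ℂ :=
  volume.withDensity fun g => ENNReal.ofReal (entryDensity τ g)

/-- The map `(x, y) ↦ √((1+τ)/2) x + i √((1-τ)/2) y`. -/
noncomputable def entryEquiv (τ : ℝ) (h0 : 0 ≤ τ) (h1 : τ < 1) : ℝ × ℝ ≃ᵐ ℂ :=
  ((Homeomorph.mulLeft₀ (Real.sqrt ((1 + τ) / 2)) (Real.sqrt_pos.2 (by linarith)).ne').prodCongr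
    (Homeomorph.mulLeft₀ (Real.sqrt ((1 - τ) / 2))
      (Real.sqrt_pos.2 (by linarith)).ne')).toMeasurableEquiv.trans
    Complex.measurableEquivRealProd.symm

theorem entryEquiv_apply (τ : ℝ) (h0 : 0 ≤ τ) (h1 : τ < 1) (p : ℝ × ℝ) :
    entryEquiv τ h0 h1 p = (Real.sqrt ((1 + τ) / 2) : ℂ) * (p.1 : ℂ) +
      Complex.I * (Real.sqrt ((1 - τ) / 2) : ℂ) * (p.2 : ℂ) := by
  apply Complex.ext <;> simp [entryEquiv, Complex.measurableEquivRealProd_symm_apply]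

theorem measurePreserving_entryEquiv (τ : ℝ) (h0 : 0 ≤ τ) (h1 : τ < 1) :
    MeasurePreserving (entryEquiv τ h0 h1) ((gaussianReal 0 1).prod (gaussianReal 0 1))
      (entryLaw τ) := by
  refine ⟨(entryEquiv τ h0 h1).measurable, ?_⟩
  have ha : (0 : ℝ) < (1 + τ) / 2 := by linarith
  have hb : (0 : ℝ) < (1 - τ) / 2 := by linarith
  have hmap : ((gaussianReal 0 1).prod (gaussianReal 0 1)).map
      (Prod.map (Real.sqrt ((1 + τ) / 2) * ·) (Real.sqrt ((1 - τ) / 2) * ·)) =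
      (volume : Measure (ℝ × ℝ)).withDensity fun p =>
        gaussianPDF 0 (NNReal.mk ((1 + τ) / 2) ha.le) p.1 * gaussianPDF 0 (NNReal.mk ((1 - τ) / 2) hb.le) p.2 := by
    rw [← Measure.map_prod_map _ _ (by fun_prop) (by fun_prop), gaussianReal_map_const_mul,
      gaussianReal_map_const_mul, Measure.volume_eq_prod]
    have e1 : NNReal.mk (Real.sqrt ((1 + τ) / 2) ^ 2) (sq_nonneg _) * 1 = (NNReal.mk ((1 + τ) / 2) ha.le) := by
      ext; rw [mul_one]; exact Real.sq_sqrt ha.le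
    have e2 : NNReal.mk (Real.sqrt ((1 - τ) / 2) ^ 2) (sq_nonneg _) * 1 = (NNReal.mk ((1 - τ) / 2) hb.le) := by
      ext; rw [mul_one]; exact Real.sq_sqrt hb.le
    have v1 : NNReal.mk ((1 + τ) / 2) ha.le ≠ 0 := fun h => ha.ne' (congrArg NNReal.toReal h)
    have v2 : NNReal.mk ((1 - τ) / 2) hb.le ≠ 0 := fun h => hb.ne' (congrArg NNReal.toReal h)
    rw [e1, e2, mul_zero, mul_zero, gaussianReal_of_var_ne_zero _ v1,
      gaussianReal_of_var_ne_zero _ v2]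
    exact prod_withDensity (measurable_gaussianPDF _ _) (measurable_gaussianPDF _ _)
  have hcoe : ⇑(entryEquiv τ h0 h1) = Complex.measurableEquivRealProd.symm ∘
      (Prod.map (Real.sqrt ((1 + τ) / 2) * ·) (Real.sqrt ((1 - τ) / 2) * ·)) := rfl
  rw [hcoe, ← Measure.map_map (MeasurableEquiv.measurable _) (by fun_prop), hmap]
  ext s hs
  rw [MeasurableEquiv.map_apply, withDensity_apply _ ((MeasurableEquiv.measurable _) hs), entryLaw,
    withDensity_apply _ hs, ← (Complex.volume_preserving_equiv_real_prod.symm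
      _).setLIntegral_comp_preimage_emb (MeasurableEquiv.measurableEmbedding _)]
  refine lintegral_congr fun p => ?_
  rw [Complex.measurableEquivRealProd_symm_apply]
  simp only [gaussianPDF]
  rw [← ENNReal.ofReal_mul (gaussianPDFReal_nonneg _ _ _)]
  congr 1
  simp only [gaussianPDFReal, entryDensity, NNReal.coe_mk, sub_zero]
  rw [mul_mul_mul_comm, ← Real.exp_add, ← mul_inv, ← Real.sqrt_mul (by positivity)]
  have e3 : 2 * Real.pi * ((1 + τ) / 2) * (2 * Real.pi * ((1 - τ) / 2)) =
      Real.pi ^ 2 * (1 - τ ^ 2) := by ring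
  rw [e3, Real.sqrt_mul (sq_nonneg _), Real.sqrt_sq Real.pi_pos.le, one_div]
  congr 2
  have : (1 + τ) ≠ 0 := by linarith
  have : (1 - τ) ≠ 0 := by linarith
  field_simp
  ring

instance (τ : ℝ) : SigmaFinite (entryLaw τ) := by
  unfold entryLaw; infer_instance

/-- The law of `G_τ` has an explicit density. -/
theorem lintegral_interpolatingGinibre (N : ℕ) (τ : ℝ) (h0 : 0 ≤ τ) (h1 : τ < 1)
    (f : Matrix (Fin N) (Fin N) ℂ → ENNReal) :
    ∫⁻ ω, f (interpolatingGinibre N τ ω) ∂(realGinibrePair N) =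
      ∫⁻ M : Fin N → Fin N → ℂ,
        (∏ i, ∏ j, ENNReal.ofReal (entryDensity τ (M i j))) * f (Matrix.of M) := by
  have hrow := measurePreserving_arrowProdEquivProdArrow ℝ ℝ (Fin N)
    (fun _ => gaussianReal 0 1) (fun _ => gaussianReal 0 1)
  have hrows := measurePreserving_pi (ι := Fin N) _ _ fun _ => hrow
  have hpair := measurePreserving_arrowProdEquivProdArrow (Fin N → ℝ) (Fin N → ℝ) (Fin N)
    (fun _ => Measure.pi fun _ => gaussianReal 0 1) (fun _ => Measure.pi fun _ => gaussianReal 0 1)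
  let e1 : (Fin N → Fin N → ℝ × ℝ) ≃ᵐ (Fin N → Fin N → ℝ) × (Fin N → Fin N → ℝ) :=
    (MeasurableEquiv.piCongrRight fun _ => MeasurableEquiv.arrowProdEquivProdArrow ℝ ℝ (Fin N)).trans
      (MeasurableEquiv.arrowProdEquivProdArrow (Fin N → ℝ) (Fin N → ℝ) (Fin N))
  let e2 : (Fin N → Fin N → ℝ × ℝ) ≃ᵐ (Fin N → Fin N → ℂ) :=
    MeasurableEquiv.piCongrRight fun _ => MeasurableEquiv.piCongrRight fun _ => entryEquiv τ h0 h1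
  have he1 : MeasurePreserving e1 (Measure.pi fun _ => Measure.pi fun _ =>
      (gaussianReal 0 1).prod (gaussianReal 0 1)) (realGinibrePair N) := hpair.comp hrows
  have he2 : MeasurePreserving e2 (Measure.pi fun _ => Measure.pi fun _ =>
      (gaussianReal 0 1).prod (gaussianReal 0 1))
      (Measure.pi fun _ => Measure.pi fun _ => entryLaw τ) :=
    measurePreserving_pi _ _ fun _ => measurePreserving_pi _ _ fun _ =>
      measurePreserving_entryEquiv τ h0 h1
  have hmeas : Measurable fun x : Fin N → Fin N → ℂ =>
      ∏ i, ∏ j, ENNReal.ofReal (entryDensity τ (x i j)) :=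
    Finset.measurable_prod _ fun i _ => Finset.measurable_prod _ fun j _ =>
      (measurable_ofReal_entryDensity τ).comp
        ((measurable_pi_apply j).comp (measurable_pi_apply i))
  have hlaw : (Measure.pi fun _ : Fin N => Measure.pi fun _ : Fin N => entryLaw τ) =
      (volume : Measure (Fin N → Fin N → ℂ)).withDensity
        fun x => ∏ i, ∏ j, ENNReal.ofReal (entryDensity τ (x i j)) :=
    pi_pi_withDensity volume _ (measurable_ofReal_entryDensity τ)
  rw [← he1.lintegral_comp_emb e1.measurableEmbedding]
  have hcomp : ∀ a, interpolatingGinibre N τ (e1 a) = Matrix.of (e2 a) := by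
    intro a
    ext i j
    exact (entryEquiv_apply τ h0 h1 (a i j)).symm
  simp_rw [hcomp]
  rw [he2.lintegral_comp_emb e2.measurableEmbedding (fun M => f (Matrix.of M)), hlaw,
    lintegral_withDensity_eq_lintegral_mul_non_measurable _ hmeas]
  · rfl
  · exact Filter.Eventually.of_forall fun x => ENNReal.prod_lt_top fun i _ =>
      ENNReal.prod_lt_top fun j _ => ENNReal.ofReal_lt_top

end Law

/-! ### The mean density as an integral over eigenvectors and columns. -/

section EigenvalueIntegral

variable {n : ℕ}

/-- Separate the first column of a matrix from the other columns. -/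
noncomputable def firstColumnEquiv (n : ℕ) : (Fin (n + 1) → Fin (n + 1) → ℂ) ≃ᵐ
    (Fin (n + 1) → ℂ) × (Fin (n + 1) → Fin n → ℂ) :=
  (MeasurableEquiv.piCongrRight fun _ : Fin (n + 1) =>
    MeasurableEquiv.piFinSuccAbove (fun _ : Fin (n + 1) => ℂ) 0).trans
    (MeasurableEquiv.arrowProdEquivProdArrow ℂ (Fin n → ℂ) (Fin (n + 1)))

theorem measurePreserving_firstColumnEquiv (n : ℕ) :
    MeasurePreserving (firstColumnEquiv n) volume volume :=
  (volume_measurePreserving_arrowProdEquivProdArrow ℂ (Fin n → ℂ) (Fin (n + 1))).comp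
    (measurePreserving_pi (fun _ => volume) (fun _ => volume) fun _ =>
      volume_preserving_piFinSuccAbove (fun _ => ℂ) 0)

theorem firstColumnEquiv_apply (M : Fin (n + 1) → Fin (n + 1) → ℂ) :
    firstColumnEquiv n M = (fun i => M i 0, fun i j => M i j.succ) := rfl

theorem consColumn_firstColumnEquiv (M : Fin (n + 1) → Fin (n + 1) → ℂ) :
    consColumn (firstColumnEquiv n M) = Matrix.of M := by
  ext i j
  refine Fin.cases ?_ (fun j => ?_) j <;> simp [consColumn, firstColumnEquiv_apply]

/-- The joint density of the first column and the other columns of `G_τ`. -/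
noncomputable def columnDensity (τ : ℝ) (y : (Fin (n + 1) → ℂ) × (Fin (n + 1) → Fin n → ℂ)) : ℝ :=
  ∏ i, (entryDensity τ (y.1 i) * ∏ j, entryDensity τ (y.2 i j))

theorem continuous_columnDensity (τ : ℝ) : Continuous (columnDensity (n := n) τ) := by
  have := continuous_entryDensity τ
  unfold columnDensity
  fun_prop

theorem columnDensity_nonneg (τ : ℝ) (y : (Fin (n + 1) → ℂ) × (Fin (n + 1) → Fin n → ℂ)) :
    0 ≤ columnDensity τ y :=
  Finset.prod_nonneg fun _ _ => mul_nonneg (entryDensity_nonneg _ _)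
    (Finset.prod_nonneg fun _ _ => entryDensity_nonneg _ _)

theorem continuous_eigenChart : Continuous (eigenChart (n := n)) := contDiff_eigenChart.continuous

theorem continuous_det_chartJacobian : Continuous fun p => (chartJacobian (n := n) p).det := by
  refine Continuous.matrix_det (continuous_matrix fun i j => ?_)
  refine Fin.cases ?_ (fun j => ?_) j
  · by_cases hi : i = 0
    · subst hi
      simpa [chartJacobian] using continuous_const
    · simp only [chartJacobian, Matrix.of_apply, Fin.cons_zero, Function.update_of_ne hi]
      fun_prop
  · simp only [chartJacobian, Matrix.of_apply, Fin.cons_succ]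
    split_ifs <;> fun_prop

/-- Tonelli isolates the eigenvalue coordinate; the condition that it lie in `A` involves no other
variable, so the two inner integrals give the density at `z`. -/
theorem lintegral_eigenvalueCount (τ : ℝ) (h0 : 0 ≤ τ) (h1 : τ < 1) {A : Set ℂ}
    (hA : MeasurableSet A) :
    ∫⁻ ω, (eigenvalueCount (interpolatingGinibre (n + 1) τ ω) A : ENNReal)
        ∂(realGinibrePair (n + 1)) =
      ∫⁻ z in A, ∫⁻ u : Fin n → ℂ, ∫⁻ g : Fin (n + 1) → Fin n → ℂ,
        ENNReal.ofReal (columnDensity τ (eigenChart (Fin.cons z u, g)) *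
          ‖(chartJacobian (Fin.cons z u, g)).det‖ ^ 2) := by
  rw [lintegral_interpolatingGinibre (n + 1) τ h0 h1 fun M => (eigenvalueCount M A : ENNReal)]
  have h2 : ∀ M : Fin (n + 1) → Fin (n + 1) → ℂ,
      (∏ i, ∏ j, ENNReal.ofReal (entryDensity τ (M i j))) * (eigenvalueCount (Matrix.of M) A : ENNReal)
      = (fun y => (eigenvalueCount (consColumn y) A : ENNReal) * ENNReal.ofReal (columnDensity τ y))
        (firstColumnEquiv n M) := by
    intro M
    simp only [consColumn_firstColumnEquiv]
    rw [mul_comm]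
    congr 1
    rw [columnDensity, ENNReal.ofReal_prod_of_nonneg]
    · refine Finset.prod_congr rfl fun i _ => ?_
      rw [Fin.prod_univ_succ, ENNReal.ofReal_mul (entryDensity_nonneg _ _),
        ENNReal.ofReal_prod_of_nonneg fun _ _ => entryDensity_nonneg _ _]
      rfl
    · exact fun i _ => mul_nonneg (entryDensity_nonneg _ _)
        (Finset.prod_nonneg fun _ _ => entryDensity_nonneg _ _)
  refine (lintegral_congr h2).trans ?_
  rw [(measurePreserving_firstColumnEquiv n).lintegral_comp_emb
    (firstColumnEquiv n).measurableEmbedding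
    (fun y => (eigenvalueCount (consColumn y) A : ENNReal) * ENNReal.ofReal (columnDensity τ y)),
    lintegral_eigenvalueCount_mul hA (continuous_columnDensity τ).measurable.ennreal_ofReal]
  have hS : MeasurableSet {p : (Fin (n + 1) → ℂ) × (Fin (n + 1) → Fin n → ℂ) | p.1 0 ∈ A} :=
    ((measurable_pi_apply 0).comp measurable_fst) hA
  let F : (Fin (n + 1) → ℂ) × (Fin (n + 1) → Fin n → ℂ) → ENNReal := fun p =>
    ENNReal.ofReal (columnDensity τ (eigenChart p) * ‖(chartJacobian p).det‖ ^ 2)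
  have hF : Measurable F := (((continuous_columnDensity τ).comp continuous_eigenChart).mul
    (continuous_det_chartJacobian.norm.pow 2)).measurable.ennreal_ofReal
  have h3 : ∀ p : (Fin (n + 1) → ℂ) × (Fin (n + 1) → Fin n → ℂ),
      ENNReal.ofReal (‖(chartJacobian p).det‖ ^ 2) *
        ENNReal.ofReal (columnDensity τ (eigenChart p)) = F p := fun p => by
    rw [mul_comm, ← ENNReal.ofReal_mul (columnDensity_nonneg _ _)]
  simp_rw [h3]
  rw [← lintegral_indicator hS, Measure.volume_eq_prod,
    lintegral_prod _ (hF.indicator hS).aemeasurable]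
  have hmp := (volume_preserving_piFinSuccAbove (fun _ : Fin (n + 1) => ℂ) 0).symm
  rw [← hmp.lintegral_comp_emb (MeasurableEquiv.measurableEmbedding _), Measure.volume_eq_prod,
    lintegral_prod, ← lintegral_indicator hA]
  · refine lintegral_congr fun z => ?_
    have h4 : ∀ u : Fin n → ℂ, (MeasurableEquiv.piFinSuccAbove (fun _ : Fin (n + 1) => ℂ) 0).symm
        (z, u) = Fin.cons z u := fun u => by
      simp [MeasurableEquiv.piFinSuccAbove, Fin.insertNthEquiv]
    simp_rw [h4]
    by_cases hz : z ∈ A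
    · rw [Set.indicator_of_mem hz]
      refine lintegral_congr fun u => lintegral_congr fun g => ?_
      rw [Set.indicator_of_mem (by simpa using hz)]
    · rw [Set.indicator_of_notMem hz]
      simp [Set.indicator, hz]
  · exact (Measurable.lintegral_prod_right' (hF.indicator hS)).comp_aemeasurable
      (MeasurableEquiv.measurable _).aemeasurable

end EigenvalueIntegral

/-! ### First and second moments of the entries. -/

section Moments

local notation "conj" => starRingEnd ℂ

theorem isProbabilityMeasure_entryLaw (τ : ℝ) (h0 : 0 ≤ τ) (h1 : τ < 1) :
    IsProbabilityMeasure (entryLaw τ) := by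
  rw [← (measurePreserving_entryEquiv τ h0 h1).map_eq]
  exact Measure.isProbabilityMeasure_map (MeasurableEquiv.measurable _).aemeasurable

theorem memLp_entryLaw (τ : ℝ) (h0 : 0 ≤ τ) (h1 : τ < 1) :
    MemLp (fun g : ℂ => g) 2 (entryLaw τ) := by
  have hmp := measurePreserving_entryEquiv τ h0 h1
  rw [← hmp.map_eq]
  refine (memLp_map_measure_iff aestronglyMeasurable_id hmp.measurable.aemeasurable).2 ?_
  have hX : MemLp (fun x : ℝ => (x : ℂ)) 2 (gaussianReal 0 1) :=
    (memLp_id_gaussianReal 2).ofReal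
  refine MemLp.ae_eq (Filter.Eventually.of_forall fun p => (entryEquiv_apply τ h0 h1 p).symm) ?_
  exact ((hX.comp_fst _).const_mul _).add ((hX.comp_snd _).const_mul _)

theorem integral_entryLaw (τ : ℝ) (h0 : 0 ≤ τ) (h1 : τ < 1) (f : ℂ → ℂ) :
    ∫ g, f g ∂(entryLaw τ) = ∫ p : ℝ × ℝ, f ((Real.sqrt ((1 + τ) / 2) : ℂ) * (p.1 : ℂ) +
      Complex.I * (Real.sqrt ((1 - τ) / 2) : ℂ) * (p.2 : ℂ))
        ∂((gaussianReal 0 1).prod (gaussianReal 0 1)) := by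
  rw [← (measurePreserving_entryEquiv τ h0 h1).integral_comp
    (entryEquiv τ h0 h1).measurableEmbedding]
  simp_rw [entryEquiv_apply]

theorem integral_sq_gaussianReal : ∫ x, x ^ 2 ∂(gaussianReal 0 1) = 1 := by
  have h := variance_id_gaussianReal (μ := 0) (v := 1)
  rw [variance_of_integral_eq_zero aemeasurable_id (by simp)] at h
  simpa using h

/-- Both `g * conj g` and `g * g` have this form in the two underlying real Gaussians; the mixed
term integrates to zero. -/
theorem integral_gaussian_pair (a b c : ℝ) :
    Integrable (fun p : ℝ × ℝ => ((a * p.1 ^ 2 + b * p.2 ^ 2 : ℝ) : ℂ) +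
      Complex.I * ((c * (p.1 * p.2) : ℝ) : ℂ)) ((gaussianReal 0 1).prod (gaussianReal 0 1)) ∧
    ∫ p : ℝ × ℝ, (((a * p.1 ^ 2 + b * p.2 ^ 2 : ℝ) : ℂ) +
      Complex.I * ((c * (p.1 * p.2) : ℝ) : ℂ)) ∂((gaussianReal 0 1).prod (gaussianReal 0 1)) =
      a + b := by
  have hX : MemLp (fun x : ℝ => x) 2 (gaussianReal 0 1) := memLp_id_gaussianReal 2
  have i1 : Integrable (fun x : ℝ => x ^ 2) (gaussianReal 0 1) := hX.integrable_sq
  have i0 : Integrable (fun x : ℝ => x) (gaussianReal 0 1) := hX.integrable one_le_two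
  have j1 := i1.comp_fst (gaussianReal 0 1)
  have j2 := i1.comp_snd (gaussianReal 0 1)
  have j3 := i0.mul_prod i0
  have k1 : Integrable (fun p : ℝ × ℝ => a * p.1 ^ 2 + b * p.2 ^ 2)
      ((gaussianReal 0 1).prod (gaussianReal 0 1)) := (j1.const_mul a).add (j2.const_mul b)
  have k2 : Integrable (fun p : ℝ × ℝ => c * (p.1 * p.2))
      ((gaussianReal 0 1).prod (gaussianReal 0 1)) := j3.const_mul c
  refine ⟨k1.ofReal.add (k2.ofReal.const_mul _), ?_⟩
  rw [integral_add k1.ofReal (k2.ofReal.const_mul _), integral_const_mul, integral_complex_ofReal,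
    integral_complex_ofReal, integral_const_mul, integral_add (j1.const_mul a) (j2.const_mul b),
    integral_const_mul, integral_const_mul, integral_fun_fst (fun x : ℝ => x ^ 2),
    integral_fun_snd (fun x : ℝ => x ^ 2), integral_prod_mul (fun x : ℝ => x) (fun x : ℝ => x),
    integral_sq_gaussianReal]
  simp

theorem integral_entryLaw_id (τ : ℝ) (h0 : 0 ≤ τ) (h1 : τ < 1) :
    ∫ g, g ∂(entryLaw τ) = 0 := by
  rw [integral_entryLaw τ h0 h1 (fun g => g)]
  have i0 : Integrable (fun x : ℝ => (x : ℂ)) (gaussianReal 0 1) :=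
    ((memLp_id_gaussianReal 1).integrable le_rfl).ofReal
  rw [integral_add ((i0.comp_fst _).const_mul _) ((i0.comp_snd _).const_mul _), integral_const_mul,
    integral_const_mul, integral_fun_fst (fun x : ℝ => (x : ℂ)),
    integral_fun_snd (fun x : ℝ => (x : ℂ)), integral_complex_ofReal]
  simp

theorem integral_entryLaw_mul_conj (τ : ℝ) (h0 : 0 ≤ τ) (h1 : τ < 1) :
    ∫ g, g * conj g ∂(entryLaw τ) = 1 := by
  rw [integral_entryLaw τ h0 h1 fun g => g * conj g]
  have h := (integral_gaussian_pair ((1 + τ) / 2) ((1 - τ) / 2) 0).2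
  rw [show (((1 + τ) / 2 : ℝ) : ℂ) + (((1 - τ) / 2 : ℝ) : ℂ) = 1 by push_cast; ring] at h
  rw [← h]
  refine integral_congr_ae (Filter.Eventually.of_forall fun p => ?_)
  have ea : ((Real.sqrt ((1 + τ) / 2) : ℝ) : ℂ) ^ 2 = ((1 + τ) / 2 : ℝ) := by
    rw [← Complex.ofReal_pow, Real.sq_sqrt (by linarith)]
  have eb : ((Real.sqrt ((1 - τ) / 2) : ℝ) : ℂ) ^ 2 = ((1 - τ) / 2 : ℝ) := by
    rw [← Complex.ofReal_pow, Real.sq_sqrt (by linarith)]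
  simp only [map_add, map_mul, Complex.conj_ofReal, Complex.conj_I]
  push_cast at ea eb ⊢
  linear_combination (p.1 : ℂ) ^ 2 * ea + (p.2 : ℂ) ^ 2 * eb -
    ((Real.sqrt ((1 - τ) / 2) : ℝ) : ℂ) ^ 2 * (p.2 : ℂ) ^ 2 * Complex.I_sq

theorem integral_entryLaw_mul_self (τ : ℝ) (h0 : 0 ≤ τ) (h1 : τ < 1) :
    ∫ g, g * g ∂(entryLaw τ) = τ := by
  rw [integral_entryLaw τ h0 h1 fun g => g * g]
  have h := (integral_gaussian_pair ((1 + τ) / 2) (-((1 - τ) / 2))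
    (2 * Real.sqrt ((1 + τ) / 2) * Real.sqrt ((1 - τ) / 2))).2
  rw [show (((1 + τ) / 2 : ℝ) : ℂ) + ((-((1 - τ) / 2) : ℝ) : ℂ) = τ by push_cast; ring] at h
  rw [← h]
  refine integral_congr_ae (Filter.Eventually.of_forall fun p => ?_)
  have ea : ((Real.sqrt ((1 + τ) / 2) : ℝ) : ℂ) ^ 2 = ((1 + τ) / 2 : ℝ) := by
    rw [← Complex.ofReal_pow, Real.sq_sqrt (by linarith)]
  have eb : ((Real.sqrt ((1 - τ) / 2) : ℝ) : ℂ) ^ 2 = ((1 - τ) / 2 : ℝ) := by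
    rw [← Complex.ofReal_pow, Real.sq_sqrt (by linarith)]
  push_cast at ea eb ⊢
  linear_combination (p.1 : ℂ) ^ 2 * ea - (p.2 : ℂ) ^ 2 * eb +
    ((Real.sqrt ((1 - τ) / 2) : ℝ) : ℂ) ^ 2 * (p.2 : ℂ) ^ 2 * Complex.I_sq

variable {n : ℕ} {τ : ℝ}

theorem memLp_pi_entryLaw (h0 : 0 ≤ τ) (h1 : τ < 1) (j : Fin n) :
    MemLp (fun g : Fin n → ℂ => g j) 2 (Measure.pi fun _ => entryLaw τ) := by
  have := isProbabilityMeasure_entryLaw τ h0 h1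
  exact (memLp_entryLaw τ h0 h1).comp_measurePreserving
    (measurePreserving_eval (fun _ : Fin n => entryLaw τ) j)

theorem integral_pi_entryLaw_mul (h0 : 0 ≤ τ) (h1 : τ < 1) (f : ℂ → ℂ) (hf : Continuous f)
    (hf0 : ∫ g, f g ∂(entryLaw τ) = 0) (j k : Fin n) :
    ∫ g : Fin n → ℂ, g j * f (g k) ∂(Measure.pi fun _ => entryLaw τ) =
      if j = k then ∫ g, g * f g ∂(entryLaw τ) else 0 := by
  have := isProbabilityMeasure_entryLaw τ h0 h1
  split_ifs with h
  · subst h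
    have hc : Continuous fun g => g * f g := by fun_prop
    exact integral_comp_eval (μ := fun _ : Fin n => entryLaw τ) (f := fun g => g * f g)
      hc.aestronglyMeasurable
  · have hind : IndepFun (fun g : Fin n → ℂ => g j) (fun g => g k)
        (Measure.pi fun _ => entryLaw τ) :=
      (iIndepFun_pi (μ := fun _ : Fin n => entryLaw τ) (X := fun _ g => g)
        fun _ => aemeasurable_id).indepFun h
    rw [IndepFun.integral_fun_mul_eq_mul_integral (X := fun g : Fin n → ℂ => g j)
      (Y := fun g => f (g k)) (hind.comp measurable_id hf.measurable)
      (measurable_pi_apply j).aestronglyMeasurable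
      (hf.comp (continuous_apply k)).aestronglyMeasurable,
      integral_comp_eval (μ := fun _ : Fin n => entryLaw τ) (f := f) hf.aestronglyMeasurable,
      hf0, mul_zero]

theorem integral_pi_entryLaw_mul_conj (h0 : 0 ≤ τ) (h1 : τ < 1) (j k : Fin n) :
    ∫ g : Fin n → ℂ, g j * conj (g k) ∂(Measure.pi fun _ => entryLaw τ) =
      if j = k then 1 else 0 := by
  rw [integral_pi_entryLaw_mul h0 h1 conj Complex.continuous_conj
    (by rw [integral_conj, integral_entryLaw_id τ h0 h1, map_zero]),
    integral_entryLaw_mul_conj τ h0 h1]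

theorem integral_pi_entryLaw_mul_self (h0 : 0 ≤ τ) (h1 : τ < 1) (j k : Fin n) :
    ∫ g : Fin n → ℂ, g j * g k ∂(Measure.pi fun _ => entryLaw τ) =
      if j = k then (τ : ℂ) else 0 := by
  rw [integral_pi_entryLaw_mul h0 h1 (fun g => g) continuous_id (integral_entryLaw_id τ h0 h1),
    integral_entryLaw_mul_self τ h0 h1]

theorem pi_entryLaw : (Measure.pi fun _ : Fin n => entryLaw τ) =
    (volume : Measure (Fin n → ℂ)).withDensity
      fun g => ∏ j, ENNReal.ofReal (entryDensity τ (g j)) :=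
  pi_withDensity (fun _ => volume) _ fun _ => measurable_ofReal_entryDensity τ

theorem toReal_prod_entryDensity (g : Fin n → ℂ) :
    (∏ j, ENNReal.ofReal (entryDensity τ (g j))).toReal = ∏ j, entryDensity τ (g j) := by
  rw [ENNReal.toReal_prod]
  exact Finset.prod_congr rfl fun j _ => ENNReal.toReal_ofReal (entryDensity_nonneg _ _)

theorem measurable_prod_entryDensity :
    Measurable fun g : Fin n → ℂ => ∏ j, ENNReal.ofReal (entryDensity τ (g j)) :=
  Finset.measurable_prod _ fun j _ =>
    (measurable_ofReal_entryDensity τ).comp (measurable_pi_apply j)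

theorem integrable_pi_entryLaw_iff (F : (Fin n → ℂ) → ℂ) :
    Integrable F (Measure.pi fun _ => entryLaw τ) ↔
      Integrable fun g => ((∏ j, entryDensity τ (g j) : ℝ) : ℂ) * F g := by
  rw [pi_entryLaw, integrable_withDensity_iff_integrable_smul' measurable_prod_entryDensity
    (Filter.Eventually.of_forall fun x => ENNReal.prod_lt_top fun j _ => ENNReal.ofReal_lt_top)]
  simp_rw [toReal_prod_entryDensity, Complex.real_smul]

theorem integral_pi_entryLaw (F : (Fin n → ℂ) → ℂ) :
    ∫ g, F g ∂(Measure.pi fun _ => entryLaw τ) =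
      ∫ g, ((∏ j, entryDensity τ (g j) : ℝ) : ℂ) * F g := by
  rw [pi_entryLaw, integral_withDensity_eq_integral_toReal_smul measurable_prod_entryDensity
    (Filter.Eventually.of_forall fun x => ENNReal.prod_lt_top fun j _ => ENNReal.ofReal_lt_top)]
  simp_rw [toReal_prod_entryDensity, Complex.real_smul]

end Moments

/-! ### A Gaussian row conditioned on its product with the eigenvector. -/

section Rows

local notation "conj" => starRingEnd ℂ

variable {n : ℕ}

/-- The vector with first coordinate `1` and remaining coordinates `u`. -/
def affineVec (u : Fin n → ℂ) : Fin (n + 1) → ℂ := Fin.cons 1 u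

/-- `|v|²` for `v = affineVec u`. -/
noncomputable def normSum (u : Fin n → ℂ) : ℝ := ∑ i, ‖affineVec u i‖ ^ 2

/-- `v ⬝ v` for `v = affineVec u`. -/
noncomputable def squareSum (u : Fin n → ℂ) : ℂ := ∑ i, affineVec u i * affineVec u i

/-- `|v|⁴ - τ² |v ⬝ v|²` for `v = affineVec u`. -/
noncomputable def disc (τ : ℝ) (u : Fin n → ℂ) : ℝ := normSum u ^ 2 - τ ^ 2 * ‖squareSum u‖ ^ 2

/-- The Lagrange multiplier of the constraint `ξ ⬝ v = h`. -/
noncomputable def multiplier (τ : ℝ) (u : Fin n → ℂ) (h : ℂ) : ℂ :=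
  (normSum u * conj h - τ * conj (squareSum u) * h) / disc τ u

/-- The mean of a row `ξ` of `G_τ` conditioned on `ξ ⬝ v = h`. -/
noncomputable def rowMean (τ : ℝ) (u : Fin n → ℂ) (h : ℂ) (j : Fin (n + 1)) : ℂ :=
  conj (multiplier τ u h) * conj (affineVec u j) + τ * multiplier τ u h * affineVec u j

/-- The vector `ξ` with `ξ ⬝ v = h` and all coordinates but the first given by `g`. -/
def rowVec (u : Fin n → ℂ) (h : ℂ) (g : Fin n → ℂ) : Fin (n + 1) → ℂ :=
  Fin.cons (h - ∑ j, g j * u j) g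

/-- The density of a row of `G_τ` at `rowVec u h g`. -/
noncomputable def rowWeight (τ : ℝ) (u : Fin n → ℂ) (h : ℂ) (g : Fin n → ℂ) : ℝ :=
  ∏ j, entryDensity τ (rowVec u h g j)

theorem one_le_normSum (u : Fin n → ℂ) : 1 ≤ normSum u := by
  rw [normSum, Fin.sum_univ_succ]
  simp only [affineVec, Fin.cons_zero, norm_one, one_pow, le_add_iff_nonneg_right]
  positivity

theorem norm_squareSum_le (u : Fin n → ℂ) : ‖squareSum u‖ ≤ normSum u := by
  refine (norm_sum_le _ _).trans (le_of_eq (Finset.sum_congr rfl fun i _ => ?_))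
  rw [norm_mul, sq]

variable {τ : ℝ}

theorem mul_norm_squareSum_lt (h0 : 0 ≤ τ) (h1 : τ < 1) (u : Fin n → ℂ) :
    τ * ‖squareSum u‖ < normSum u := by
  have := one_le_normSum u
  have := norm_squareSum_le u
  nlinarith [norm_nonneg (squareSum u)]

theorem disc_pos (h0 : 0 ≤ τ) (h1 : τ < 1) (u : Fin n → ℂ) : 0 < disc τ u := by
  have h := mul_norm_squareSum_lt h0 h1 u
  have : 0 ≤ τ * ‖squareSum u‖ := by positivity
  rw [disc]
  nlinarith

theorem normSum_coe (u : Fin n → ℂ) :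
    (normSum u : ℂ) = ∑ i, affineVec u i * conj (affineVec u i) := by
  rw [normSum, Complex.ofReal_sum]
  exact Finset.sum_congr rfl fun i _ => by rw [Complex.mul_conj']; push_cast; rfl

theorem disc_coe (u : Fin n → ℂ) : (disc τ u : ℂ) =
    (normSum u : ℂ) ^ 2 - (τ : ℂ) ^ 2 * (squareSum u * conj (squareSum u)) := by
  rw [disc, Complex.mul_conj']
  push_cast
  rfl

theorem conj_squareSum (u : Fin n → ℂ) :
    conj (squareSum u) = ∑ i, conj (affineVec u i) * conj (affineVec u i) := by
  simp [squareSum]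

theorem sum_affineVec_mul_rowVec (u : Fin n → ℂ) (h : ℂ) (g : Fin n → ℂ) :
    ∑ j, affineVec u j * rowVec u h g j = h := by
  simp [Fin.sum_univ_succ, affineVec, rowVec, mul_comm]

theorem sum_affineVec_mul_rowMean (h0 : 0 ≤ τ) (h1 : τ < 1) (u : Fin n → ℂ) (h : ℂ) :
    ∑ j, affineVec u j * rowMean τ u h j = h := by
  have hD : (disc τ u : ℂ) ≠ 0 := by exact_mod_cast (disc_pos h0 h1 u).ne'
  have e : ∑ j, affineVec u j * rowMean τ u h j =
      conj (multiplier τ u h) * normSum u + τ * multiplier τ u h * squareSum u := by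
    rw [normSum_coe, squareSum, Finset.mul_sum, Finset.mul_sum, ← Finset.sum_add_distrib]
    exact Finset.sum_congr rfl fun j _ => by rw [rowMean]; ring
  rw [e, multiplier]
  simp only [map_div₀, map_sub, map_mul, Complex.conj_conj, Complex.conj_ofReal]
  field_simp
  rw [disc_coe]
  ring

/-- The conditional mean lies on the hyperplane `ξ ⬝ v = h`, and `rowVec u 0` parametrises the
parallel hyperplane through the origin. Translating `g` by the mean thus reduces every `h` to `0`.
-/
theorem rowVec_add (h0 : 0 ≤ τ) (h1 : τ < 1) (u : Fin n → ℂ) (h : ℂ) (g : Fin n → ℂ) :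
    rowVec u h ((fun j => rowMean τ u h j.succ) + g) = rowMean τ u h + rowVec u 0 g := by
  funext j
  refine Fin.cases ?_ (fun j => ?_) j
  · have := sum_affineVec_mul_rowMean h0 h1 u h
    rw [Fin.sum_univ_succ] at this
    simp only [affineVec, Fin.cons_zero, Fin.cons_succ, one_mul] at this
    simp only [rowVec, Fin.cons_zero, Pi.add_apply, add_mul, Finset.sum_add_distrib]
    nth_rewrite 1 [← this]
    simp only [mul_comm (u _)]
    ring
  · simp [rowVec]

/-- Completing the square. -/
theorem prod_entryDensity_add (h0 : 0 ≤ τ) (h1 : τ < 1) (u : Fin n → ℂ) (h : ℂ)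
    (ξ : Fin (n + 1) → ℂ) (hξ : ∑ j, affineVec u j * ξ j = 0) :
    ∏ j, entryDensity τ (rowMean τ u h j + ξ j) =
      Real.exp (-(multiplier τ u h * h).re) * ∏ j, entryDensity τ (ξ j) := by
  have ha : 1 + τ ≠ 0 := by linarith
  have hb : 1 - τ ≠ 0 := by linarith
  -- With `μ = multiplier * v j`, the mean `conj μ + τ μ` has real part `(1 + τ) Re μ` and imaginary
  -- part `-(1 - τ) Im μ`. This cancels the two denominators and makes the cross term `2 Re (μ ξ
  -- j)`, whose sum over `j` vanishes on the hyperplane.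
  have hQ : ∀ j, (rowMean τ u h j + ξ j).re ^ 2 / (1 + τ) + (rowMean τ u h j + ξ j).im ^ 2 / (1 - τ)
      = (multiplier τ u h * (affineVec u j * rowMean τ u h j)).re +
        2 * (multiplier τ u h * (affineVec u j * ξ j)).re +
        ((ξ j).re ^ 2 / (1 + τ) + (ξ j).im ^ 2 / (1 - τ)) := by
    intro j
    have e1 : (rowMean τ u h j).re = (1 + τ) * (multiplier τ u h * affineVec u j).re := by
      simp [rowMean]; ring
    have e2 : (rowMean τ u h j).im = -(1 - τ) * (multiplier τ u h * affineVec u j).im := by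
      simp [rowMean]; ring
    rw [← mul_assoc, ← mul_assoc]
    generalize multiplier τ u h * affineVec u j = μ at *
    rw [Complex.add_re, Complex.add_im, Complex.mul_re, Complex.mul_re, e1, e2]
    field_simp
    ring
  simp only [entryDensity]
  rw [Finset.prod_mul_distrib, Finset.prod_mul_distrib, ← Real.exp_sum, ← Real.exp_sum,
    mul_left_comm, ← Real.exp_add]
  congr 2
  simp only [hQ, neg_add, Finset.sum_add_distrib, Finset.sum_neg_distrib]
  have s1 : ∑ j, (multiplier τ u h * (affineVec u j * rowMean τ u h j)).re =
      (multiplier τ u h * h).re := by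
    rw [← Complex.re_sum, ← Finset.mul_sum, sum_affineVec_mul_rowMean h0 h1]
  have s2 : ∑ j, 2 * (multiplier τ u h * (affineVec u j * ξ j)).re = 0 := by
    rw [← Finset.mul_sum, ← Complex.re_sum, ← Finset.mul_sum, hξ]
    simp
  rw [s1, s2]
  ring

theorem rowWeight_add (h0 : 0 ≤ τ) (h1 : τ < 1) (u : Fin n → ℂ) (h : ℂ) (g : Fin n → ℂ) :
    rowWeight τ u h ((fun j => rowMean τ u h j.succ) + g) =
      Real.exp (-(multiplier τ u h * h).re) * rowWeight τ u 0 g := by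
  rw [rowWeight, rowVec_add h0 h1]
  exact prod_entryDensity_add h0 h1 u h _ (sum_affineVec_mul_rowVec u 0 g)

/-- Integrals of functions of a row conditioned on `ξ ⬝ v = h`, reduced to `h = 0`. -/
theorem integral_rowWeight_mul (h0 : 0 ≤ τ) (h1 : τ < 1) (u : Fin n → ℂ) (h : ℂ)
    (F : (Fin (n + 1) → ℂ) → ℂ) :
    ∫ g, (rowWeight τ u h g : ℂ) * F (rowVec u h g) =
      Real.exp (-(multiplier τ u h * h).re) *
        ∫ g, (rowWeight τ u 0 g : ℂ) * F (rowMean τ u h + rowVec u 0 g) := by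
  rw [← integral_add_left_eq_self (fun g => (rowWeight τ u h g : ℂ) * F (rowVec u h g))
    (fun j => rowMean τ u h j.succ), ← integral_const_mul]
  refine integral_congr_ae (Filter.Eventually.of_forall fun g => ?_)
  simp only [rowVec_add h0 h1, rowWeight_add h0 h1]
  push_cast
  ring

theorem entryDensity_le (h0 : 0 ≤ τ) (h1 : τ < 1) (g : ℂ) :
    entryDensity τ g ≤ 1 / (Real.pi * Real.sqrt (1 - τ ^ 2)) := by
  have ha : 0 < 1 + τ := by linarith
  have hb : 0 < 1 - τ := by linarith
  refine mul_le_of_le_one_right (by positivity) (Real.exp_le_one_iff.2 ?_)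
  have : 0 ≤ g.re ^ 2 / (1 + τ) + g.im ^ 2 / (1 - τ) := by positivity
  linarith

theorem rowWeight_eq (u : Fin n → ℂ) (h : ℂ) (g : Fin n → ℂ) :
    rowWeight τ u h g =
      entryDensity τ (h - ∑ j, g j * u j) * ∏ j, entryDensity τ (g j) := by
  rw [rowWeight, Fin.prod_univ_succ]
  rfl

/-- The density of the dependent first entry is bounded, so the weight is dominated by a multiple of
the density of the `n` free entries. -/
theorem integrable_rowWeight_mul (h0 : 0 ≤ τ) (h1 : τ < 1) (u : Fin n → ℂ) (h : ℂ)
    {F : (Fin n → ℂ) → ℂ} (hF : Integrable F (Measure.pi fun _ => entryLaw τ)) :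
    Integrable fun g => (rowWeight τ u h g : ℂ) * F g := by
  have hc : Continuous fun g : Fin n → ℂ => ((entryDensity τ (h - ∑ j, g j * u j) : ℝ) : ℂ) := by
    have := continuous_entryDensity τ
    fun_prop
  have h2 := ((integrable_pi_entryLaw_iff F).1 hF).bdd_mul hc.aestronglyMeasurable
    (c := 1 / (Real.pi * Real.sqrt (1 - τ ^ 2))) (Filter.Eventually.of_forall fun g => by
      rw [Complex.norm_real, Real.norm_of_nonneg (entryDensity_nonneg _ _)]
      exact entryDensity_le h0 h1 _)
  refine h2.congr (Filter.Eventually.of_forall fun g => ?_)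
  simp only [rowWeight_eq]
  push_cast
  ring

theorem measurePreserving_rowShear (u : Fin n → ℂ) :
    MeasurePreserving (fun p : ℂ × (Fin n → ℂ) => (p.1 - ∑ j, p.2 j * u j, p.2))
      (volume.prod volume) (volume.prod volume) := by
  have h := (MeasurePreserving.id (volume : Measure (Fin n → ℂ))).skew_product
    (μc := (volume : Measure ℂ)) (μd := (volume : Measure ℂ))
    (g := fun (g : Fin n → ℂ) (h : ℂ) => h - ∑ j, g j * u j)
    (by unfold Function.uncurry; fun_prop)
    (Filter.Eventually.of_forall fun g => (measurePreserving_sub_right volume _).map_eq)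
  exact (Measure.measurePreserving_swap.comp h).comp Measure.measurePreserving_swap

/-- Integrating over the value `h` of `ξ ⬝ v` recovers the law of a row `ξ`. -/
theorem integral_integral_rowWeight (u : Fin n → ℂ) {F : (Fin (n + 1) → ℂ) → ℂ}
    (hF : Integrable F (Measure.pi fun _ => entryLaw τ)) :
    Integrable (fun h => ∫ g, (rowWeight τ u h g : ℂ) * F (rowVec u h g)) ∧
    ∫ h, ∫ g, (rowWeight τ u h g : ℂ) * F (rowVec u h g) =
      ∫ ξ, F ξ ∂(Measure.pi fun _ => entryLaw τ) := by
  have hG := (integrable_pi_entryLaw_iff F).1 hF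
  set G : (Fin (n + 1) → ℂ) → ℂ := fun ξ => ((∏ j, entryDensity τ (ξ j) : ℝ) : ℂ) * F ξ with hGdef
  have hmp := (volume_preserving_piFinSuccAbove (fun _ : Fin (n + 1) => ℂ) 0).symm
  have hmp' := hmp.comp (measurePreserving_rowShear u)
  have hval : ∀ p : ℂ × (Fin n → ℂ), (MeasurableEquiv.piFinSuccAbove
      (fun _ : Fin (n + 1) => ℂ) 0).symm (p.1 - ∑ j, p.2 j * u j, p.2) = rowVec u p.1 p.2 := by
    intro p
    simp [MeasurableEquiv.piFinSuccAbove, Fin.insertNthEquiv, rowVec]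
  have hint : Integrable (fun p : ℂ × (Fin n → ℂ) => G (rowVec u p.1 p.2))
      (volume.prod volume) := by
    refine (hmp'.integrable_comp_of_integrable hG).congr (Filter.Eventually.of_forall fun p => ?_)
    simp only [Function.comp_apply, hval]
  refine ⟨hint.integral_prod_left, ?_⟩
  have h3 := integral_prod _ hint
  refine h3.symm.trans ?_
  rw [integral_pi_entryLaw]
  change _ = ∫ ξ, G ξ
  rw [← hmp'.map_eq, integral_map hmp'.measurable.aemeasurable
    (by rw [hmp'.map_eq]; exact hG.aestronglyMeasurable)]
  simp only [Function.comp_apply, hval]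

/-- In real coordinates the exponent is `-x² / (a + b) - y² / (a - b)`, and the integral is a
product of two Gaussian ones. -/
theorem integral_exp_quadratic {a b : ℝ} (hb : 0 ≤ b) (hab : b < a) :
    ∫ h : ℂ, Real.exp (-((a * ‖h‖ ^ 2 - b * (h * h).re) / (a ^ 2 - b ^ 2))) =
      Real.pi * Real.sqrt (a ^ 2 - b ^ 2) := by
  have h1 : 0 < a + b := by linarith
  have h2 : 0 < a - b := by linarith
  rw [← (Complex.volume_preserving_equiv_real_prod.symm _).integral_comp
    (MeasurableEquiv.measurableEmbedding _)]
  have h3 : ∀ p : ℝ × ℝ, Real.exp (-((a * ‖Complex.measurableEquivRealProd.symm p‖ ^ 2 -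
      b * (Complex.measurableEquivRealProd.symm p * Complex.measurableEquivRealProd.symm p).re) /
        (a ^ 2 - b ^ 2))) = Real.exp (-(1 / (a + b)) * p.1 ^ 2) *
          Real.exp (-(1 / (a - b)) * p.2 ^ 2) := by
    intro p
    rw [← Real.exp_add, Complex.measurableEquivRealProd_symm_apply, ← Complex.normSq_eq_norm_sq,
      Complex.normSq_apply, Complex.mul_re]
    congr 1
    have : a ^ 2 - b ^ 2 = (a + b) * (a - b) := by ring
    rw [this]
    field_simp
    ring
  simp_rw [h3]
  rw [Measure.volume_eq_prod, integral_prod_mul (fun x => Real.exp (-(1 / (a + b)) * x ^ 2))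
    (fun x => Real.exp (-(1 / (a - b)) * x ^ 2)), integral_gaussian, integral_gaussian,
    ← Real.sqrt_mul (by positivity)]
  have : Real.pi / (1 / (a + b)) * (Real.pi / (1 / (a - b))) = Real.pi ^ 2 * (a ^ 2 - b ^ 2) := by
    field_simp
    ring
  rw [this, Real.sqrt_mul (sq_nonneg _), Real.sqrt_sq Real.pi_pos.le]

theorem re_multiplier_mul (u : Fin n → ℂ) (h : ℂ) :
    (multiplier τ u h * h).re =
      (normSum u * ‖h‖ ^ 2 - τ * (conj (squareSum u) * (h * h)).re) / disc τ u := by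
  have : multiplier τ u h * h = ((normSum u * ‖h‖ ^ 2 : ℝ) - τ * (conj (squareSum u) * (h * h))) /
      (disc τ u : ℂ) := by
    rw [multiplier]
    push_cast
    rw [← Complex.mul_conj']
    ring
  rw [this, Complex.div_ofReal_re, Complex.sub_re, Complex.ofReal_re, Complex.re_ofReal_mul]

theorem integral_exp_multiplier (h0 : 0 ≤ τ) (h1 : τ < 1) (u : Fin n → ℂ) :
    ∫ h : ℂ, Real.exp (-(multiplier τ u h * h).re) = Real.pi * Real.sqrt (disc τ u) := by
  -- Rotating `h` by half the argument of `v ⬝ v` makes the coefficient of `h * h` real and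
  -- nonnegative.
  obtain ⟨c, hc⟩ : ∃ c : Circle, conj (squareSum u) * ((c : ℂ) * c) = ‖squareSum u‖ := by
    refine ⟨Circle.exp ((squareSum u).arg / 2), ?_⟩
    have h2 := Complex.norm_mul_exp_arg_mul_I (squareSum u)
    rw [Circle.coe_exp, ← Complex.exp_add]
    nth_rewrite 1 [← h2]
    rw [map_mul, Complex.conj_ofReal, ← Complex.exp_conj, mul_assoc, ← Complex.exp_add]
    simp only [map_mul, Complex.conj_ofReal, Complex.conj_I]
    push_cast
    ring_nf
    simp
  rw [← (rotation c).measurePreserving.integral_comp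
    (rotation c).toHomeomorph.measurableEmbedding]
  have h2 : ∀ h : ℂ, (multiplier τ u (rotation c h) * rotation c h).re =
      (normSum u * ‖h‖ ^ 2 - (τ * ‖squareSum u‖) * (h * h).re) /
        (normSum u ^ 2 - (τ * ‖squareSum u‖) ^ 2) := by
    intro h
    rw [re_multiplier_mul, LinearIsometryEquiv.norm_map, rotation_apply,
      show conj (squareSum u) * (c * h * (c * h)) =
        conj (squareSum u) * ((c : ℂ) * c) * (h * h) by ring, hc, Complex.re_ofReal_mul, disc]
    ring
  simp_rw [h2]
  rw [integral_exp_quadratic (by positivity) (mul_norm_squareSum_lt h0 h1 u), disc, mul_pow]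

end Rows

/-! ### Conditional mean and covariance of a row. -/

section RowMoments

local notation "conj" => starRingEnd ℂ

variable {n : ℕ} {τ : ℝ}

theorem memLp_rowVec (h0 : 0 ≤ τ) (h1 : τ < 1) (u : Fin n → ℂ) (h : ℂ) (j : Fin (n + 1)) :
    MemLp (fun g => rowVec u h g j) 2 (Measure.pi fun _ => entryLaw τ) := by
  have := isProbabilityMeasure_entryLaw τ h0 h1
  refine Fin.cases ?_ (fun j => ?_) j
  · exact (memLp_const h).sub (memLp_finsetSum _ fun j _ => (memLp_pi_entryLaw h0 h1 j).mul_const _)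
  · exact memLp_pi_entryLaw h0 h1 j

theorem MeasureTheory.MemLp.integrable_mul_conj {α : Type*} [MeasurableSpace α] {μ : Measure α}
    {f g : α → ℂ} (hf : MemLp f 2 μ) (hg : MemLp g 2 μ) :
    Integrable (fun x => f x * conj (g x)) μ :=
  hf.integrable_mul hg.star

theorem integrable_rowWeight_mul_conj (h0 : 0 ≤ τ) (h1 : τ < 1) (u : Fin n → ℂ) (h a b : ℂ)
    (j k : Fin (n + 1)) :
    Integrable fun g => (rowWeight τ u h g : ℂ) *
      ((a - rowVec u h g j) * conj (b - rowVec u h g k)) := by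
  have := isProbabilityMeasure_entryLaw τ h0 h1
  exact integrable_rowWeight_mul h0 h1 u h
    (((memLp_const a).sub (memLp_rowVec h0 h1 u h j)).integrable_mul_conj
      ((memLp_const b).sub (memLp_rowVec h0 h1 u h k)))

theorem rowVec_neg (u : Fin n → ℂ) (g : Fin n → ℂ) : rowVec u 0 (-g) = -rowVec u 0 g := by
  funext j
  refine Fin.cases ?_ (fun j => ?_) j <;> simp [rowVec]

theorem rowWeight_neg (u : Fin n → ℂ) (g : Fin n → ℂ) :
    rowWeight τ u 0 (-g) = rowWeight τ u 0 g := by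
  simp [rowWeight, rowVec_neg, entryDensity]

/-- The weight at `h = 0` is even in `g`, while the integrand's other factor is odd. -/
theorem integral_rowWeight_mul_rowVec (u : Fin n → ℂ) (j : Fin (n + 1)) :
    ∫ g, (rowWeight τ u 0 g : ℂ) * rowVec u 0 g j = 0 := by
  have h := integral_neg_eq_self (fun g => (rowWeight τ u 0 g : ℂ) * rowVec u 0 g j) volume
  simp only [rowVec_neg, rowWeight_neg, Pi.neg_apply, mul_neg, integral_neg] at h
  exact self_eq_neg.1 h.symm

theorem integrable_and_integral_add_add {α : Type*} [MeasurableSpace α] {μ : Measure α}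
    {f₁ f₂ f₃ : α → ℂ} (h₁ : Integrable f₁ μ) (h₂ : Integrable f₂ μ) (h₃ : Integrable f₃ μ)
    (a b c : ℂ) :
    Integrable (fun x => a * f₁ x + (b * f₂ x + c * f₃ x)) μ ∧
    ∫ x, (a * f₁ x + (b * f₂ x + c * f₃ x)) ∂μ =
      a * (∫ x, f₁ x ∂μ) + (b * (∫ x, f₂ x ∂μ) + c * ∫ x, f₃ x ∂μ) := by
  have i : Integrable (fun x => b * f₂ x + c * f₃ x) μ := (h₂.const_mul b).add (h₃.const_mul c)
  refine ⟨(h₁.const_mul a).add i, ?_⟩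
  rw [integral_add (h₁.const_mul a) i, integral_add (h₂.const_mul b) (h₃.const_mul c),
    integral_const_mul, integral_const_mul, integral_const_mul]

theorem integral_rowWeight_zero_mul_conj (h0 : 0 ≤ τ) (h1 : τ < 1) (u : Fin n → ℂ) (a b : ℂ)
    (j k : Fin (n + 1)) :
    ∫ g, (rowWeight τ u 0 g : ℂ) * ((a + rowVec u 0 g j) * conj (b + rowVec u 0 g k)) =
      a * conj b * (∫ g, (rowWeight τ u 0 g : ℂ)) +
        ∫ g, (rowWeight τ u 0 g : ℂ) * (rowVec u 0 g j * conj (rowVec u 0 g k)) := by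
  have := isProbabilityMeasure_entryLaw τ h0 h1
  have i0 : Integrable fun g => (rowWeight τ u 0 g : ℂ) := by
    simpa using integrable_rowWeight_mul h0 h1 u 0 (integrable_const (1 : ℂ))
  have i1 : ∀ j, Integrable fun g => (rowWeight τ u 0 g : ℂ) * rowVec u 0 g j := fun j =>
    integrable_rowWeight_mul h0 h1 u 0 ((memLp_rowVec h0 h1 u 0 j).integrable one_le_two)
  have i1' : Integrable fun g => (rowWeight τ u 0 g : ℂ) * conj (rowVec u 0 g k) :=
    integrable_rowWeight_mul h0 h1 u 0 ((memLp_rowVec h0 h1 u 0 k).star.integrable one_le_two)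
  have i2 : Integrable fun g => (rowWeight τ u 0 g : ℂ) *
      (rowVec u 0 g j * conj (rowVec u 0 g k)) := integrable_rowWeight_mul h0 h1 u 0
    ((memLp_rowVec h0 h1 u 0 j).integrable_mul_conj (memLp_rowVec h0 h1 u 0 k))
  have z1 : ∫ g, (rowWeight τ u 0 g : ℂ) * conj (rowVec u 0 g k) = 0 := by
    have := congrArg conj (integral_rowWeight_mul_rowVec (τ := τ) u k)
    rw [← integral_conj] at this
    simpa using this
  have e : ∀ g, (rowWeight τ u 0 g : ℂ) * ((a + rowVec u 0 g j) * conj (b + rowVec u 0 g k)) =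
      a * conj b * (rowWeight τ u 0 g : ℂ) + (a * ((rowWeight τ u 0 g : ℂ) * conj (rowVec u 0 g k))
        + (conj b * ((rowWeight τ u 0 g : ℂ) * rowVec u 0 g j) +
          (rowWeight τ u 0 g : ℂ) * (rowVec u 0 g j * conj (rowVec u 0 g k)))) := by
    intro g
    rw [map_add]
    ring
  simp_rw [e]
  have h3 := integrable_and_integral_add_add i1' (i1 j) i2 a (conj b) 1
  simp only [one_mul] at h3
  rw [integral_add (i0.const_mul _) h3.1, h3.2, integral_const_mul, z1,
    integral_rowWeight_mul_rowVec]
  ring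

/-- The density of `ξ ⬝ v`, for a row `ξ` of `G_τ`, at `h`. -/
noncomputable def rowDensity (τ : ℝ) (u : Fin n → ℂ) (h : ℂ) : ℝ :=
  Real.exp (-(multiplier τ u h * h).re) / (Real.pi * Real.sqrt (disc τ u))

/-- The mass at `h` is the mass at `0` times `exp (-(multiplier * h).re)`. Integrating over `h`
gives total mass one, which fixes the mass at `0`. -/
theorem integral_rowWeight_zero (h0 : 0 ≤ τ) (h1 : τ < 1) (u : Fin n → ℂ) :
    ∫ g, (rowWeight τ u 0 g : ℂ) = (1 / (Real.pi * Real.sqrt (disc τ u)) : ℝ) := by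
  have := isProbabilityMeasure_entryLaw τ h0 h1
  have h := (integral_integral_rowWeight (τ := τ) u (F := fun _ => 1) (integrable_const 1)).2
  rw [integral_congr_ae (Filter.Eventually.of_forall fun h =>
    integral_rowWeight_mul h0 h1 u h (fun _ => 1))] at h
  rw [integral_mul_const, integral_complex_ofReal, integral_exp_multiplier h0 h1] at h
  simp only [mul_one, integral_const, probReal_univ, one_smul] at h
  rw [Complex.ofReal_div, Complex.ofReal_one]
  exact eq_one_div_of_mul_eq_one_right h

/-- On the slice belonging to `h` the function is constant, so only the mass of the slice enters.
This supplies the moments of `ξ ⬝ v` from those of independent entries. -/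
theorem integral_rowWeight_mul_comp (h0 : 0 ≤ τ) (h1 : τ < 1) (u : Fin n → ℂ) (φ : ℂ → ℂ)
    (hF : Integrable (fun ξ : Fin (n + 1) → ℂ => φ (∑ j, affineVec u j * ξ j))
      (Measure.pi fun _ => entryLaw τ)) :
    Integrable (fun h => (rowDensity τ u h : ℂ) * φ h) ∧
    ∫ h, (rowDensity τ u h : ℂ) * φ h =
      ∫ ξ : Fin (n + 1) → ℂ, φ (∑ j, affineVec u j * ξ j) ∂(Measure.pi fun _ => entryLaw τ) := by
  have h := integral_integral_rowWeight (τ := τ) u hF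
  have e : ∀ h, ∫ g, (rowWeight τ u h g : ℂ) * φ (∑ j, affineVec u j * rowVec u h g j) =
      (rowDensity τ u h : ℂ) * φ h := by
    intro h
    have h2 := integral_rowWeight_mul h0 h1 u h (fun _ => 1)
    simp only [mul_one, integral_rowWeight_zero h0 h1] at h2
    simp_rw [sum_affineVec_mul_rowVec]
    rw [integral_mul_const, h2, ← Complex.ofReal_mul, rowDensity]
    congr 2
    ring
  simp_rw [e] at h
  exact h

theorem memLp_sum_affineVec (h0 : 0 ≤ τ) (h1 : τ < 1) (u : Fin n → ℂ) :
    MemLp (fun ξ : Fin (n + 1) → ℂ => ∑ j, affineVec u j * ξ j) 2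
      (Measure.pi fun _ => entryLaw τ) :=
  memLp_finsetSum _ fun j _ => (memLp_pi_entryLaw h0 h1 j).const_mul _

theorem integral_rowDensity (h0 : 0 ≤ τ) (h1 : τ < 1) (u : Fin n → ℂ) :
    Integrable (fun h => (rowDensity τ u h : ℂ)) ∧ ∫ h, (rowDensity τ u h : ℂ) = 1 := by
  have := isProbabilityMeasure_entryLaw τ h0 h1
  have h := integral_rowWeight_mul_comp h0 h1 u (fun _ => 1) (integrable_const 1)
  simpa using h

theorem integral_rowDensity_mul_conj (h0 : 0 ≤ τ) (h1 : τ < 1) (u : Fin n → ℂ) :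
    Integrable (fun h => (rowDensity τ u h : ℂ) * (h * conj h)) ∧
    ∫ h, (rowDensity τ u h : ℂ) * (h * conj h) = normSum u := by
  have h := integral_rowWeight_mul_comp h0 h1 u (fun h => h * conj h)
    ((memLp_sum_affineVec h0 h1 u).integrable_mul_conj (memLp_sum_affineVec h0 h1 u))
  refine ⟨h.1, h.2.trans ?_⟩
  have e : ∀ ξ : Fin (n + 1) → ℂ, (∑ j, affineVec u j * ξ j) * conj (∑ j, affineVec u j * ξ j) =
      ∑ j, ∑ k, affineVec u j * conj (affineVec u k) * (ξ j * conj (ξ k)) := by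
    intro ξ
    rw [map_sum, Finset.sum_mul_sum]
    refine Finset.sum_congr rfl fun j _ => Finset.sum_congr rfl fun k _ => ?_
    rw [map_mul]
    ring
  have i : ∀ j k : Fin (n + 1), Integrable (fun ξ : Fin (n + 1) → ℂ =>
      affineVec u j * conj (affineVec u k) * (ξ j * conj (ξ k)))
      (Measure.pi fun _ => entryLaw τ) := fun j k =>
    ((memLp_pi_entryLaw h0 h1 j).integrable_mul_conj (memLp_pi_entryLaw h0 h1 k)).const_mul _
  simp_rw [e]
  rw [integral_finsetSum _ fun j _ => integrable_finsetSum _ fun k _ => i j k, normSum_coe]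
  refine Finset.sum_congr rfl fun j _ => ?_
  rw [integral_finsetSum _ fun k _ => i j k]
  simp_rw [integral_const_mul, integral_pi_entryLaw_mul_conj h0 h1]
  simp

theorem integral_rowDensity_mul_self (h0 : 0 ≤ τ) (h1 : τ < 1) (u : Fin n → ℂ) :
    Integrable (fun h => (rowDensity τ u h : ℂ) * (h * h)) ∧
    ∫ h, (rowDensity τ u h : ℂ) * (h * h) = τ * squareSum u := by
  have h := integral_rowWeight_mul_comp h0 h1 u (fun h => h * h)
    ((memLp_sum_affineVec h0 h1 u).integrable_mul (memLp_sum_affineVec h0 h1 u))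
  refine ⟨h.1, h.2.trans ?_⟩
  have e : ∀ ξ : Fin (n + 1) → ℂ, (∑ j, affineVec u j * ξ j) * (∑ j, affineVec u j * ξ j) =
      ∑ j, ∑ k, affineVec u j * affineVec u k * (ξ j * ξ k) := by
    intro ξ
    rw [Finset.sum_mul_sum]
    refine Finset.sum_congr rfl fun j _ => Finset.sum_congr rfl fun k _ => ?_
    ring
  have i : ∀ j k : Fin (n + 1), Integrable (fun ξ : Fin (n + 1) → ℂ =>
      affineVec u j * affineVec u k * (ξ j * ξ k))
      (Measure.pi fun _ => entryLaw τ) := fun j k =>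
    ((memLp_pi_entryLaw h0 h1 j).integrable_mul (memLp_pi_entryLaw h0 h1 k)).const_mul _
  simp_rw [e]
  rw [integral_finsetSum _ fun j _ => integrable_finsetSum _ fun k _ => i j k, squareSum,
    Finset.mul_sum]
  refine Finset.sum_congr rfl fun j _ => ?_
  rw [integral_finsetSum _ fun k _ => i j k]
  simp_rw [integral_const_mul, integral_pi_entryLaw_mul_self h0 h1]
  simp [mul_comm]

theorem integral_rowDensity_mul_conj_conj (h0 : 0 ≤ τ) (h1 : τ < 1) (u : Fin n → ℂ) :
    Integrable (fun h => (rowDensity τ u h : ℂ) * (conj h * conj h)) ∧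
    ∫ h, (rowDensity τ u h : ℂ) * (conj h * conj h) = τ * conj (squareSum u) := by
  obtain ⟨h2, h3⟩ := integral_rowDensity_mul_self h0 h1 u
  have e : ∀ h, conj ((rowDensity τ u h : ℂ) * (h * h)) =
      (rowDensity τ u h : ℂ) * (conj h * conj h) := fun h => by simp
  constructor
  · have h4 := (LinearIsometryEquiv.integrable_comp_iff Complex.conjLIE).2 h2
    exact h4.congr (Filter.Eventually.of_forall e)
  · have := congrArg conj h3
    rw [← integral_conj] at this
    simp_rw [e] at this
    simpa using this

/-- The covariances of the conditional means of the entries of a row. -/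
theorem integral_rowDensity_mul_rowMean (h0 : 0 ≤ τ) (h1 : τ < 1) (u : Fin n → ℂ)
    (j k : Fin (n + 1)) :
    Integrable (fun h => (rowDensity τ u h : ℂ) * (rowMean τ u h j * conj (rowMean τ u h k))) ∧
    ∫ h, (rowDensity τ u h : ℂ) * (rowMean τ u h j * conj (rowMean τ u h k)) =
      (if j = k then 1 else 0) - conditionalCov τ (normSum u) (squareSum u) (conj (squareSum u))
        (affineVec u) (fun i => conj (affineVec u i)) j k := by
  have hD : (disc τ u : ℂ) ≠ 0 := by exact_mod_cast (disc_pos h0 h1 u).ne'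
  obtain ⟨i1, m1⟩ := integral_rowDensity_mul_conj h0 h1 u
  obtain ⟨i2, m2⟩ := integral_rowDensity_mul_self h0 h1 u
  obtain ⟨i3, m3⟩ := integral_rowDensity_mul_conj_conj h0 h1 u
  set s : ℂ := (normSum u : ℂ) with hs
  set q := squareSum u with hq
  set D : ℂ := (disc τ u : ℂ) with hDdef
  set v := affineVec u
  -- The conditional mean is real linear in `h`; `p` and `r` are its coefficients on `h` and `conj
  -- h`.
  let p : Fin (n + 1) → ℂ := fun j => (s * conj (v j) - τ ^ 2 * conj q * v j) / D
  let r : Fin (n + 1) → ℂ := fun j => (τ * s * v j - τ * q * conj (v j)) / D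
  have hm : ∀ h j, rowMean τ u h j = p j * h + r j * conj h := by
    intro h j
    simp only [rowMean, multiplier, p, r, map_div₀, map_sub, map_mul, Complex.conj_conj,
      Complex.conj_ofReal]
    ring
  have e : ∀ h, (rowDensity τ u h : ℂ) * (rowMean τ u h j * conj (rowMean τ u h k)) =
      (p j * conj (p k) + r j * conj (r k)) * ((rowDensity τ u h : ℂ) * (h * conj h)) +
      (p j * conj (r k) * ((rowDensity τ u h : ℂ) * (h * h)) +
        r j * conj (p k) * ((rowDensity τ u h : ℂ) * (conj h * conj h))) := by
    intro h
    rw [hm, hm, map_add, map_mul, map_mul, Complex.conj_conj]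
    ring
  simp_rw [e]
  have h4 := integrable_and_integral_add_add i1 i2 i3 (p j * conj (p k) + r j * conj (r k))
    (p j * conj (r k)) (r j * conj (p k))
  refine ⟨h4.1, ?_⟩
  rw [h4.2, m1, m2, m3]
  have hDs : s ^ 2 - τ ^ 2 * (q * conj q) = D := (disc_coe u).symm
  simp only [conditionalCov, Matrix.of_apply, sub_sub_cancel, hDs, p, r, map_div₀, map_sub, map_mul,
    map_pow, Complex.conj_conj, Complex.conj_ofReal]
  have hDc : conj D = D := Complex.conj_ofReal _
  have hsc : conj s = s := Complex.conj_ofReal _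
  rw [hDc, hsc]
  field_simp
  rw [← hDs]
  ring

/-- The law of total covariance: the identity covariance of the row is the conditional covariance,
which does not depend on `h`, plus the covariance of the conditional means. The latter is already
known, so the former is obtained without inverting a quadratic form. -/
theorem integral_rowWeight_zero_mul_rowVec_mul_conj (h0 : 0 ≤ τ) (h1 : τ < 1) (u : Fin n → ℂ)
    (j k : Fin (n + 1)) :
    ∫ g, (rowWeight τ u 0 g : ℂ) * (rowVec u 0 g j * conj (rowVec u 0 g k)) =
      (1 / (Real.pi * Real.sqrt (disc τ u)) : ℝ) *
        conditionalCov τ (normSum u) (squareSum u) (conj (squareSum u))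
          (affineVec u) (fun i => conj (affineVec u i)) j k := by
  have hN : (Real.pi * Real.sqrt (disc τ u) : ℝ) ≠ 0 :=
    (mul_pos Real.pi_pos (Real.sqrt_pos.2 (disc_pos h0 h1 u))).ne'
  have h := (integral_integral_rowWeight (τ := τ) u (F := fun ξ => ξ j * conj (ξ k))
    ((memLp_pi_entryLaw h0 h1 j).integrable_mul_conj (memLp_pi_entryLaw h0 h1 k))).2
  rw [integral_pi_entryLaw_mul_conj h0 h1] at h
  simp_rw [integral_rowWeight_mul h0 h1 u _ (fun ξ => ξ j * conj (ξ k)), Pi.add_apply,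
    integral_rowWeight_zero_mul_conj h0 h1, integral_rowWeight_zero h0 h1] at h
  set Q := ∫ g, (rowWeight τ u 0 g : ℂ) * (rowVec u 0 g j * conj (rowVec u 0 g k)) with hQ
  obtain ⟨i1, m1⟩ := integral_rowDensity_mul_rowMean h0 h1 u j k
  obtain ⟨i2, m2⟩ := integral_rowDensity h0 h1 u
  have e : ∀ h, ((Real.exp (-(multiplier τ u h * h).re) : ℝ) : ℂ) *
      (rowMean τ u h j * conj (rowMean τ u h k) * ((1 / (Real.pi * Real.sqrt (disc τ u)) : ℝ) : ℂ)
        + Q) = (rowDensity τ u h : ℂ) * (rowMean τ u h j * conj (rowMean τ u h k)) +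
      (rowDensity τ u h : ℂ) * (((Real.pi * Real.sqrt (disc τ u) : ℝ) : ℂ) * Q) := by
    intro h
    have : ((Real.pi * Real.sqrt (disc τ u) : ℝ) : ℂ) ≠ 0 := by exact_mod_cast hN
    rw [rowDensity, Complex.ofReal_div, Complex.ofReal_div, Complex.ofReal_one]
    field_simp
  simp_rw [e] at h
  rw [integral_add i1 (i2.mul_const _), integral_mul_const, m1, m2] at h
  have h3 : ((Real.pi * Real.sqrt (disc τ u) : ℝ) : ℂ) * Q =
      conditionalCov τ (normSum u) (squareSum u) (conj (squareSum u))
          (affineVec u) (fun i => conj (affineVec u i)) j k := by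
    linear_combination h
  rw [← h3, ← mul_assoc, ← Complex.ofReal_mul, one_div_mul_cancel hN, Complex.ofReal_one, one_mul]

/-- Second moments of a row of `G_τ` conditioned on `ξ ⬝ v = h`. -/
theorem integral_rowWeight_mul_conj (h0 : 0 ≤ τ) (h1 : τ < 1) (u : Fin n → ℂ) (h a b : ℂ)
    (j k : Fin (n + 1)) :
    ∫ g, (rowWeight τ u h g : ℂ) * ((a - rowVec u h g j) * conj (b - rowVec u h g k)) =
      rowDensity τ u h * (conditionalCov τ (normSum u) (squareSum u) (conj (squareSum u))
        (affineVec u) (fun i => conj (affineVec u i)) j k +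
          (a - rowMean τ u h j) * conj (b - rowMean τ u h k)) := by
  rw [integral_rowWeight_mul h0 h1 u h (fun ξ => (a - ξ j) * conj (b - ξ k))]
  have e : ∀ g, (rowWeight τ u 0 g : ℂ) * ((a - (rowMean τ u h + rowVec u 0 g) j) *
      conj (b - (rowMean τ u h + rowVec u 0 g) k)) = (rowWeight τ u 0 g : ℂ) *
        (((rowMean τ u h j - a) + rowVec u 0 g j) * conj ((rowMean τ u h k - b) + rowVec u 0 g k)) := by
    intro g
    simp only [Pi.add_apply, map_sub, map_add]
    ring
  simp_rw [e]
  rw [integral_rowWeight_zero_mul_conj h0 h1, integral_rowWeight_zero h0 h1,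
    integral_rowWeight_zero_mul_rowVec_mul_conj h0 h1, rowDensity,
    div_eq_mul_one_div (Real.exp _), Complex.ofReal_mul]
  simp only [map_sub]
  ring

end RowMoments

/-! ### The conditional second moment of the Jacobian determinant. -/

section Determinant

local notation "conj" => starRingEnd ℂ

/-- If `H v = 0` and `v 0 = 1`, then `det (H + v wᵀ)` is the same for all `w` with `w ⬝ v = 1`. -/
theorem det_add_vecMulVec {n : ℕ} (H : Matrix (Fin (n + 1)) (Fin (n + 1)) ℂ)
    (v w : Fin (n + 1) → ℂ) (hv : v 0 = 1) (hH : H.mulVec v = 0) (hw : w ⬝ᵥ v = 1) :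
    (H + Matrix.vecMulVec v w).det = (H.updateCol 0 v).det := by
  set e : Fin (n + 1) → ℂ := Pi.single 0 1 with he
  have hev : e ⬝ᵥ v = 1 := by simp [he, hv]
  -- As `H v = 0`, right multiplication by `1 + v (w - e)ᵀ` changes `e` into `w`; it has determinant
  -- one because `(w - e) ⬝ v = 0`. For `w = e` the perturbation adds `v` to the first column, and
  -- `H` itself is singular.
  have h1 : (H + Matrix.vecMulVec v e) * (1 + Matrix.vecMulVec v (w - e)) =
      H + Matrix.vecMulVec v w := by
    rw [Matrix.add_mul, Matrix.mul_add, Matrix.mul_add, Matrix.mul_one, Matrix.mul_one,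
      Matrix.mul_vecMulVec, hH, Matrix.vecMulVec_mul_vecMulVec, hev, one_smul,
      Matrix.zero_vecMulVec, add_zero, ← Matrix.vecMulVec_add, add_sub_cancel]
  have h2 : (1 + Matrix.vecMulVec v (w - e)).det = 1 := by
    rw [Matrix.vecMulVec_eq Unit, Matrix.det_one_add_replicateCol_mul_replicateRow, sub_dotProduct,
      hw, hev, sub_self, add_zero]
  have h3 : H.det = 0 := by
    rw [← Matrix.exists_mulVec_eq_zero_iff]
    exact ⟨v, fun h => by simpa [hv] using congrFun h 0, hH⟩
  have h4 : H + Matrix.vecMulVec v e = H.updateCol 0 ((fun i => H i 0) + v) := by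
    ext i j
    by_cases hj : j = 0
    · subst hj
      simp [he, Matrix.vecMulVec_apply]
    · simp [he, Matrix.vecMulVec_apply, hj]
  rw [← h1, Matrix.det_mul, h2, mul_one, h4, Matrix.det_updateCol_add]
  have h5 : H.updateCol 0 (fun i => H i 0) = H := Matrix.updateCol_eq_self H 0
  rw [h5, h3, zero_add]

variable {n : ℕ} {τ : ℝ}

theorem columnDensity_eigenChart (z : ℂ) (u : Fin n → ℂ) (g : Fin (n + 1) → Fin n → ℂ) :
    columnDensity τ (eigenChart (Fin.cons z u, g)) =
      ∏ i, rowWeight τ u (z * affineVec u i) (g i) := by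
  rw [columnDensity]
  refine Finset.prod_congr rfl fun i _ => ?_
  rw [rowWeight_eq]
  have : Function.update (Fin.cons z u : Fin (n + 1) → ℂ) 0 1 = affineVec u := by
    rw [Fin.update_cons_zero]
    rfl
  simp [eigenChart, this]

/-- Take `H = z - G`, which kills `v`; the chart's Jacobian matrix is `H` with first column replaced
by `v`. Choosing `w = conj v / |v|²` removes the special role of the first coordinate, and makes the
mean a scalar matrix plus a term in `v` and `conj v`. -/
theorem det_chartJacobian_eq (z : ℂ) (u : Fin n → ℂ) (g : Fin (n + 1) → Fin n → ℂ) :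
    (chartJacobian (Fin.cons z u, g)).det = (Matrix.of fun i j =>
      ((if i = j then z else 0) + affineVec u i * conj (affineVec u j) / normSum u) -
        rowVec u (z * affineVec u i) (g i) j).det := by
  have hs : (normSum u : ℂ) ≠ 0 := by
    exact_mod_cast (zero_lt_one.trans_le (one_le_normSum u)).ne'
  let H : Matrix (Fin (n + 1)) (Fin (n + 1)) ℂ := Matrix.of fun i j =>
    (if i = j then z else 0) - rowVec u (z * affineVec u i) (g i) j
  have h := det_add_vecMulVec H (affineVec u) (fun j => conj (affineVec u j) / normSum u)
    (by simp [affineVec]) (by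
      funext i
      have := sum_affineVec_mul_rowVec u (z * affineVec u i) (g i)
      simp only [H, Matrix.mulVec, dotProduct, Matrix.of_apply, sub_mul, Finset.sum_sub_distrib,
        ite_mul, zero_mul, Finset.sum_ite_eq, Finset.mem_univ, if_true, Pi.zero_apply]
      rw [sub_eq_zero]
      simpa [mul_comm] using this.symm) (by
      rw [dotProduct]
      simp_rw [div_mul_eq_mul_div]
      rw [← Finset.sum_div, div_eq_one_iff_eq hs, normSum_coe]
      exact Finset.sum_congr rfl fun i _ => mul_comm _ _)
  have h1 : chartJacobian (Fin.cons z u, g) = H.updateCol 0 (affineVec u) := by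
    ext i j
    refine Fin.cases ?_ (fun j => ?_) j
    · simp only [chartJacobian, Matrix.of_apply, Fin.cons_zero, Matrix.updateCol_self]
      rw [Fin.update_cons_zero]
      rfl
    · simp [chartJacobian, H, rowVec]
  rw [h1, ← h]
  congr 1
  ext i j
  simp only [H, Matrix.add_apply, Matrix.of_apply, Matrix.vecMulVec_apply]
  ring

/-- The truncated exponential series `m! ∑_{k ≤ m} x ^ k / k!`. -/
noncomputable def truncExp (m : ℕ) (x : ℝ) : ℝ :=
  ∑ k ∈ Finset.range (m + 1), (m.factorial : ℝ) / k.factorial * x ^ k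

/-- The binomial theorem, with `(m.choose k) * (m - k)! = m! / k!`. -/
theorem factorialFunctional_X_add_C_pow (m : ℕ) (x : ℝ) :
    factorialFunctional ℂ ((Polynomial.X + Polynomial.C (x : ℂ)) ^ m) = truncExp m x := by
  rw [add_comm, add_pow, map_sum, truncExp, Complex.ofReal_sum]
  refine Finset.sum_congr rfl fun k hk => ?_
  have hk' : k ≤ m := Nat.lt_succ_iff.1 (Finset.mem_range.1 hk)
  rw [mul_right_comm, ← Polynomial.C_pow, ← Polynomial.C_eq_natCast, ← Polynomial.C_mul,
    factorialFunctional_C_mul_X_pow, Nat.cast_choose ℂ hk']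
  have : ((m - k).factorial : ℂ) ≠ 0 := by exact_mod_cast (m - k).factorial_ne_zero
  have : (k.factorial : ℂ) ≠ 0 := by exact_mod_cast k.factorial_ne_zero
  push_cast
  field_simp

/-- The leading coefficient in the conditional second moment of the determinant. -/
noncomputable def detCoeff (τ : ℝ) (u : Fin n → ℂ) : ℝ :=
  (1 - τ ^ 2) * normSum u ^ 2 / disc τ u

/-- The constant coefficient in the conditional second moment of the determinant. -/
noncomputable def detConst (τ : ℝ) (z : ℂ) (u : Fin n → ℂ) : ℝ :=
  ((1 - τ) ^ 2 * (normSum u ^ 2 + τ * ‖squareSum u‖ ^ 2) ^ 2 * z.re ^ 2 +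
    (1 + τ) ^ 2 * (normSum u ^ 2 - τ * ‖squareSum u‖ ^ 2) ^ 2 * z.im ^ 2) / disc τ u ^ 2

/-- The mean of a row in the deflated matrix. -/
noncomputable def deflated (τ : ℝ) (z : ℂ) (u : Fin n → ℂ) :
    Matrix (Fin (n + 1)) (Fin (n + 1)) ℂ :=
  deflatedMean τ (normSum u) (squareSum u) (conj (squareSum u)) z (conj z) (affineVec u)
    (fun i => conj (affineVec u i))

theorem deflated_apply (z : ℂ) (u : Fin n → ℂ) (i j : Fin (n + 1)) :
    deflated τ z u i j = ((if i = j then z else 0) +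
      affineVec u i * conj (affineVec u j) / normSum u) - rowMean τ u (z * affineVec u i) j := by
  simp only [deflated, deflatedMean, Matrix.of_apply, rowMean, multiplier, ← disc_coe, map_div₀,
    map_sub, map_mul, Complex.conj_conj, Complex.conj_ofReal]
  ring

theorem conj_deflated_apply (z : ℂ) (u : Fin n → ℂ) (i j : Fin (n + 1)) :
    conj (deflated τ z u i j) = deflatedMean τ (normSum u) (conj (squareSum u)) (squareSum u)
      (conj z) z (fun i => conj (affineVec u i)) (affineVec u) i j := by
  have h : (normSum u : ℂ) ^ 2 - (τ : ℂ) ^ 2 * (conj (squareSum u) * squareSum u) =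
      (disc τ u : ℂ) := by
    rw [disc_coe]; ring
  simp only [deflated, deflatedMean, Matrix.of_apply, ← disc_coe, h, map_div₀,
    map_sub, map_add, map_mul, Complex.conj_conj, Complex.conj_ofReal, apply_ite conj, map_zero]

/-- With `ρ = ‖z‖ ^ 2`, the rank-two computation gives `(T + ρ) ^ (n - 1) * (detCoeff * T +
detConst)`. Writing `T = (T + ρ) - ρ` expresses it by two powers of `T + ρ`, each of which the
functional sends to a truncated exponential series. -/
theorem sum_perm_deflated (hn : 1 ≤ n) (h0 : 0 ≤ τ) (h1 : τ < 1) (z : ℂ) (u : Fin n → ℂ) :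
    ∑ σ : Equiv.Perm (Fin (n + 1)), ∑ π : Equiv.Perm (Fin (n + 1)),
      ((Equiv.Perm.sign σ : ℤ) : ℂ) * ((Equiv.Perm.sign π : ℤ) : ℂ) *
        ∏ i, (conditionalCov τ (normSum u) (squareSum u) (conj (squareSum u))
          (affineVec u) (fun i => conj (affineVec u i)) (σ i) (π i) +
            deflated τ z u i (σ i) * conj (deflated τ z u i (π i))) =
      (detCoeff τ u * truncExp n (‖z‖ ^ 2) +
        (detConst τ z u - detCoeff τ u * ‖z‖ ^ 2) * truncExp (n - 1) (‖z‖ ^ 2) : ℝ) := by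
  simp_rw [conj_deflated_apply]
  rw [sum_sign_mul_sign_prod]
  have hs : (normSum u : ℂ) ≠ 0 := by
    exact_mod_cast (zero_lt_one.trans_le (one_le_normSum u)).ne'
  have hD : (normSum u : ℂ) ^ 2 - (τ : ℂ) ^ 2 * (squareSum u * conj (squareSum u)) ≠ 0 := by
    rw [← disc_coe]
    exact_mod_cast (disc_pos h0 h1 u).ne'
  have hpoly : ((Polynomial.X : Polynomial ℂ) • (conditionalCov τ (normSum u) (squareSum u)
      (conj (squareSum u)) (affineVec u) (fun i => conj (affineVec u i))).map Polynomial.C +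
      ((deflated τ z u).map Polynomial.C).transpose * (deflatedMean τ (normSum u)
        (conj (squareSum u)) (squareSum u) (conj z) z (fun i => conj (affineVec u i))
        (affineVec u)).map Polynomial.C).det =
      Polynomial.C (detCoeff τ u : ℂ) * (Polynomial.X + Polynomial.C ((‖z‖ ^ 2 : ℝ) : ℂ)) ^ n +
        Polynomial.C ((detConst τ z u - detCoeff τ u * ‖z‖ ^ 2 : ℝ) : ℂ) *
          (Polynomial.X + Polynomial.C ((‖z‖ ^ 2 : ℝ) : ℂ)) ^ (n - 1) := by
    refine Polynomial.funext fun T => ?_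
    have h := det_smul_conditionalCov_add (n := Fin (n + 1)) (by simpa using hn) τ (normSum u)
      (squareSum u) (conj (squareSum u)) z (conj z) T (affineVec u) (fun i => conj (affineVec u i))
      hs hD rfl (normSum_coe u).symm (conj_squareSum u).symm
    rw [← Polynomial.coe_evalRingHom, RingHom.map_det]
    have e1 : (Polynomial.evalRingHom T).mapMatrix ((Polynomial.X : Polynomial ℂ) •
        (conditionalCov τ (normSum u) (squareSum u)
        (conj (squareSum u)) (affineVec u) (fun i => conj (affineVec u i))).map Polynomial.C +
        ((deflated τ z u).map Polynomial.C).transpose * (deflatedMean τ (normSum u)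
        (conj (squareSum u)) (squareSum u) (conj z) z (fun i => conj (affineVec u i))
        (affineVec u)).map Polynomial.C) =
        T • conditionalCov τ (normSum u) (squareSum u) (conj (squareSum u)) (affineVec u)
          (fun i => conj (affineVec u i)) + (deflated τ z u).transpose *
          deflatedMean τ (normSum u) (conj (squareSum u)) (squareSum u) (conj z) z
            (fun i => conj (affineVec u i)) (affineVec u) := by
      ext i j
      simp [Matrix.mul_apply, Polynomial.eval_finsetSum, mul_comm T]
    rw [e1]
    refine h.trans ?_
    have hz : ((‖z‖ ^ 2 : ℝ) : ℂ) = z * conj z := by rw [Complex.mul_conj']; push_cast; rfl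
    have hq : ((‖squareSum u‖ ^ 2 : ℝ) : ℂ) = squareSum u * conj (squareSum u) := by
      rw [Complex.mul_conj']; push_cast; rfl
    have e2 : (1 - (τ : ℂ) ^ 2) * (normSum u : ℂ) ^ 2 / ((normSum u : ℂ) ^ 2 - (τ : ℂ) ^ 2 *
        (squareSum u * conj (squareSum u))) = (detCoeff τ u : ℂ) := by
      rw [detCoeff, ← disc_coe]
      push_cast
      rfl
    have e3 : ((1 - (τ : ℂ)) ^ 2 * ((normSum u : ℂ) ^ 2 + τ * (squareSum u * conj (squareSum u))) ^ 2
        * ((z + conj z) / 2) ^ 2 - (1 + (τ : ℂ)) ^ 2 * ((normSum u : ℂ) ^ 2 - τ *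
          (squareSum u * conj (squareSum u))) ^ 2 * ((z - conj z) / 2) ^ 2) /
        ((normSum u : ℂ) ^ 2 - (τ : ℂ) ^ 2 * (squareSum u * conj (squareSum u))) ^ 2 =
        (detConst τ z u : ℂ) := by
      have e4 : ((z - conj z) / 2) ^ 2 = -(z.im : ℂ) ^ 2 := by
        rw [Complex.sub_conj]
        push_cast
        linear_combination (z.im : ℂ) ^ 2 * Complex.I_sq
      rw [detConst, ← disc_coe, e4, Complex.add_conj, ← hq]
      push_cast
      ring
    rw [e2, e3, ← hz, Fintype.card_fin, show n + 1 - 2 = n - 1 by omega]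
    obtain ⟨m, rfl⟩ : ∃ m, n = m + 1 := ⟨n - 1, by omega⟩
    simp only [Nat.add_sub_cancel, Polynomial.coe_evalRingHom, Polynomial.eval_add,
      Polynomial.eval_mul, Polynomial.eval_pow, Polynomial.eval_X, Polynomial.eval_C]
    push_cast
    ring
  rw [hpoly, map_add, ← Polynomial.smul_eq_C_mul, ← Polynomial.smul_eq_C_mul, map_smul, map_smul,
    factorialFunctional_X_add_C_pow, factorialFunctional_X_add_C_pow]
  simp

end Determinant

/-! ### Integrating out the columns for a fixed eigenpair. -/

section ColumnIntegral

local notation "conj" => starRingEnd ℂ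

variable {n : ℕ} {τ : ℝ}

theorem det_mul_conj_det (M : Matrix (Fin (n + 1)) (Fin (n + 1)) ℂ) :
    M.det * conj M.det = ∑ σ : Equiv.Perm (Fin (n + 1)), ∑ π : Equiv.Perm (Fin (n + 1)),
      ((Equiv.Perm.sign σ : ℤ) : ℂ) * ((Equiv.Perm.sign π : ℤ) : ℂ) *
        ∏ i, (M i (σ i) * conj (M i (π i))) := by
  rw [← Matrix.det_transpose, Matrix.det_apply', map_sum, Finset.sum_mul_sum]
  refine Finset.sum_congr rfl fun σ _ => Finset.sum_congr rfl fun π _ => ?_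
  rw [Finset.prod_mul_distrib, map_mul, map_prod, map_intCast]
  simp only [Matrix.transpose_apply]
  ring

/-- Expand the squared modulus of the determinant over pairs of permutations. Each term is a product
of functions of single rows, so its integral is a product of conditional second moments; the
resulting double sum is the one in `sum_perm_deflated`. -/
theorem integral_columnDensity_mul (hn : 1 ≤ n) (h0 : 0 ≤ τ) (h1 : τ < 1) (z : ℂ) (u : Fin n → ℂ) :
    Integrable (fun g : Fin (n + 1) → Fin n → ℂ => columnDensity τ (eigenChart (Fin.cons z u, g)) *
      ‖(chartJacobian (Fin.cons z u, g)).det‖ ^ 2) ∧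
    ∫ g : Fin (n + 1) → Fin n → ℂ, columnDensity τ (eigenChart (Fin.cons z u, g)) *
      ‖(chartJacobian (Fin.cons z u, g)).det‖ ^ 2 =
      (∏ i, rowDensity τ u (z * affineVec u i)) * (detCoeff τ u * truncExp n (‖z‖ ^ 2) +
        (detConst τ z u - detCoeff τ u * ‖z‖ ^ 2) * truncExp (n - 1) (‖z‖ ^ 2)) := by
  let a : Fin (n + 1) → Fin (n + 1) → ℂ := fun i j =>
    (if i = j then z else 0) + affineVec u i * conj (affineVec u j) / normSum u
  let f : Fin (n + 1) → Fin (n + 1) → Fin (n + 1) → (Fin n → ℂ) → ℂ := fun i j k g =>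
    (rowWeight τ u (z * affineVec u i) g : ℂ) *
      ((a i j - rowVec u (z * affineVec u i) g j) * conj (a i k - rowVec u (z * affineVec u i) g k))
  have hf : ∀ i j k, Integrable (f i j k) := fun i j k =>
    integrable_rowWeight_mul_conj h0 h1 u _ _ _ _ _
  have hprod : ∀ σ π : Equiv.Perm (Fin (n + 1)), Integrable
      (fun g : Fin (n + 1) → Fin n → ℂ => ((Equiv.Perm.sign σ : ℤ) : ℂ) *
        ((Equiv.Perm.sign π : ℤ) : ℂ) * ∏ i, f i (σ i) (π i) (g i)) := fun σ π =>
    (Integrable.fintype_prod (f := fun i => f i (σ i) (π i)) fun i => hf i _ _).const_mul _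
  have e : ∀ g : Fin (n + 1) → Fin n → ℂ,
      ((columnDensity τ (eigenChart (Fin.cons z u, g)) *
        ‖(chartJacobian (Fin.cons z u, g)).det‖ ^ 2 : ℝ) : ℂ) =
      ∑ σ : Equiv.Perm (Fin (n + 1)), ∑ π : Equiv.Perm (Fin (n + 1)),
        ((Equiv.Perm.sign σ : ℤ) : ℂ) * ((Equiv.Perm.sign π : ℤ) : ℂ) *
          ∏ i, f i (σ i) (π i) (g i) := by
    intro g
    push_cast
    rw [← Complex.mul_conj', det_chartJacobian_eq, det_mul_conj_det, columnDensity_eigenChart,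
      Finset.mul_sum]
    refine Finset.sum_congr rfl fun σ _ => ?_
    rw [Finset.mul_sum]
    refine Finset.sum_congr rfl fun π _ => ?_
    simp only [f, a, Matrix.of_apply, Complex.ofReal_prod]
    rw [Finset.prod_mul_distrib (f := fun i => (rowWeight τ u (z * affineVec u i) (g i) : ℂ))]
    ring
  have hint : Integrable (fun g : Fin (n + 1) → Fin n → ℂ =>
      ((columnDensity τ (eigenChart (Fin.cons z u, g)) *
        ‖(chartJacobian (Fin.cons z u, g)).det‖ ^ 2 : ℝ) : ℂ)) := by
    simp_rw [e]
    exact integrable_finsetSum _ fun σ _ => integrable_finsetSum _ fun π _ => hprod σ π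
  refine ⟨hint.re, ?_⟩
  rw [← Complex.ofReal_inj, ← integral_complex_ofReal]
  simp_rw [e]
  rw [integral_finsetSum _ fun σ _ => integrable_finsetSum _ fun π _ => hprod σ π,
    Complex.ofReal_mul, ← sum_perm_deflated hn h0 h1, Finset.mul_sum]
  refine Finset.sum_congr rfl fun σ _ => ?_
  rw [integral_finsetSum _ fun π _ => hprod σ π, Finset.mul_sum]
  refine Finset.sum_congr rfl fun π _ => ?_
  rw [integral_const_mul, integral_fintype_prod_volume_eq_prod (fun i => f i (σ i) (π i))]
  simp only [f, integral_rowWeight_mul_conj h0 h1, Finset.prod_mul_distrib, deflated_apply,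
    Complex.ofReal_prod, a]
  ring

/-- Row `i` is conditioned at `h = z v i`. The sums of `|v i|²` and of `conj (v ⬝ v) * v i²` are
`|v|²` and `|v ⬝ v|²`, so the exponents combine. -/
theorem prod_rowDensity (z : ℂ) (u : Fin n → ℂ) :
    ∏ i, rowDensity τ u (z * affineVec u i) =
      Real.exp (-((normSum u ^ 2 * ‖z‖ ^ 2 - τ * ‖squareSum u‖ ^ 2 * (z.re ^ 2 - z.im ^ 2)) /
        disc τ u)) / (Real.pi * Real.sqrt (disc τ u)) ^ (n + 1) := by
  simp only [rowDensity, Finset.prod_div_distrib, ← Real.exp_sum, Finset.prod_const,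
    Finset.card_univ, Fintype.card_fin, re_multiplier_mul]
  congr 2
  rw [Finset.sum_neg_distrib, ← Finset.sum_div, Finset.sum_sub_distrib, ← Finset.mul_sum,
    ← Finset.mul_sum]
  congr 3
  · simp_rw [norm_mul, mul_pow, ← Finset.mul_sum, normSum]
    ring
  · have h : ∑ i, conj (squareSum u) * (z * affineVec u i * (z * affineVec u i)) =
        ((‖squareSum u‖ ^ 2 : ℝ) : ℂ) * (z * z) := by
      push_cast
      rw [← Complex.conj_mul']
      nth_rewrite 3 [squareSum]
      rw [Finset.mul_sum, Finset.sum_mul]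
      exact Finset.sum_congr rfl fun i _ => by ring
    rw [← Complex.re_sum, h, Complex.re_ofReal_mul, Complex.mul_re]
    ring

/-- The contribution to the mean density at `z` of the eigenvectors `v` with
`|v ⬝ v|² = r |v|⁴`. -/
noncomputable def fiberDensity (n : ℕ) (τ : ℝ) (z : ℂ) (r : ℝ) : ℝ :=
  Real.exp (-((‖z‖ ^ 2 - τ * r * (z.re ^ 2 - z.im ^ 2)) / (1 - τ ^ 2 * r))) /
    (Real.pi * Real.sqrt (1 - τ ^ 2 * r)) ^ (n + 1) *
  ((1 - τ ^ 2) / (1 - τ ^ 2 * r) * truncExp n (‖z‖ ^ 2) +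
    (((1 - τ) ^ 2 * (1 + τ * r) ^ 2 * z.re ^ 2 + (1 + τ) ^ 2 * (1 - τ * r) ^ 2 * z.im ^ 2) /
      (1 - τ ^ 2 * r) ^ 2 - (1 - τ ^ 2) / (1 - τ ^ 2 * r) * ‖z‖ ^ 2) *
        truncExp (n - 1) (‖z‖ ^ 2))

/-- `|v ⬝ v|² / |v|⁴` for `v = affineVec u`. -/
noncomputable def squareRatio (u : Fin n → ℂ) : ℝ := ‖squareSum u‖ ^ 2 / normSum u ^ 2

/-- Homogeneity: `disc = |v|⁴ (1 - τ² r)`. Powers of `|v|` cancel everywhere except in the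
normalisation of the `n + 1` row densities, which leaves `1 / normSum u ^ (n + 1)`. -/
theorem lintegral_columnDensity_mul (hn : 1 ≤ n) (h0 : 0 ≤ τ) (h1 : τ < 1) (z : ℂ)
    (u : Fin n → ℂ) :
    ∫⁻ g : Fin (n + 1) → Fin n → ℂ, ENNReal.ofReal (columnDensity τ (eigenChart (Fin.cons z u, g)) *
      ‖(chartJacobian (Fin.cons z u, g)).det‖ ^ 2) =
      ENNReal.ofReal (1 / normSum u ^ (n + 1) * fiberDensity n τ z (squareRatio u)) := by
  obtain ⟨h2, h3⟩ := integral_columnDensity_mul hn h0 h1 z u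
  rw [← ofReal_integral_eq_lintegral_ofReal h2 (Filter.Eventually.of_forall fun g =>
    mul_nonneg (columnDensity_nonneg _ _) (sq_nonneg _)), h3, prod_rowDensity]
  have hs : 0 < normSum u := zero_lt_one.trans_le (one_le_normSum u)
  have hD : disc τ u = normSum u ^ 2 * (1 - τ ^ 2 * squareRatio u) := by
    rw [disc, squareRatio]
    field_simp
  have hq : ‖squareSum u‖ ^ 2 = normSum u ^ 2 * squareRatio u := by
    rw [squareRatio]
    field_simp
  have hR : 0 < 1 - τ ^ 2 * squareRatio u := by
    have := disc_pos h0 h1 u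
    rw [hD] at this
    exact pos_of_mul_pos_right this (sq_nonneg _)
  rw [fiberDensity, detCoeff, detConst, hD, hq, Real.sqrt_mul (sq_nonneg _), Real.sqrt_sq hs.le]
  have hR' : 0 < Real.sqrt (1 - τ ^ 2 * squareRatio u) := Real.sqrt_pos.2 hR
  congr 1
  have e1 : (normSum u ^ 2 * ‖z‖ ^ 2 - τ * (normSum u ^ 2 * squareRatio u) * (z.re ^ 2 - z.im ^ 2)) /
      (normSum u ^ 2 * (1 - τ ^ 2 * squareRatio u)) =
      (‖z‖ ^ 2 - τ * squareRatio u * (z.re ^ 2 - z.im ^ 2)) / (1 - τ ^ 2 * squareRatio u) := by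
    rw [← mul_div_mul_left _ (1 - τ ^ 2 * squareRatio u) (pow_pos hs 2).ne']
    congr 1
    ring
  have e2 : (1 - τ ^ 2) * normSum u ^ 2 / (normSum u ^ 2 * (1 - τ ^ 2 * squareRatio u)) =
      (1 - τ ^ 2) / (1 - τ ^ 2 * squareRatio u) := by
    rw [mul_comm (1 - τ ^ 2), mul_div_mul_left _ _ (pow_pos hs 2).ne']
  have e3 : ((1 - τ) ^ 2 * (normSum u ^ 2 + τ * (normSum u ^ 2 * squareRatio u)) ^ 2 * z.re ^ 2 +
      (1 + τ) ^ 2 * (normSum u ^ 2 - τ * (normSum u ^ 2 * squareRatio u)) ^ 2 * z.im ^ 2) /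
      (normSum u ^ 2 * (1 - τ ^ 2 * squareRatio u)) ^ 2 =
      ((1 - τ) ^ 2 * (1 + τ * squareRatio u) ^ 2 * z.re ^ 2 +
        (1 + τ) ^ 2 * (1 - τ * squareRatio u) ^ 2 * z.im ^ 2) / (1 - τ ^ 2 * squareRatio u) ^ 2 := by
    rw [← mul_div_mul_left _ ((1 - τ ^ 2 * squareRatio u) ^ 2) (pow_pos hs 4).ne']
    congr 1 <;> ring
  rw [e1, e2, e3, mul_left_comm Real.pi, mul_pow (normSum u), ← mul_assoc]
  congr 1
  rw [div_mul_div_comm, one_mul]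

end ColumnIntegral

/-! ### Polar coordinates, reflections and Archimedes' theorem. -/

section Geometry

theorem lintegral_fun_norm {E : Type*} [NormedAddCommGroup E] [NormedSpace ℝ E]
    [FiniteDimensional ℝ E] [Nontrivial E] [MeasurableSpace E] [BorelSpace E] (μ : Measure E)
    [μ.IsAddHaarMeasure] {f : ℝ → ENNReal} (hf : Measurable f) :
    ∫⁻ x, f ‖x‖ ∂μ = μ.toSphere Set.univ *
      ∫⁻ y in Set.Ioi (0 : ℝ), ENNReal.ofReal (y ^ (Module.finrank ℝ E - 1)) * f y := by
  have h1 := (μ.measurePreserving_homeomorphUnitSphereProd).lintegral_comp_emb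
    (Homeomorph.measurableEmbedding _) (fun p => f p.2)
  simp only [homeomorphUnitSphereProd_apply_snd_coe] at h1
  have h2 : ∫⁻ x, f ‖x‖ ∂μ = ∫⁻ x in ({0}ᶜ : Set E), f ‖x‖ ∂μ := by
    rw [restrict_compl_singleton]
  have h3 := lintegral_subtype_comap (μ := μ) (measurableSet_singleton (0 : E)).compl (fun x => f ‖x‖)
  rw [h2, ← h3]
  refine h1.trans ?_
  have h4 := lintegral_prod_mul (μ := μ.toSphere)
    (ν := Measure.volumeIoiPow (Module.finrank ℝ E - 1)) (f := fun _ => 1)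
    (g := fun y => f y) aemeasurable_const (hf.comp measurable_subtype_coe).aemeasurable
  simp only [one_mul, lintegral_const] at h4
  rw [h4, Measure.volumeIoiPow, lintegral_withDensity_eq_lintegral_mul
    (g := fun y : Set.Ioi (0 : ℝ) => f y) _
    ((measurable_subtype_coe.pow_const _).ennreal_ofReal) (hf.comp measurable_subtype_coe)]
  congr 1
  exact lintegral_subtype_comap measurableSet_Ioi
    (fun y : ℝ => ENNReal.ofReal (y ^ (Module.finrank ℝ E - 1)) * f y)

/-- Averages over `a` of functions of `‖a‖` and `⟪a, b⟫` only depend on `‖b‖`. -/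
theorem lintegral_norm_inner {m : ℕ} (b : EuclideanSpace ℝ (Fin (m + 1)))
    (F : ℝ → ℝ → ENNReal) :
    ∫⁻ a : EuclideanSpace ℝ (Fin (m + 1)), F ‖a‖ (inner ℝ a b) =
      ∫⁻ a : EuclideanSpace ℝ (Fin (m + 1)), F ‖a‖ (‖b‖ * a 0) := by
  let e : EuclideanSpace ℝ (Fin (m + 1)) := EuclideanSpace.single 0 ‖b‖
  have he : ‖e‖ = ‖b‖ := by simp [e]
  -- The reflection in the hyperplane orthogonal to `e - b` takes `e = ‖b‖ e₀` to `b`, because the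
  -- two norms agree.
  let R := (Submodule.span ℝ {e - b})ᗮ.reflection
  have hR : R e = b := Submodule.reflection_sub he
  rw [← (R.measurePreserving).lintegral_comp_emb R.toHomeomorph.measurableEmbedding]
  refine lintegral_congr fun a => ?_
  have : inner ℝ (R a) b = ‖b‖ * a 0 := by
    rw [← hR, R.inner_map_map]
    simp [e, EuclideanSpace.inner_single_right]
  rw [this, R.norm_map]

/-- The Cayley transform from the unit disc to the upper half-plane. -/
noncomputable def cayley (ζ : ℂ) : ℂ := Complex.I * (1 + ζ) / (1 - ζ)

theorem one_sub_ne_zero_of_mem_ball {ζ : ℂ} (hζ : ζ ∈ Metric.ball (0 : ℂ) 1) : 1 - ζ ≠ 0 := by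
  intro h
  rw [mem_ball_zero_iff, ← sub_eq_zero.1 h] at hζ
  simp at hζ

theorem cayley_im_norm {ζ : ℂ} (hζ : 1 - ζ ≠ 0) :
    (cayley ζ).im = (1 - ‖ζ‖ ^ 2) / ‖1 - ζ‖ ^ 2 ∧
    1 + ‖cayley ζ‖ ^ 2 = 2 * (1 + ‖ζ‖ ^ 2) / ‖1 - ζ‖ ^ 2 := by
  have h1 : ‖1 - ζ‖ ^ 2 ≠ 0 := by simpa using hζ
  constructor
  · rw [cayley, Complex.div_im, Complex.normSq_eq_norm_sq, ← Complex.normSq_eq_norm_sq ζ,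
      Complex.normSq_apply, ← sub_div]
    congr 1
    simp
    ring
  · rw [cayley, norm_div, norm_mul, Complex.norm_I, one_mul, div_pow, eq_div_iff h1, add_mul,
      div_mul_cancel₀ _ h1, ← Complex.normSq_eq_norm_sq, ← Complex.normSq_eq_norm_sq,
      ← Complex.normSq_eq_norm_sq]
    simp only [Complex.normSq_apply, Complex.add_re, Complex.add_im, Complex.sub_re,
      Complex.sub_im, Complex.one_re, Complex.one_im]
    ring

theorem cayley_image_ball : cayley '' Metric.ball 0 1 = {z : ℂ | 0 < z.im} := by
  ext z
  constructor
  · rintro ⟨ζ, hζ, rfl⟩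
    have h1 := one_sub_ne_zero_of_mem_ball hζ
    rw [Set.mem_ofPred_eq, (cayley_im_norm h1).1]
    rw [mem_ball_zero_iff] at hζ
    have := norm_nonneg ζ
    have : 0 < ‖1 - ζ‖ := norm_pos_iff.2 h1
    have : 0 < 1 - ‖ζ‖ ^ 2 := by nlinarith
    positivity
  · intro hz
    rw [Set.mem_ofPred_eq] at hz
    have h1 : z + Complex.I ≠ 0 := by
      intro h
      have := congrArg Complex.im h
      simp at this
      linarith
    refine ⟨(z - Complex.I) / (z + Complex.I), ?_, ?_⟩
    · rw [mem_ball_zero_iff, norm_div, div_lt_one (norm_pos_iff.2 h1), ← sq_lt_sq₀ (norm_nonneg _)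
        (norm_nonneg _), ← Complex.normSq_eq_norm_sq, ← Complex.normSq_eq_norm_sq,
        Complex.normSq_apply, Complex.normSq_apply]
      simp
      nlinarith
    · rw [cayley]
      have h2 : (1 : ℂ) - (z - Complex.I) / (z + Complex.I) = 2 * Complex.I / (z + Complex.I) := by
        field_simp
        ring
      rw [h2]
      have := Complex.I_ne_zero
      field_simp
      ring

theorem cayley_injOn : Set.InjOn cayley (Metric.ball 0 1) := by
  intro a ha b hb h
  have h1 := one_sub_ne_zero_of_mem_ball ha
  have h2 := one_sub_ne_zero_of_mem_ball hb
  rw [cayley, cayley, div_eq_div_iff h1 h2] at h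
  have h3 : Complex.I * 2 * (a - b) = 0 := by linear_combination h
  have h4 : a - b = 0 := by simpa using h3
  exact sub_eq_zero.1 h4

theorem hasDerivAt_cayley {ζ : ℂ} (hζ : 1 - ζ ≠ 0) :
    HasDerivAt cayley (2 * Complex.I / (1 - ζ) ^ 2) ζ := by
  have h := (((hasDerivAt_id ζ).const_add 1).const_mul Complex.I).div
    ((hasDerivAt_id ζ).const_sub 1) hζ
  refine h.congr_deriv ?_
  congr 1
  simp
  ring

/-- The weight `1 / (1 + |z|²)²` is spherical area in stereographic coordinates, and the Cayley
transform is a rotation of the sphere. It takes the coordinate in the direction of `i` to the polar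
one, which is radial on the disc. -/
theorem lintegral_cayley (g : ℝ → ENNReal) :
    ∫⁻ z in {z : ℂ | 0 < z.im}, ENNReal.ofReal (1 / (1 + ‖z‖ ^ 2) ^ 2) *
      g (2 * z.im / (1 + ‖z‖ ^ 2)) =
    ∫⁻ ζ in Metric.ball (0 : ℂ) 1, ENNReal.ofReal (1 / (1 + ‖ζ‖ ^ 2) ^ 2) *
      g ((1 - ‖ζ‖ ^ 2) / (1 + ‖ζ‖ ^ 2)) := by
  rw [← cayley_image_ball, lintegral_image_eq_lintegral_abs_det_fderiv_mul volume
    measurableSet_ball (fun ζ hζ => ((hasDerivAt_cayley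
      (one_sub_ne_zero_of_mem_ball hζ)).hasFDerivAt.restrictScalars ℝ).hasFDerivWithinAt)
    cayley_injOn]
  refine setLIntegral_congr_fun measurableSet_ball fun ζ hζ => ?_
  have h1 := one_sub_ne_zero_of_mem_ball hζ
  obtain ⟨h2, h3⟩ := cayley_im_norm h1
  have h4 : ‖1 - ζ‖ ≠ 0 := norm_ne_zero_iff.2 h1
  have h5 : 1 + ‖ζ‖ ^ 2 ≠ 0 := by positivity
  have h6 : |((ContinuousLinearMap.toSpanSingleton ℂ (2 * Complex.I / (1 - ζ) ^ 2)).restrictScalars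
      ℝ).det| = 4 / ‖1 - ζ‖ ^ 4 := by
    simp [ContinuousLinearMap.det, LinearMap.det_restrictScalars,
      Algebra.norm_complex_eq, Complex.normSq_eq_norm_sq, ← pow_mul]
    norm_num
    positivity
  simp only [h6]
  rw [← mul_assoc, ← ENNReal.ofReal_mul (by positivity), h2, h3]
  congr 2
  · field_simp
    norm_num
  · field_simp

theorem lintegral_rational_substitution (g : ℝ → ENNReal) :
    ∫⁻ w in Set.Ioo (0 : ℝ) 1, g w = ∫⁻ ρ in Set.Ioo (0 : ℝ) 1,
      ENNReal.ofReal (4 * ρ / (1 + ρ ^ 2) ^ 2) * g ((1 - ρ ^ 2) / (1 + ρ ^ 2)) := by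
  have h1 : (fun ρ : ℝ => (1 - ρ ^ 2) / (1 + ρ ^ 2)) '' Set.Ioo 0 1 = Set.Ioo 0 1 := by
    ext w
    constructor
    · rintro ⟨ρ, ⟨h0, h1⟩, rfl⟩
      have : 0 < 1 - ρ ^ 2 := by nlinarith
      refine ⟨by positivity, ?_⟩
      rw [div_lt_one (by positivity)]
      nlinarith
    · rintro ⟨h0, h1⟩
      have h2 : 0 < (1 - w) / (1 + w) := div_pos (by linarith) (by linarith)
      refine ⟨Real.sqrt ((1 - w) / (1 + w)), ⟨Real.sqrt_pos.2 h2, ?_⟩, ?_⟩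
      · rw [Real.sqrt_lt' one_pos, one_pow, div_lt_one (by linarith)]
        linarith
      · simp only [Real.sq_sqrt h2.le]
        have : 1 + w ≠ 0 := by linarith
        field_simp
        ring
  have h2 : ∀ ρ ∈ Set.Ioo (0 : ℝ) 1, HasDerivWithinAt (fun ρ : ℝ => (1 - ρ ^ 2) / (1 + ρ ^ 2))
      (-(4 * ρ / (1 + ρ ^ 2) ^ 2)) (Set.Ioo 0 1) ρ := by
    intro ρ _
    have h := ((hasDerivAt_pow 2 ρ).const_sub 1).div ((hasDerivAt_pow 2 ρ).const_add 1)
      (by positivity)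
    refine (h.congr_deriv ?_).hasDerivWithinAt
    rw [← neg_div]
    congr 1
    simp
    ring
  have h3 : Set.InjOn (fun ρ : ℝ => (1 - ρ ^ 2) / (1 + ρ ^ 2)) (Set.Ioo 0 1) := by
    intro a ha b hb h
    simp only at h
    rw [div_eq_div_iff (by positivity) (by positivity)] at h
    have h4 : a ^ 2 = b ^ 2 := by linarith
    exact (pow_left_inj₀ ha.1.le hb.1.le two_ne_zero).1 h4
  nth_rewrite 1 [← h1]
  rw [lintegral_image_eq_lintegral_abs_deriv_mul measurableSet_Ioo h2 h3]
  refine setLIntegral_congr_fun measurableSet_Ioo fun ρ hρ => ?_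
  have := hρ.1
  simp only [abs_neg]
  rw [abs_of_nonneg (by positivity)]

/-- A coordinate on the sphere is uniformly distributed. -/
theorem lintegral_upperHalfPlane {g : ℝ → ENNReal} (hg : Measurable g) :
    ∫⁻ z in {z : ℂ | 0 < z.im}, ENNReal.ofReal (1 / (1 + ‖z‖ ^ 2) ^ 2) *
      g (2 * z.im / (1 + ‖z‖ ^ 2)) =
    (volume : Measure ℂ).toSphere Set.univ * ENNReal.ofReal (1 / 4) *
      ∫⁻ w in Set.Ioo (0 : ℝ) 1, g w := by
  rw [lintegral_cayley, ← lintegral_indicator measurableSet_ball]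
  let F : ℝ → ENNReal := (Set.Iio 1).indicator fun ρ =>
    ENNReal.ofReal (1 / (1 + ρ ^ 2) ^ 2) * g ((1 - ρ ^ 2) / (1 + ρ ^ 2))
  have hF : Measurable F := Measurable.indicator (by fun_prop) measurableSet_Iio
  have e : (Metric.ball (0 : ℂ) 1).indicator (fun ζ => ENNReal.ofReal (1 / (1 + ‖ζ‖ ^ 2) ^ 2) *
      g ((1 - ‖ζ‖ ^ 2) / (1 + ‖ζ‖ ^ 2))) = fun ζ => F ‖ζ‖ := by
    funext ζ
    simp [F, Set.indicator]
  rw [e, lintegral_fun_norm volume hF, lintegral_rational_substitution, mul_assoc,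
    ← lintegral_const_mul' _ _ ENNReal.ofReal_ne_top, ← lintegral_indicator measurableSet_Ioi,
    ← lintegral_indicator measurableSet_Ioo]
  congr 2
  funext ρ
  by_cases h : ρ ∈ Set.Ioo (0 : ℝ) 1
  · rw [Set.indicator_of_mem h, Set.indicator_of_mem (Set.mem_Ioi.2 h.1)]
    simp only [F]
    have := h.1
    rw [Set.indicator_of_mem (Set.mem_Iio.2 h.2), ← mul_assoc, ← mul_assoc, Complex.finrank_real_complex,
      ← ENNReal.ofReal_mul (by positivity), ← ENNReal.ofReal_mul (by positivity)]
    congr 2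
    field_simp
    norm_num
  · rw [Set.indicator_of_notMem h]
    by_cases h2 : 0 < ρ
    · have : ρ ∉ Set.Iio 1 := fun h3 => h ⟨h2, h3⟩
      simp [F, this, Set.indicator]
    · rw [Set.indicator_of_notMem (by simpa using h2)]

end Geometry

/-! ### The law of the ratio, up to a constant. -/

section Eigenvectors

theorem lintegral_upperHalfPlane_smul {t : ℝ} (ht : 0 < t) (f : ℂ → ENNReal) :
    ∫⁻ z in {z : ℂ | 0 < z.im}, f z =
      ENNReal.ofReal (t ^ 2) * ∫⁻ z in {z : ℂ | 0 < z.im}, f (t * z) := by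
  have hm : MeasurableSet {z : ℂ | 0 < z.im} := measurableSet_lt measurable_const Complex.measurable_im
  rw [← lintegral_indicator hm, ← lintegral_indicator hm]
  have h1 := (Homeomorph.smulOfNeZero t ht.ne' : ℂ ≃ₜ ℂ).measurableEmbedding.lintegral_map
    (μ := volume) ({z : ℂ | 0 < z.im}.indicator f)
  have h2 : Measure.map (Homeomorph.smulOfNeZero t ht.ne' : ℂ ≃ₜ ℂ) volume =
      ENNReal.ofReal |(t ^ Module.finrank ℝ ℂ)⁻¹| • volume :=
    Measure.map_addHaar_smul volume ht.ne'
  rw [h2, lintegral_smul_measure, Complex.finrank_real_complex, abs_of_pos (by positivity)] at h1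
  have h3 : ∀ z, {z : ℂ | 0 < z.im}.indicator f ((Homeomorph.smulOfNeZero t ht.ne' : ℂ ≃ₜ ℂ) z) =
      {z : ℂ | 0 < z.im}.indicator (fun z => f (t * z)) z := by
    intro z
    simp [Set.indicator, ht]
  simp_rw [h3] at h1
  rw [← h1, smul_eq_mul, ← mul_assoc, ← ENNReal.ofReal_mul (by positivity),
    mul_inv_cancel₀ (by positivity), ENNReal.ofReal_one, one_mul]

theorem lintegral_upperHalfPlane_eq {f : ℂ → ENNReal} (hf : Measurable f) :
    ∫⁻ z in {z : ℂ | 0 < z.im}, f z =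
      ∫⁻ x : ℝ, ∫⁻ y in Set.Ioi (0 : ℝ), f ⟨x, y⟩ := by
  have hm : MeasurableSet {z : ℂ | 0 < z.im} := measurableSet_lt measurable_const Complex.measurable_im
  rw [← lintegral_indicator hm,
    ← Complex.volume_preserving_equiv_real_prod.symm.lintegral_comp (hf.indicator hm)]
  refine (lintegral_prod _ ((hf.indicator hm).comp
      Complex.measurableEquivRealProd.symm.measurable).aemeasurable).trans ?_
  refine lintegral_congr fun x => ?_
  rw [← lintegral_indicator measurableSet_Ioi]
  rfl

/-- The identification of `ℝⁿ × ℝⁿ` with `ℂⁿ`. -/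
noncomputable def realImEquiv (n : ℕ) :
    EuclideanSpace ℝ (Fin n) × EuclideanSpace ℝ (Fin n) ≃ᵐ (Fin n → ℂ) :=
  (((MeasurableEquiv.toLp 2 (Fin n → ℝ)).symm.prodCongr (MeasurableEquiv.toLp 2 (Fin n → ℝ)).symm).trans
    (MeasurableEquiv.arrowProdEquivProdArrow ℝ ℝ (Fin n)).symm).trans
    (MeasurableEquiv.piCongrRight fun _ => Complex.measurableEquivRealProd.symm)

theorem realImEquiv_apply {n : ℕ} (p : EuclideanSpace ℝ (Fin n) × EuclideanSpace ℝ (Fin n))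
    (i : Fin n) : realImEquiv n p i = ⟨p.1 i, p.2 i⟩ := rfl

theorem measurePreserving_realImEquiv (n : ℕ) :
    MeasurePreserving (realImEquiv n) (volume.prod volume) volume := by
  have h1 := (PiLp.volume_preserving_ofLp (Fin n)).prod (PiLp.volume_preserving_ofLp (Fin n))
  have h2 := (volume_measurePreserving_arrowProdEquivProdArrow ℝ ℝ (Fin n)).symm
  have h3 := volume_preserving_pi (ι := Fin n)
    (fun _ => Complex.volume_preserving_equiv_real_prod.symm)
  exact (h3.comp h2).comp h1

theorem lintegral_euclideanSpace_succ {m : ℕ} {f : ℝ → ℝ → ENNReal}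
    (hf : Measurable (Function.uncurry f)) :
    ∫⁻ a : EuclideanSpace ℝ (Fin (m + 1)), f (‖a‖ ^ 2) (a 0) =
      ∫⁻ a : Fin m → ℝ, ∫⁻ x : ℝ, f (x ^ 2 + ∑ i, a i ^ 2) x := by
  have h1 := (PiLp.volume_preserving_toLp (Fin (m + 1))).comp
    (volume_preserving_piFinSuccAbove (fun _ : Fin (m + 1) => ℝ) 0).symm
  have hm : Measurable fun a : EuclideanSpace ℝ (Fin (m + 1)) => f (‖a‖ ^ 2) (a 0) :=
    hf.comp (f := fun a : EuclideanSpace ℝ (Fin (m + 1)) => (‖a‖ ^ 2, a 0)) (by fun_prop)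
  rw [← h1.lintegral_comp hm]
  refine (lintegral_prod_symm _ (hm.comp h1.measurable).aemeasurable).trans ?_
  refine lintegral_congr fun a => lintegral_congr fun x => ?_
  simp [EuclideanSpace.norm_sq_eq, Fin.sum_univ_succ, MeasurableEquiv.piFinSuccAbove,
    Fin.insertNthEquiv]

variable {m : ℕ}

theorem normSum_realImEquiv (p : EuclideanSpace ℝ (Fin m) × EuclideanSpace ℝ (Fin m)) :
    normSum (realImEquiv m p) = 1 + ‖p.1‖ ^ 2 + ‖p.2‖ ^ 2 := by
  simp only [normSum, Fin.sum_univ_succ, affineVec, Fin.cons_zero, Fin.cons_succ,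
    EuclideanSpace.norm_sq_eq, ← Complex.normSq_eq_norm_sq, Complex.normSq_apply,
    realImEquiv_apply, Finset.sum_add_distrib, Real.norm_eq_abs, sq_abs]
  simp [sq, add_assoc]

theorem norm_squareSum_realImEquiv (p : EuclideanSpace ℝ (Fin m) × EuclideanSpace ℝ (Fin m)) :
    ‖squareSum (realImEquiv m p)‖ ^ 2 =
      (1 + ‖p.1‖ ^ 2 - ‖p.2‖ ^ 2) ^ 2 + 4 * (inner ℝ p.1 p.2) ^ 2 := by
  have h1 : (squareSum (realImEquiv m p)).re = 1 + ‖p.1‖ ^ 2 - ‖p.2‖ ^ 2 := by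
    rw [EuclideanSpace.norm_sq_eq, EuclideanSpace.norm_sq_eq]
    simp [squareSum, Fin.sum_univ_succ, affineVec, realImEquiv_apply, ← sq, add_sub_assoc]
    simp [sq, Finset.sum_sub_distrib]
  have h2 : (squareSum (realImEquiv m p)).im = 2 * inner ℝ p.1 p.2 := by
    simp [squareSum, Fin.sum_univ_succ, affineVec, realImEquiv_apply, PiLp.inner_apply,
      Finset.mul_sum]
    exact Finset.sum_congr rfl fun i _ => by ring
  rw [← Complex.normSq_eq_norm_sq, Complex.normSq_apply, h1, h2]
  ring

/-- The contribution of the point `x + iy` of the half-plane. -/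
theorem lintegral_upperHalfPlane_pow (m : ℕ) {k : ℝ → ENNReal} (hk : Measurable k) {t : ℝ}
    (ht : 0 < t) :
    ∫⁻ z in {z : ℂ | 0 < z.im}, ENNReal.ofReal (z.im ^ m / (t ^ 2 + ‖z‖ ^ 2) ^ (m + 2)) *
      k (1 - (2 * t * z.im / (t ^ 2 + ‖z‖ ^ 2)) ^ 2) =
    ENNReal.ofReal (1 / t ^ (m + 2)) * (ENNReal.ofReal ((1 / 2) ^ m) *
      ((volume : Measure ℂ).toSphere Set.univ * ENNReal.ofReal (1 / 4))) *
        ∫⁻ w in Set.Ioo (0 : ℝ) 1, ENNReal.ofReal (w ^ m) * k (1 - w ^ 2) := by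
  have hm : MeasurableSet {z : ℂ | 0 < z.im} := measurableSet_lt measurable_const Complex.measurable_im
  rw [lintegral_upperHalfPlane_smul ht, mul_assoc, mul_assoc,
    ← lintegral_upperHalfPlane (g := fun w => ENNReal.ofReal (w ^ m) * k (1 - w ^ 2))
      (by fun_prop), ← lintegral_const_mul' _ _ ENNReal.ofReal_ne_top,
      ← lintegral_const_mul' _ _ ENNReal.ofReal_ne_top,
      ← lintegral_const_mul' _ _ ENNReal.ofReal_ne_top]
  refine setLIntegral_congr_fun hm fun z hz => ?_
  have hz' : 0 < z.im := hz
  have h1 : t ^ 2 + ‖(t : ℂ) * z‖ ^ 2 = t ^ 2 * (1 + ‖z‖ ^ 2) := by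
    rw [norm_mul, Complex.norm_real, Real.norm_of_nonneg ht.le]
    ring
  have h2 : 0 < 1 + ‖z‖ ^ 2 := by positivity
  simp only [h1, Complex.im_ofReal_mul]
  have h3 : 2 * t * (t * z.im) / (t ^ 2 * (1 + ‖z‖ ^ 2)) = 2 * z.im / (1 + ‖z‖ ^ 2) := by
    field_simp
  rw [h3]
  simp only [← mul_assoc]
  rw [← ENNReal.ofReal_mul (by positivity), ← ENNReal.ofReal_mul (by positivity),
    ← ENNReal.ofReal_mul (by positivity), ← ENNReal.ofReal_mul (by positivity)]
  congr 2
  generalize 1 + ‖z‖ ^ 2 = S at h2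
  simp only [div_pow, mul_pow, one_pow]
  field_simp
  ring

/-- Write `u = a + i b` with real vectors, so that `|v|² = 1 + |a|² + |b|²` and `v ⬝ v = 1 + |a|² -
|b|² + 2 i ⟪a, b⟫`. Rotate `b` onto the first axis and use polar coordinates `y = |b|`. With `x` the
first coordinate of `a`, `z = x + i y`, and `t²` equal to one plus the squares of its other
coordinates, `|v|² = t² + |z|²` and `1 - r = (2 t y / (t² + |z|²))²`. The half-plane integral then
depends on `t` only by a factor, which joins the constant. That constant is not evaluated here. -/
theorem exists_lintegral_squareRatio (m : ℕ) : ∃ C : ENNReal, ∀ k : ℝ → ENNReal, Measurable k →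
    ∫⁻ u : Fin (m + 1) → ℂ, ENNReal.ofReal (1 / normSum u ^ (m + 2)) * k (squareRatio u) =
      C * ∫⁻ w in Set.Ioo (0 : ℝ) 1, ENNReal.ofReal (w ^ m) * k (1 - w ^ 2) := by
  let cE := (volume : Measure (EuclideanSpace ℝ (Fin (m + 1)))).toSphere Set.univ
  let c := ENNReal.ofReal ((1 / 2) ^ m) *
      ((volume : Measure ℂ).toSphere Set.univ * ENNReal.ofReal (1 / 4))
  refine ⟨cE * ((∫⁻ a : Fin m → ℝ,
    ENNReal.ofReal (1 / Real.sqrt (1 + ∑ i, a i ^ 2) ^ (m + 2))) * c), fun k hk => ?_⟩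
  let Ψ : ℝ → ℝ → ℝ → ENNReal := fun A x y => ENNReal.ofReal (1 / (1 + A + y ^ 2) ^ (m + 2)) *
    k (((1 + A - y ^ 2) ^ 2 + 4 * x ^ 2) / (1 + A + y ^ 2) ^ 2)
  have hΨ : Measurable fun p : ℝ × ℝ × ℝ => Ψ p.1 p.2.1 p.2.2 := by fun_prop
  let f : ℝ → ℝ → ENNReal := fun A x =>
    ∫⁻ y in Set.Ioi (0 : ℝ), ENNReal.ofReal (y ^ m) * Ψ A (y * x) y
  have hf : Measurable (Function.uncurry f) := by
    have : Measurable fun q : (ℝ × ℝ) × ℝ =>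
        ENNReal.ofReal (q.2 ^ m) * Ψ q.1.1 (q.2 * q.1.2) q.2 := by fun_prop
    exact this.lintegral_prod_right
  have e1 : ∀ p : EuclideanSpace ℝ (Fin (m + 1)) × EuclideanSpace ℝ (Fin (m + 1)), ENNReal.ofReal (1 / normSum (realImEquiv (m + 1) p) ^ (m + 2)) *
      k (squareRatio (realImEquiv (m + 1) p)) = Ψ (‖p.1‖ ^ 2) (inner ℝ p.1 p.2) ‖p.2‖ := by
    intro p
    simp only [squareRatio, normSum_realImEquiv, norm_squareSum_realImEquiv, Ψ]
  have hm1 : Measurable fun p : EuclideanSpace ℝ (Fin (m + 1)) × EuclideanSpace ℝ (Fin (m + 1)) => Ψ (‖p.1‖ ^ 2) (inner ℝ p.1 p.2) ‖p.2‖ :=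
    hΨ.comp (f := fun p : EuclideanSpace ℝ (Fin (m + 1)) × EuclideanSpace ℝ (Fin (m + 1)) => (‖p.1‖ ^ 2, inner ℝ p.1 p.2, ‖p.2‖)) (by fun_prop)
  have hm2 : Measurable fun p : EuclideanSpace ℝ (Fin (m + 1)) × EuclideanSpace ℝ (Fin (m + 1)) => Ψ (‖p.1‖ ^ 2) (‖p.2‖ * p.1 0) ‖p.2‖ :=
    hΨ.comp (f := fun p : EuclideanSpace ℝ (Fin (m + 1)) × EuclideanSpace ℝ (Fin (m + 1)) => (‖p.1‖ ^ 2, ‖p.2‖ * p.1 0, ‖p.2‖)) (by fun_prop)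
  rw [← (measurePreserving_realImEquiv (m + 1)).lintegral_comp_emb
    (realImEquiv (m + 1)).measurableEmbedding]
  simp_rw [e1]
  rw [lintegral_prod_symm _ hm1.aemeasurable]
  have e2 : ∀ b : EuclideanSpace ℝ (Fin (m + 1)), ∫⁻ a : EuclideanSpace ℝ (Fin (m + 1)), Ψ (‖a‖ ^ 2) (inner ℝ a b) ‖b‖ =
      ∫⁻ a : EuclideanSpace ℝ (Fin (m + 1)), Ψ (‖a‖ ^ 2) (‖b‖ * a 0) ‖b‖ := fun b =>
    lintegral_norm_inner b (fun r x => Ψ (r ^ 2) x ‖b‖)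
  simp_rw [e2]
  -- Exchanging the order lets `b`, now present only through its norm, be integrated radially for
  -- fixed `a`.
  rw [← lintegral_prod_symm _ hm2.aemeasurable, lintegral_prod _ hm2.aemeasurable]
  have e3 : ∀ a : EuclideanSpace ℝ (Fin (m + 1)), ∫⁻ b : EuclideanSpace ℝ (Fin (m + 1)), Ψ (‖a‖ ^ 2) (‖b‖ * a 0) ‖b‖ = cE * f (‖a‖ ^ 2) (a 0) := by
    intro a
    have := lintegral_fun_norm (volume : Measure (EuclideanSpace ℝ (Fin (m + 1)))) (f := fun y => Ψ (‖a‖ ^ 2) (y * a 0) y)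
      (hΨ.comp (f := fun y : ℝ => (‖a‖ ^ 2, y * a 0, y)) (by fun_prop))
    rw [finrank_euclideanSpace_fin] at this
    exact this
  simp_rw [e3]
  have hm3 : Measurable fun a : EuclideanSpace ℝ (Fin (m + 1)) => f (‖a‖ ^ 2) (a 0) :=
    hf.comp (f := fun a : EuclideanSpace ℝ (Fin (m + 1)) => (‖a‖ ^ 2, a 0)) (by fun_prop)
  rw [lintegral_const_mul _ hm3, lintegral_euclideanSpace_succ hf, mul_assoc, mul_assoc]
  congr 1
  rw [← lintegral_mul_const _ (by fun_prop)]
  refine lintegral_congr fun a => ?_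
  have ht : 0 < 1 + ∑ i, a i ^ 2 := by positivity
  have hH := lintegral_upperHalfPlane_pow m hk (Real.sqrt_pos.2 ht)
  rw [mul_assoc] at hH
  rw [← hH, lintegral_upperHalfPlane_eq (by fun_prop)]
  refine lintegral_congr fun x => setLIntegral_congr_fun measurableSet_Ioi fun y hy => ?_
  have hy' : (0 : ℝ) < y := hy
  have h4 : Real.sqrt (1 + ∑ i, a i ^ 2) ^ 2 + ‖(⟨x, y⟩ : ℂ)‖ ^ 2 =
      1 + (x ^ 2 + ∑ i, a i ^ 2) + y ^ 2 := by
    rw [Real.sq_sqrt ht.le, ← Complex.normSq_eq_norm_sq, Complex.normSq_apply]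
    ring
  simp only [Ψ, h4]
  have hs : 0 < 1 + (x ^ 2 + ∑ i, a i ^ 2) + y ^ 2 := by positivity
  rw [← mul_assoc, ← ENNReal.ofReal_mul (by positivity), mul_one_div]
  congr 2
  rw [div_pow, mul_pow, mul_pow, mul_pow, Real.sq_sqrt ht.le]
  field_simp
  ring

end Eigenvectors

/-! ### The total mass, which fixes the constant. -/

section Mass

theorem lintegral_exp_neg_mul_norm_sq {t : ℝ} (ht : 0 < t) :
    ∫⁻ z : ℂ, ENNReal.ofReal (Real.exp (-(t * ‖z‖ ^ 2))) = ENNReal.ofReal (Real.pi / t) := by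
  have h := integral_exp_quadratic (a := 1 / t) le_rfl (by positivity)
  have e : ∀ z : ℂ, -((1 / t * ‖z‖ ^ 2 - 0 * (z * z).re) / ((1 / t) ^ 2 - 0 ^ 2)) =
      -(t * ‖z‖ ^ 2) := by
    intro z
    field_simp
    ring
  simp_rw [e] at h
  rw [zero_pow two_ne_zero, sub_zero, Real.sqrt_sq (by positivity), mul_one_div] at h
  rw [← ofReal_integral_eq_lintegral_ofReal, h]
  · exact Integrable.of_integral_ne_zero (by rw [h]; positivity)
  · exact Filter.Eventually.of_forall fun z => (Real.exp_pos _).le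

theorem lintegral_pow_mul_exp_neg (n : ℕ) {s : ℝ} (hs : 0 < s) :
    ∫⁻ t in Set.Ioi (0 : ℝ), ENNReal.ofReal (t ^ n * Real.exp (-(s * t))) =
      ENNReal.ofReal (n.factorial / s ^ (n + 1)) := by
  have h := Real.integral_rpow_mul_exp_neg_mul_Ioi (a := n + 1) (r := s) (by positivity) hs
  rw [add_sub_cancel_right, Real.Gamma_nat_eq_factorial] at h
  have e : ∀ t : ℝ, t ^ (n : ℝ) = t ^ n := fun t => Real.rpow_natCast t n
  have e2 : (1 / s) ^ ((n : ℝ) + 1) = (1 / s) ^ (n + 1) := by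
    exact_mod_cast Real.rpow_natCast (1 / s) (n + 1)
  simp_rw [e, e2] at h
  rw [one_div, inv_pow, inv_mul_eq_div] at h
  rw [← ofReal_integral_eq_lintegral_ofReal, h]
  · exact Integrable.of_integral_ne_zero (by rw [h]; positivity)
  · filter_upwards [ae_restrict_mem measurableSet_Ioi] with t ht
    exact mul_nonneg (pow_nonneg (le_of_lt ht) _) (Real.exp_pos _).le

theorem normSum_eq {n : ℕ} (u : Fin n → ℂ) : normSum u = 1 + ∑ i, ‖u i‖ ^ 2 := by
  simp [normSum, Fin.sum_univ_succ, affineVec]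

/-- Write `1 / s ^ (n + 1)` as `1 / n!` times the integral of `t ^ n * exp (-s t)`. After exchanging
integrals, the one over `u` is Gaussian with value `(π / t) ^ n * exp (-t)`, which cancels `t ^ n`.
-/
theorem lintegral_one_div_normSum_pow (n : ℕ) :
    ∫⁻ u : Fin n → ℂ, ENNReal.ofReal (1 / normSum u ^ (n + 1)) =
      ENNReal.ofReal (Real.pi ^ n / n.factorial) := by
  have hf : (0 : ℝ) < n.factorial := by exact_mod_cast n.factorial_pos
  have e1 : ∀ u : Fin n → ℂ, ENNReal.ofReal (1 / normSum u ^ (n + 1)) =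
      ENNReal.ofReal (1 / n.factorial) * ∫⁻ t in Set.Ioi (0 : ℝ),
        ENNReal.ofReal (t ^ n * Real.exp (-(normSum u * t))) := by
    intro u
    have hs : 0 < normSum u := zero_lt_one.trans_le (one_le_normSum u)
    rw [lintegral_pow_mul_exp_neg n hs, ← ENNReal.ofReal_mul (by positivity)]
    congr 1
    field_simp
  have hn : Measurable (normSum (n := n)) := by
    rw [show normSum (n := n) = fun u => 1 + ∑ i, ‖u i‖ ^ 2 from funext normSum_eq]
    fun_prop
  simp_rw [e1]
  rw [lintegral_const_mul' _ _ ENNReal.ofReal_ne_top, lintegral_lintegral_swap (by fun_prop)]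
  have e2 : ∀ t ∈ Set.Ioi (0 : ℝ), ∫⁻ u : Fin n → ℂ,
      ENNReal.ofReal (t ^ n * Real.exp (-(normSum u * t))) =
        ENNReal.ofReal (Real.pi ^ n) * ENNReal.ofReal (t ^ 0 * Real.exp (-(1 * t))) := by
    intro t ht
    have ht' : 0 < t := ht
    have e3 : ∀ u : Fin n → ℂ, ENNReal.ofReal (t ^ n * Real.exp (-(normSum u * t))) =
        ENNReal.ofReal (t ^ n * Real.exp (-t)) *
          ∏ i, ENNReal.ofReal (Real.exp (-(t * ‖u i‖ ^ 2))) := by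
      intro u
      rw [← ENNReal.ofReal_prod_of_nonneg fun i _ => (Real.exp_pos _).le, ← Real.exp_sum,
        ← ENNReal.ofReal_mul (by positivity), mul_assoc, ← Real.exp_add, normSum_eq,
        Finset.sum_neg_distrib, ← Finset.mul_sum]
      congr 3
      ring
    simp_rw [e3]
    rw [lintegral_const_mul' _ _ ENNReal.ofReal_ne_top]
    have e4 := lintegral_fin_prod_eq_prod (n := n) (fun _ => (volume : Measure ℂ))
      (fun _ z => ENNReal.ofReal (Real.exp (-(t * ‖z‖ ^ 2)))) (fun _ => by fun_prop)
    rw [volume_pi, e4]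
    simp only [lintegral_exp_neg_mul_norm_sq ht', Finset.prod_const, Finset.card_univ,
      Fintype.card_fin]
    rw [← ENNReal.ofReal_pow (by positivity), ← ENNReal.ofReal_mul (by positivity),
      ← ENNReal.ofReal_mul (by positivity), div_pow]
    congr 1
    field_simp
  rw [setLIntegral_congr_fun measurableSet_Ioi e2, lintegral_const_mul' _ _ ENNReal.ofReal_ne_top,
    lintegral_pow_mul_exp_neg 0 one_pos, ← ENNReal.ofReal_mul (by positivity),
    ← ENNReal.ofReal_mul (by positivity)]
  congr 1
  simp
  field_simp

/-- The law of `|v ⬝ v|² / |v|⁴` for an eigenvector `v`. -/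
theorem lintegral_squareRatio (m : ℕ) {k : ℝ → ENNReal} (hk : Measurable k) :
    ∫⁻ u : Fin (m + 1) → ℂ, ENNReal.ofReal (1 / normSum u ^ (m + 2)) * k (squareRatio u) =
      ENNReal.ofReal (Real.pi ^ (m + 1) / m.factorial) *
        ∫⁻ w in Set.Ioo (0 : ℝ) 1, ENNReal.ofReal (w ^ m) * k (1 - w ^ 2) := by
  obtain ⟨C, hC⟩ := exists_lintegral_squareRatio m
  rw [hC k hk]
  congr 1
  -- Testing with `k = 1` determines `C`: the left side is `π ^ (m + 1) / (m + 1)!` and the integral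
  -- on the right is `1 / (m + 1)`.
  have h := hC (fun _ => 1) measurable_const
  simp only [mul_one] at h
  have h2 : ∫⁻ w in Set.Ioo (0 : ℝ) 1, ENNReal.ofReal (w ^ m) =
      ENNReal.ofReal (1 / ((m : ℝ) + 1)) := by
    rw [Measure.restrict_congr_set Ioo_ae_eq_Ioc, ← ofReal_integral_eq_lintegral_ofReal
      (intervalIntegral.intervalIntegrable_pow _).1, ← intervalIntegral.integral_of_le zero_le_one]
    · simp
    · filter_upwards [ae_restrict_mem measurableSet_Ioc] with y hy
      exact pow_nonneg hy.1.le _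
  have hm : (0 : ℝ) < (m : ℝ) + 1 := by positivity
  have hf : (0 : ℝ) < m.factorial := by exact_mod_cast m.factorial_pos
  have h3 : C * ENNReal.ofReal (1 / ((m : ℝ) + 1)) = ENNReal.ofReal (Real.pi ^ (m + 1) / m.factorial)
      * ENNReal.ofReal (1 / ((m : ℝ) + 1)) := by
    rw [← h2, ← h, lintegral_one_div_normSum_pow, h2, ← ENNReal.ofReal_mul (by positivity)]
    congr 1
    rw [Nat.factorial_succ]
    push_cast
    field_simp
  exact (ENNReal.mul_left_inj (by simpa using hm) ENNReal.ofReal_ne_top).1 h3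

end Mass

/-! ### Incomplete Gamma functions, positivity and the last substitution. -/

section Density

theorem truncExp_succ (m : ℕ) (x : ℝ) :
    truncExp (m + 1) x = x ^ (m + 1) + (m + 1) * truncExp m x := by
  have h : ((m + 1).factorial : ℝ) ≠ 0 := by exact_mod_cast (m + 1).factorial_ne_zero
  rw [truncExp, Finset.sum_range_succ, div_self h, one_mul, add_comm, truncExp, Finset.mul_sum]
  congr 1
  refine Finset.sum_congr rfl fun k _ => ?_
  rw [Nat.factorial_succ]
  push_cast
  ring

theorem truncExp_zero (x : ℝ) : truncExp 0 x = 1 := by simp [truncExp]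

theorem continuous_truncExp (m : ℕ) : Continuous (truncExp m) := by
  unfold truncExp
  fun_prop

theorem hasDerivAt_exp_neg_mul_truncExp (m : ℕ) (t : ℝ) :
    HasDerivAt (fun t => -(Real.exp (-t) * truncExp m t)) (t ^ m * Real.exp (-t)) t := by
  have he : HasDerivAt (fun t : ℝ => Real.exp (-t)) (-Real.exp (-t)) t := by
    simpa using (hasDerivAt_neg t).exp
  induction m with
  | zero =>
    simp only [truncExp_zero, mul_one, pow_zero, one_mul]
    exact he.neg.congr_deriv (neg_neg _)
  | succ m ih =>
    have h := ((he.mul (hasDerivAt_pow (m + 1) t)).neg).add (ih.const_mul ((m : ℝ) + 1))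
    refine (h.congr_deriv ?_).congr_of_eventuallyEq (Filter.Eventually.of_forall fun s => ?_)
    · simp
      ring
    · simp [truncExp_succ]
      ring

theorem tendsto_exp_neg_mul_truncExp (m : ℕ) :
    Filter.Tendsto (fun t => -(Real.exp (-t) * truncExp m t)) Filter.atTop (nhds 0) := by
  have h : Filter.Tendsto (fun t : ℝ => -∑ k ∈ Finset.range (m + 1),
      (m.factorial : ℝ) / k.factorial * (t ^ k * Real.exp (-t))) Filter.atTop
      (nhds (-∑ k ∈ Finset.range (m + 1), (m.factorial : ℝ) / k.factorial * 0)) :=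
    (tendsto_finsetSum _ fun k _ =>
      (Real.tendsto_pow_mul_exp_neg_atTop_nhds_zero k).const_mul _).neg
  simp only [mul_zero, Finset.sum_const_zero, neg_zero] at h
  refine h.congr fun t => ?_
  rw [truncExp, Finset.mul_sum]
  congr 1
  exact Finset.sum_congr rfl fun k _ => by ring

theorem incompleteGamma_natCast_succ (m : ℕ) {a : ℝ} (ha : 0 ≤ a) :
    incompleteGamma ((m : ℝ) + 1) a = Real.exp (-a) * truncExp m a := by
  have e : ∀ t : ℝ, t ^ (m : ℝ) = t ^ m := fun t => Real.rpow_natCast t m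
  rw [incompleteGamma]
  simp_rw [add_sub_cancel_right, e]
  rw [integral_Ioi_of_hasDerivAt_of_nonneg' (fun t _ => hasDerivAt_exp_neg_mul_truncExp m t)
    (fun t ht => mul_nonneg (pow_nonneg (ha.trans (le_of_lt ht)) _) (Real.exp_pos _).le)
    (tendsto_exp_neg_mul_truncExp m)]
  ring

theorem truncExp_nonneg (m : ℕ) {x : ℝ} (hx : 0 ≤ x) : 0 ≤ truncExp m x := by
  unfold truncExp
  positivity

theorem interpolatingIntegrand_eq (m : ℕ) (τ x y w : ℝ) :
    interpolatingIntegrand (m + 2) τ x y w =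
      w ^ m / Real.sqrt (1 - τ ^ 2 * w ^ 2) *
        Real.exp (τ * (1 - w ^ 2) * (x ^ 2 / (1 + τ) - y ^ 2 / (1 - τ))) *
        (Real.exp (-(x ^ 2 + y ^ 2)) * (truncExp (m + 1) (x ^ 2 + y ^ 2) * (1 - τ ^ 2 * w ^ 2) +
          truncExp m (x ^ 2 + y ^ 2) * τ * w ^ 2 *
            (τ * (x ^ 2 + y ^ 2) * (1 + w ^ 2) - 2 * (x ^ 2 - y ^ 2)))) := by
  have h1 := incompleteGamma_natCast_succ (m + 1) (a := x ^ 2 + y ^ 2) (by positivity)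
  have h2 := incompleteGamma_natCast_succ m (a := x ^ 2 + y ^ 2) (by positivity)
  rw [interpolatingIntegrand, Nat.add_sub_cancel,
    show ((m + 2 : ℕ) : ℝ) = ((m + 1 : ℕ) : ℝ) + 1 by push_cast; ring, h1,
    show ((m + 1 : ℕ) : ℝ) + 1 - 1 = (m : ℝ) + 1 by push_cast; ring, h2]
  ring

theorem interpolatingIntegrand_nonneg (m : ℕ) {τ : ℝ} (h0 : 0 ≤ τ) (h1 : τ < 1) (x y : ℝ) {w : ℝ}
    (hw : w ∈ Set.Icc (0 : ℝ) 1) : 0 ≤ interpolatingIntegrand (m + 2) τ x y w := by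
  obtain ⟨hw0, hw1⟩ := hw
  rw [interpolatingIntegrand_eq]
  have hQ : 0 ≤ 1 - τ ^ 2 * w ^ 2 := by
    have : τ * w ≤ 1 := mul_le_one₀ h1.le hw0 hw1
    have : 0 ≤ τ * w := by positivity
    nlinarith
  have hT := truncExp_nonneg m (x := x ^ 2 + y ^ 2) (by positivity)
  -- Splitting off `ρ * truncExp m ρ` with `ρ = x² + y²` collects the indefinite terms into two
  -- squares; the remaining difference `truncExp (m + 1) ρ - ρ * truncExp m ρ` is nonnegative by
  -- induction.
  have hB : truncExp (m + 1) (x ^ 2 + y ^ 2) * (1 - τ ^ 2 * w ^ 2) +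
      truncExp m (x ^ 2 + y ^ 2) * τ * w ^ 2 *
        (τ * (x ^ 2 + y ^ 2) * (1 + w ^ 2) - 2 * (x ^ 2 - y ^ 2)) =
      (truncExp (m + 1) (x ^ 2 + y ^ 2) - (x ^ 2 + y ^ 2) * truncExp m (x ^ 2 + y ^ 2)) *
        (1 - τ ^ 2 * w ^ 2) + truncExp m (x ^ 2 + y ^ 2) *
          (x ^ 2 * (1 - τ * w ^ 2) ^ 2 + y ^ 2 * (1 + τ * w ^ 2) ^ 2) := by
    ring
  have hD : ∀ (m : ℕ) {r : ℝ}, 0 ≤ r → 0 ≤ truncExp (m + 1) r - r * truncExp m r := by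
    intro m r hr
    induction m with
    | zero => simp [truncExp_succ, truncExp_zero]
    | succ m ih =>
      have h2 := truncExp_nonneg (m + 1) hr
      have h3 := truncExp_nonneg m hr
      have h4 : (truncExp (m + 2) r - r * truncExp (m + 1) r) = truncExp (m + 1) r +
          (m + 1) * (truncExp (m + 1) r - r * truncExp m r) := by
        rw [truncExp_succ (m + 1), truncExp_succ m]
        push_cast
        ring
      rw [h4]
      positivity
  have := hD m (r := x ^ 2 + y ^ 2) (by positivity)
  rw [hB]
  positivity

/-- The substitution relating `w` to the eigenvector statistic `1 - |v ⬝ v|² / |v|⁴`. -/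
theorem lintegral_sqrt_substitution {τ : ℝ} (h0 : 0 ≤ τ) (h1 : τ < 1) (g : ℝ → ENNReal) :
    ∫⁻ w in Set.Ioo (0 : ℝ) 1, g w = ∫⁻ w in Set.Ioo (0 : ℝ) 1,
      ENNReal.ofReal (Real.sqrt (1 - τ ^ 2) / Real.sqrt (1 - τ ^ 2 * w ^ 2) ^ 3) *
        g (w * Real.sqrt (1 - τ ^ 2) / Real.sqrt (1 - τ ^ 2 * w ^ 2)) := by
  have hA : 0 < 1 - τ ^ 2 := by nlinarith
  have hA' := Real.sqrt_pos.2 hA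
  have hQ : ∀ w ∈ Set.Ioo (0 : ℝ) 1, 0 < 1 - τ ^ 2 * w ^ 2 := by
    intro w hw
    have : w ^ 2 < 1 := by nlinarith [hw.1, hw.2]
    nlinarith [sq_nonneg τ]
  have hsq : ∀ w ∈ Set.Ioo (0 : ℝ) 1,
      (w * Real.sqrt (1 - τ ^ 2) / Real.sqrt (1 - τ ^ 2 * w ^ 2)) ^ 2 =
        w ^ 2 * (1 - τ ^ 2) / (1 - τ ^ 2 * w ^ 2) := by
    intro w hw
    rw [div_pow, mul_pow, Real.sq_sqrt hA.le, Real.sq_sqrt (hQ w hw).le]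
  have himg : (fun w : ℝ => w * Real.sqrt (1 - τ ^ 2) / Real.sqrt (1 - τ ^ 2 * w ^ 2)) ''
      Set.Ioo 0 1 = Set.Ioo 0 1 := by
    ext s
    constructor
    · rintro ⟨w, hw, rfl⟩
      have hq := hQ w hw
      have h2 := Real.sqrt_pos.2 hq
      have h3 := hw.1
      refine ⟨by positivity, ?_⟩
      rw [← sq_lt_one_iff₀ (by positivity), hsq w hw, div_lt_one hq]
      nlinarith [hw.2]
    · rintro ⟨hs0, hs1⟩
      have hd : 0 < 1 - τ ^ 2 + τ ^ 2 * s ^ 2 := by positivity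
      -- The preimage of `s`, found by solving `s² = w² (1 - τ²) / (1 - τ² w²)` for `w`.
      have hwpos : 0 < s / Real.sqrt (1 - τ ^ 2 + τ ^ 2 * s ^ 2) :=
        div_pos hs0 (Real.sqrt_pos.2 hd)
      have hw2 : (s / Real.sqrt (1 - τ ^ 2 + τ ^ 2 * s ^ 2)) ^ 2 =
          s ^ 2 / (1 - τ ^ 2 + τ ^ 2 * s ^ 2) := by
        rw [div_pow, Real.sq_sqrt hd.le]
      have hw : s / Real.sqrt (1 - τ ^ 2 + τ ^ 2 * s ^ 2) ∈ Set.Ioo (0 : ℝ) 1 := by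
        refine ⟨hwpos, ?_⟩
        rw [← sq_lt_one_iff₀ hwpos.le, hw2, div_lt_one hd]
        have : s ^ 2 < 1 := by nlinarith
        nlinarith
      refine ⟨_, hw, ?_⟩
      have hq := Real.sqrt_pos.2 (hQ _ hw)
      simp only
      rw [← pow_left_inj₀ (by positivity) hs0.le two_ne_zero, hsq _ hw, hw2]
      have h5 : 1 - τ ^ 2 * (s ^ 2 / (1 - τ ^ 2 + τ ^ 2 * s ^ 2)) =
          (1 - τ ^ 2) / (1 - τ ^ 2 + τ ^ 2 * s ^ 2) := by
        field_simp
        ring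
      rw [h5]
      field_simp
  have hinj : Set.InjOn (fun w : ℝ => w * Real.sqrt (1 - τ ^ 2) / Real.sqrt (1 - τ ^ 2 * w ^ 2))
      (Set.Ioo 0 1) := by
    intro a ha b hb h
    have h2 := congrArg (· ^ 2) h
    simp only [hsq a ha, hsq b hb] at h2
    rw [div_eq_div_iff (hQ a ha).ne' (hQ b hb).ne'] at h2
    have h3 : (1 - τ ^ 2) * a ^ 2 = (1 - τ ^ 2) * b ^ 2 := by linear_combination h2
    exact (pow_left_inj₀ ha.1.le hb.1.le two_ne_zero).1 (mul_left_cancel₀ hA.ne' h3)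
  have hder : ∀ w ∈ Set.Ioo (0 : ℝ) 1, HasDerivWithinAt
      (fun w : ℝ => w * Real.sqrt (1 - τ ^ 2) / Real.sqrt (1 - τ ^ 2 * w ^ 2))
      (Real.sqrt (1 - τ ^ 2) / Real.sqrt (1 - τ ^ 2 * w ^ 2) ^ 3) (Set.Ioo 0 1) w := by
    intro w hw
    have hq := hQ w hw
    have hq' := Real.sqrt_pos.2 hq
    have h2 := (((hasDerivAt_pow 2 w).const_mul (τ ^ 2)).const_sub 1).sqrt hq.ne'
    have h3 := ((hasDerivAt_id w).mul_const (Real.sqrt (1 - τ ^ 2))).div h2 hq'.ne'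
    refine (h3.congr_deriv ?_).hasDerivWithinAt
    have h4 := Real.sq_sqrt hq.le
    simp only [id]
    field_simp
    rw [h4]
    norm_num
    ring
  nth_rewrite 1 [← himg]
  rw [lintegral_image_eq_lintegral_abs_deriv_mul measurableSet_Ioo hder hinj]
  refine setLIntegral_congr_fun measurableSet_Ioo fun w hw => ?_
  have h2 := Real.sqrt_pos.2 (hQ w hw)
  rw [abs_of_pos (by positivity)]

end Density

/-! ### The explicit density. -/

section MeanDensity

/-- `interpolatingIntegrand`, extended continuously to all real `w`. -/
noncomputable def extendedIntegrand (m : ℕ) (τ x y w : ℝ) : ℝ :=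
  w ^ m / Real.sqrt (max (1 - τ ^ 2) (1 - τ ^ 2 * w ^ 2)) *
    Real.exp (τ * (1 - w ^ 2) * (x ^ 2 / (1 + τ) - y ^ 2 / (1 - τ))) *
    (Real.exp (-(x ^ 2 + y ^ 2)) * (truncExp (m + 1) (x ^ 2 + y ^ 2) * (1 - τ ^ 2 * w ^ 2) +
      truncExp m (x ^ 2 + y ^ 2) * τ * w ^ 2 *
        (τ * (x ^ 2 + y ^ 2) * (1 + w ^ 2) - 2 * (x ^ 2 - y ^ 2))))

/-- For `w² ≤ 1` the maximum is inactive; elsewhere it keeps the denominator away from zero, which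
allows the continuity of parametric integrals to be applied. -/
theorem interpolatingIntegrand_eq_extendedIntegrand (m : ℕ) (τ x y : ℝ) {w : ℝ}
    (hw : w ∈ Set.uIcc (0 : ℝ) 1) :
    interpolatingIntegrand (m + 2) τ x y w = extendedIntegrand m τ x y w := by
  rw [Set.uIcc_of_le zero_le_one] at hw
  have : w ^ 2 ≤ 1 := pow_le_one₀ hw.1 hw.2
  rw [interpolatingIntegrand_eq, extendedIntegrand, max_eq_right]
  nlinarith [sq_nonneg τ]

theorem continuous_extendedIntegrand (m : ℕ) {τ : ℝ} (h0 : 0 ≤ τ) (h1 : τ < 1) :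
    Continuous fun p : ℂ × ℝ => extendedIntegrand m τ p.1.re p.1.im p.2 := by
  have hA : 0 < 1 - τ ^ 2 := by nlinarith
  have h2 : ∀ p : ℂ × ℝ, Real.sqrt (max (1 - τ ^ 2) (1 - τ ^ 2 * p.2 ^ 2)) ≠ 0 := fun p =>
    (Real.sqrt_pos.2 (lt_max_of_lt_left hA)).ne'
  have h3 := continuous_truncExp m
  have h4 := continuous_truncExp (m + 1)
  unfold extendedIntegrand
  fun_prop (disch := exact h2)

theorem continuous_extendedIntegrand_right (m : ℕ) {τ : ℝ} (h0 : 0 ≤ τ) (h1 : τ < 1) (x y : ℝ) :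
    Continuous (extendedIntegrand m τ x y) :=
  (continuous_extendedIntegrand m h0 h1).comp (Continuous.prodMk_right (⟨x, y⟩ : ℂ))

theorem intervalIntegrable_interpolatingIntegrand (m : ℕ) {τ : ℝ} (h0 : 0 ≤ τ) (h1 : τ < 1)
    (x y : ℝ) : IntervalIntegrable (interpolatingIntegrand (m + 2) τ x y) volume 0 1 :=
  ((continuous_extendedIntegrand_right m h0 h1 x y).intervalIntegrable 0 1).congr
    fun _ hw => (interpolatingIntegrand_eq_extendedIntegrand m τ x y
      (Set.uIoc_subset_uIcc hw)).symm

theorem continuous_interpolatingDensity (m : ℕ) {τ : ℝ} (h0 : 0 ≤ τ) (h1 : τ < 1) :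
    Continuous fun z : ℂ => interpolatingDensity (m + 2) τ z.re z.im := by
  unfold interpolatingDensity
  refine continuous_const.mul ?_
  have e : ∀ z : ℂ, ∫ w in (0 : ℝ)..1, interpolatingIntegrand (m + 2) τ z.re z.im w =
      ∫ w in (0 : ℝ)..1, extendedIntegrand m τ z.re z.im w := fun z =>
    intervalIntegral.integral_congr fun _ hw =>
      interpolatingIntegrand_eq_extendedIntegrand m τ z.re z.im hw
  simp_rw [e]
  exact intervalIntegral.continuous_parametric_intervalIntegral_of_continuous'
    (continuous_extendedIntegrand m h0 h1) 0 1

theorem interpolatingDensity_nonneg (m : ℕ) {τ : ℝ} (h0 : 0 ≤ τ) (h1 : τ < 1) (x y : ℝ) :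
    0 ≤ interpolatingDensity (m + 2) τ x y := by
  have h2 : (((m + 2 : ℕ) : ℝ) - 1) = (m : ℝ) + 1 := by push_cast; ring
  rw [interpolatingDensity, h2, Real.Gamma_nat_eq_factorial]
  exact mul_nonneg (by positivity) (intervalIntegral.integral_nonneg zero_le_one fun w hw =>
    interpolatingIntegrand_nonneg m h0 h1 x y hw)

/-- In the new variable, `r = (1 - w²) / (1 - τ² w²)` and `1 - τ² r = (1 - τ²) / (1 - τ² w²)`. Thus
the leading coefficient becomes `1 - τ² w²`, the constant one loses its denominator, and the
exponent splits off `-(x² + y²)`. -/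
theorem mul_fiberDensity_eq (m : ℕ) {τ : ℝ} (h0 : 0 ≤ τ) (h1 : τ < 1) (z : ℂ) {w : ℝ}
    (hw : w ∈ Set.Ioo (0 : ℝ) 1) :
    Real.pi ^ (m + 1) / m.factorial *
      (Real.sqrt (1 - τ ^ 2) / Real.sqrt (1 - τ ^ 2 * w ^ 2) ^ 3 *
        ((w * Real.sqrt (1 - τ ^ 2) / Real.sqrt (1 - τ ^ 2 * w ^ 2)) ^ m *
          fiberDensity (m + 1) τ z
            (1 - (w * Real.sqrt (1 - τ ^ 2) / Real.sqrt (1 - τ ^ 2 * w ^ 2)) ^ 2))) =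
      1 / (Real.pi * m.factorial * Real.sqrt (1 - τ ^ 2)) *
        interpolatingIntegrand (m + 2) τ z.re z.im w := by
  have hA : 0 < 1 - τ ^ 2 := by nlinarith
  have hQ : 0 < 1 - τ ^ 2 * w ^ 2 := by
    have : w ^ 2 < 1 := by nlinarith [hw.1, hw.2]
    nlinarith [sq_nonneg τ]
  have ha : 1 + τ ≠ 0 := by linarith
  have hb : 1 - τ ≠ 0 := by linarith
  have hρ : ‖z‖ ^ 2 = z.re ^ 2 + z.im ^ 2 := by
    rw [← Complex.normSq_eq_norm_sq, Complex.normSq_apply]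
    ring
  have hr : 1 - (w * Real.sqrt (1 - τ ^ 2) / Real.sqrt (1 - τ ^ 2 * w ^ 2)) ^ 2 =
      (1 - w ^ 2) / (1 - τ ^ 2 * w ^ 2) := by
    rw [div_pow, mul_pow, Real.sq_sqrt hA.le, Real.sq_sqrt hQ.le, eq_div_iff hQ.ne', sub_mul,
      div_mul_cancel₀ _ hQ.ne']
    ring
  have hD : 1 - τ ^ 2 * ((1 - w ^ 2) / (1 - τ ^ 2 * w ^ 2)) =
      (1 - τ ^ 2) / (1 - τ ^ 2 * w ^ 2) := by
    field_simp
    ring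
  have hexp : Real.exp (-((‖z‖ ^ 2 - τ * ((1 - w ^ 2) / (1 - τ ^ 2 * w ^ 2)) *
      (z.re ^ 2 - z.im ^ 2)) / ((1 - τ ^ 2) / (1 - τ ^ 2 * w ^ 2)))) =
      Real.exp (τ * (1 - w ^ 2) * (z.re ^ 2 / (1 + τ) - z.im ^ 2 / (1 - τ))) *
        Real.exp (-(z.re ^ 2 + z.im ^ 2)) := by
    rw [← Real.exp_add, hρ]
    congr 1
    rw [show 1 - τ ^ 2 = (1 + τ) * (1 - τ) by ring]
    field_simp
    ring
  have hc : (1 - τ ^ 2) / ((1 - τ ^ 2) / (1 - τ ^ 2 * w ^ 2)) = 1 - τ ^ 2 * w ^ 2 := by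
    field_simp
  have hk : ((1 - τ) ^ 2 * (1 + τ * ((1 - w ^ 2) / (1 - τ ^ 2 * w ^ 2))) ^ 2 * z.re ^ 2 +
      (1 + τ) ^ 2 * (1 - τ * ((1 - w ^ 2) / (1 - τ ^ 2 * w ^ 2))) ^ 2 * z.im ^ 2) /
      ((1 - τ ^ 2) / (1 - τ ^ 2 * w ^ 2)) ^ 2 =
      z.re ^ 2 * (1 - τ * w ^ 2) ^ 2 + z.im ^ 2 * (1 + τ * w ^ 2) ^ 2 := by
    rw [show 1 - τ ^ 2 = (1 + τ) * (1 - τ) by ring]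
    field_simp
    ring
  rw [hr, fiberDensity, interpolatingIntegrand_eq, hD, hexp, hc, hk, hρ, Real.sqrt_div hA.le,
    Nat.add_sub_cancel]
  have hA' := Real.sqrt_pos.2 hA
  have hQ' := Real.sqrt_pos.2 hQ
  have hf : (0 : ℝ) < m.factorial := by exact_mod_cast m.factorial_pos
  generalize Real.sqrt (1 - τ ^ 2) = a at hA'
  generalize Real.sqrt (1 - τ ^ 2 * w ^ 2) = q at hQ'
  simp only [div_pow, mul_pow]
  field_simp
  ring

theorem lintegral_columnDensity_eq (m : ℕ) {τ : ℝ} (h0 : 0 ≤ τ) (h1 : τ < 1) (z : ℂ) :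
    ∫⁻ u : Fin (m + 1) → ℂ, ∫⁻ g : Fin (m + 2) → Fin (m + 1) → ℂ,
      ENNReal.ofReal (columnDensity τ (eigenChart (Fin.cons z u, g)) *
        ‖(chartJacobian (Fin.cons z u, g)).det‖ ^ 2) =
      ENNReal.ofReal (interpolatingDensity (m + 2) τ z.re z.im) := by
  have hk : Measurable fun r => ENNReal.ofReal (fiberDensity (m + 1) τ z r) := by
    unfold fiberDensity
    fun_prop
  have e1 : ∀ u : Fin (m + 1) → ℂ, ∫⁻ g : Fin (m + 2) → Fin (m + 1) → ℂ,
      ENNReal.ofReal (columnDensity τ (eigenChart (Fin.cons z u, g)) *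
        ‖(chartJacobian (Fin.cons z u, g)).det‖ ^ 2) =
      ENNReal.ofReal (1 / normSum u ^ (m + 2)) *
        ENNReal.ofReal (fiberDensity (m + 1) τ z (squareRatio u)) := by
    intro u
    have hs : 0 < normSum u := zero_lt_one.trans_le (one_le_normSum u)
    rw [lintegral_columnDensity_mul (by omega) h0 h1, ENNReal.ofReal_mul (by positivity)]
  simp_rw [e1]
  rw [lintegral_squareRatio m hk, lintegral_sqrt_substitution h0 h1,
    ← lintegral_const_mul' _ _ ENNReal.ofReal_ne_top]
  have h2 : (((m + 2 : ℕ) : ℝ) - 1) = (m : ℝ) + 1 := by push_cast; ring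
  have hi := (intervalIntegrable_interpolatingIntegrand m h0 h1 z.re z.im).const_mul
    (1 / (Real.pi * m.factorial * Real.sqrt (1 - τ ^ 2)))
  rw [interpolatingDensity, h2, Real.Gamma_nat_eq_factorial,
    ← intervalIntegral.integral_const_mul, intervalIntegral.integral_of_le zero_le_one,
    ofReal_integral_eq_lintegral_ofReal hi.1, Measure.restrict_congr_set Ioo_ae_eq_Ioc.symm]
  · refine setLIntegral_congr_fun measurableSet_Ioo fun w hw => ?_
    have hw0 := hw.1
    rw [← mul_fiberDensity_eq m h0 h1 z hw, ← ENNReal.ofReal_mul (by positivity),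
      ← ENNReal.ofReal_mul (by positivity), ← ENNReal.ofReal_mul (by positivity)]
  · filter_upwards [ae_restrict_mem measurableSet_Ioc] with w hw
    exact mul_nonneg (by positivity)
      (interpolatingIntegrand_nonneg m h0 h1 _ _ (Set.Ioc_subset_Icc_self hw))

theorem isMeanEigenvalueDensity_interpolatingDensity (m : ℕ) {τ : ℝ} (h0 : 0 ≤ τ) (h1 : τ < 1) :
    IsMeanEigenvalueDensity (realGinibrePair (m + 2)) (interpolatingGinibre (m + 2) τ)
      (fun z : ℂ => interpolatingDensity (m + 2) τ z.re z.im) where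
  measurable := (continuous_interpolatingDensity m h0 h1).measurable
  nonneg z := interpolatingDensity_nonneg m h0 h1 z.re z.im
  lintegral_count A hA := by
    rw [lintegral_eigenvalueCount τ h0 h1 hA]
    simp_rw [lintegral_columnDensity_eq m h0 h1]

/-- At `τ = 0` the only dependence on `w` is `w ^ m`; its integral `1 / (m + 1)` and the factor `1 /
m!` cancel the `(m + 1)!` in the truncated series. -/
theorem interpolatingDensity_zero (m : ℕ) (x y : ℝ) :
    interpolatingDensity (m + 2) 0 x y = 1 / Real.pi * Real.exp (-(x ^ 2 + y ^ 2)) *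
      ∑ n ∈ Finset.range (m + 2), (x ^ 2 + y ^ 2) ^ n / (n.factorial : ℝ) := by
  have h2 : (((m + 2 : ℕ) : ℝ) - 1) = (m : ℝ) + 1 := by push_cast; ring
  have e : ∀ w, interpolatingIntegrand (m + 2) 0 x y w =
      w ^ m * (Real.exp (-(x ^ 2 + y ^ 2)) * truncExp (m + 1) (x ^ 2 + y ^ 2)) := by
    intro w
    simp [interpolatingIntegrand_eq]
  have hT : truncExp (m + 1) (x ^ 2 + y ^ 2) = (m + 1).factorial *
      ∑ n ∈ Finset.range (m + 2), (x ^ 2 + y ^ 2) ^ n / (n.factorial : ℝ) := by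
    rw [truncExp, Finset.mul_sum]
    exact Finset.sum_congr rfl fun n _ => by ring
  have hf : (0 : ℝ) < m.factorial := by exact_mod_cast m.factorial_pos
  simp_rw [interpolatingDensity, e]
  rw [h2, Real.Gamma_nat_eq_factorial, intervalIntegral.integral_mul_const, integral_pow, hT,
    Nat.factorial_succ]
  have hm : (m : ℝ) + 1 ≠ 0 := by positivity
  push_cast
  simp
  field_simp

end MeanDensity

theorem mainTheorem8 (N : ℕ) (hN : 2 ≤ N) :
    (∀ τ : ℝ, 0 ≤ τ → τ < 1 →
      (∀ x y : ℝ, IntervalIntegrable (interpolatingIntegrand N τ x y) volume 0 1) ∧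
      Continuous (fun z : ℂ => interpolatingDensity N τ z.re z.im) ∧
      IsMeanEigenvalueDensity (realGinibrePair N) (interpolatingGinibre N τ)
        (fun z : ℂ => interpolatingDensity N τ z.re z.im)) ∧
    (∀ x y : ℝ, interpolatingDensity N 0 x y =
      1 / Real.pi * Real.exp (-(x ^ 2 + y ^ 2)) *
        ∑ n ∈ Finset.range N, (x ^ 2 + y ^ 2) ^ n / (n.factorial : ℝ)) := by
  obtain ⟨m, rfl⟩ : ∃ m, N = m + 2 := ⟨N - 2, by omega⟩
  exact ⟨fun τ h0 h1 => ⟨intervalIntegrable_interpolatingIntegrand m h0 h1,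
    continuous_interpolatingDensity m h0 h1, isMeanEigenvalueDensity_interpolatingDensity m h0 h1⟩,
    interpolatingDensity_zero m⟩
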